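/- Let $\overline M$ be a smooth manifold with boundary, of dimension $n+1$, with boundary $\partial M$ and interior $M$, endowed with a projective structure, i.e. a projective equivalence class of (smooth, torsion-free) affine connections, where $\hat\nabla\sim\nabla$ if $\hat\nabla_\xi\eta=\nabla_\xi\eta+\Upsilon(\xi)\eta+\Upsilon(\eta)\xi$ for a smooth one-form $\Upsilon$. Let $\nabla$ be an affine connection on $M$ which lies in the restriction of the projective class to $M$. Then the following are equivalent: (a) $\nabla$ is the Levi-Civita connection of an Einstein metric $g$ of some signature on $M$ ($\mathrm{Ric}=c\,g$, $c$ constant) that is not Ricci-flat ($c\neq0$); (b) $\nabla$ is special, i.e. it preserves a nowhere vanishing volume density $\kappa$ on $M$, and $\nabla\,\mathrm{Ric}^\nabla=0$, and $\mathrm{Ric}^\nabla$ is non-degenerate. Suppose that $\nabla$ satisfies these conditions, and that no boundary point has a neighbourhood $U$ in $\overline M$ such that $\nabla|_{U\cap M}$ extends to a smooth affine connection on $U$. Then $\nabla$ is projectively compact of order $2$: every boundary point has a neighbourhood $U$ with a local defining function $\rho:U\to\mathbb R_{\ge0}$ for $\partial M$ (smooth, with $\rho^{-1}(0)=U\cap\partial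 M$ and $d\rho\ne0$ there) such that the connection $\nabla+\frac{d\rho}{2\rho}$ (projective change with $\Upsilon=\frac{d\rho}{2\rho}$) on $U\cap M$ extends smoothly to $U$. Moreover, for every nowhere vanishing $\nabla$-parallel volume density $\kappa$ on $M$, the density $\tau:=|\kappa|^{-2/(n+2)}$ of projective weight $2$ (where $\mathcal E(w)=\mathrm{vol}^{-w/(n+2)}$) extends smoothly by zero to a defining density for $\partial M$, i.e. a smooth section of $\mathcal E(2)$ over $\overline M$ whose zero locus is $\partial M$ and which near each boundary point is a local defining function times a nowhere vanishing section. This extension is a normal solution of the first BGG equation on $\mathcal E(2)$: with respect to any connection $\tilde\nabla$ on $\overline M$ in the projective class, with projective Schouten tensor $\mathsf P_{ab}$, the section $$L(\tau)=(\tau,\ \nu_a,\ \rho_{ab})=\bigl(\tau,\ \tfrac12\tilde\nabla_a\tau,\ \tfrac12\tilde\nabla_{(a}\tilde\nabla_{b)}\tau+\mathsf P_{(ab)}\tau\bigr)$$ of the symmetric square of the standard cotractor bundle is parallel for the tractor connection $$(\tau,\nu_b,\rho_{bc})\mapsto\bigl(\tilde\nabla_a\tau-2\nu_a,\ \tilde\nabla_a\nu_b+\mathsf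 P_{ab}\tau-\rho_{ab},\ \tilde\nabla_a\rho_{bc}+2\mathsf P_{a(b}\nu_{c)}\bigr)$$ on all of $\overline M$. Finally, $L(\tau)$ is non-degenerate at every point of $\overline M$ as a bilinear form on the standard tractor bundle, so that it defines a reduction of projective holonomy to an orthogonal group. -/

import Mathlib

open scoped Manifold ContDiff Topology

noncomputable section

namespace ProjCompact

/-! ### Densities on a vector space -/

section Density

variable {n : ℕ} {V : Type*} [AddCommGroup V] [Module ℝ V]

/-- Densities of order `r` on an `(n+1)`-dimensional real vector space `V`: functions `φ` of bases
of `V` with `φ (A e) = |det A| ^ r * φ e` (extended by zero to linearly dependent tuples). This is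
the fibre of the line bundle associated to the linear frame bundle by `A ↦ |det A| ^ r`. For `r = 1`
these are the volume densities, and order `r` corresponds to the `r`-th power of that line. -/
def densitySpace (n : ℕ) (r : ℝ) (V : Type*) [AddCommGroup V] [Module ℝ V] :
    Submodule ℝ ((Fin (n + 1) → V) → ℝ) where
  carrier := {φ | (∀ (A : V ≃ₗ[ℝ] V) (e : Fin (n + 1) → V),
      φ (fun i => A (e i)) = |LinearMap.det (A : V →ₗ[ℝ] V)| ^ r * φ e) ∧
    ∀ e : Fin (n + 1) → V, ¬ LinearIndependent ℝ e → φ e = 0}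
  add_mem' := by
    rintro φ ψ ⟨h1, h2⟩ ⟨h3, h4⟩
    refine ⟨fun A e => ?_, fun e he => ?_⟩
    · simp only [Pi.add_apply, h1, h3]; ring
    · simp [h2 e he, h4 e he]
  zero_mem' := ⟨fun A e => by simp, fun e _ => rfl⟩
  smul_mem' := by
    rintro c φ ⟨h1, h2⟩
    refine ⟨fun A e => ?_, fun e he => ?_⟩
    · simp only [Pi.smul_apply, h1, smul_eq_mul]; ring
    · simp [h2 e he]

open Classical in
/-- The density of order `r` taking the value `c` on the basis `b`. -/
def densityOfBasis (r : ℝ) (b : Module.Basis (Fin (n + 1)) ℝ V) (c : ℝ) : densitySpace n r V :=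
  ⟨fun e => if LinearIndependent ℝ e then |b.det e| ^ r * c else 0, by
    refine ⟨fun A e => ?_, fun e he => if_neg he⟩
    have hli : LinearIndependent ℝ (fun i => A (e i)) ↔ LinearIndependent ℝ e :=
      LinearMap.linearIndependent_iff (A : V →ₗ[ℝ] V) (by simp)
    have hdet : b.det (fun i => A (e i)) = LinearMap.det (A : V →ₗ[ℝ] V) * b.det e :=
      Module.Basis.det_comp b (A : V →ₗ[ℝ] V) e
    simp only [hli]
    split_ifs
    · rw [hdet, abs_mul, Real.mul_rpow (abs_nonneg _) (abs_nonneg _)]; ring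
    · simp⟩

lemma densityOfBasis_apply_self (r : ℝ) (b : Module.Basis (Fin (n + 1)) ℝ V) (c : ℝ) :
    (densityOfBasis r b c).1 b = c := by
  simp [densityOfBasis, b.linearIndependent, Module.Basis.det_self]

end Density

section Manifold

/- `M` is the manifold with boundary of dimension `n + 1` (written `M̄` on paper), and its interior
is `(𝓡∂ (n + 1)).interior M`. Objects which live on a subset only are represented by objects on all
of `M` whose values elsewhere are irrelevant. -/
variable {n : ℕ} {M : Type*} [TopologicalSpace M] [ChartedSpace (EuclideanHalfSpace (n + 1)) M]

/-- The tangent space of `M` at `x`. -/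
abbrev T (n : ℕ) {M : Type*} [TopologicalSpace M] [ChartedSpace (EuclideanHalfSpace (n + 1)) M]
    (x : M) : Type := TangentSpace (𝓡∂ (n + 1)) x

variable [IsManifold (𝓡∂ (n + 1)) ∞ M]

/-- Operators `η ↦ (x ↦ (ξ ↦ (∇_ξ η)(x)))` on vector fields; `∇_ξ η (x)` is `D η x ξ`. -/
abbrev ConnOp (n : ℕ) (M : Type*) [TopologicalSpace M]
    [ChartedSpace (EuclideanHalfSpace (n + 1)) M] : Type _ :=
  ((x : M) → T n x) → (x : M) → T n x →L[ℝ] T n x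

/-- The vector field `X` is smooth on `u`. -/
def SmoothVF (X : (x : M) → T n x) (u : Set M) : Prop :=
  ContMDiffOn (𝓡∂ (n + 1)) ((𝓡∂ (n + 1)).prod 𝓘(ℝ, EuclideanSpace ℝ (Fin (n + 1)))) ∞
    (fun x => (⟨x, X x⟩ : TangentBundle (𝓡∂ (n + 1)) M)) u

/-- The vector field `X` is differentiable at `x`. -/
def DiffVFAt (X : (x : M) → T n x) (x : M) : Prop :=
  MDifferentiableAt (𝓡∂ (n + 1)) ((𝓡∂ (n + 1)).prod 𝓘(ℝ, EuclideanSpace ℝ (Fin (n + 1))))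
    (fun y => (⟨y, X y⟩ : TangentBundle (𝓡∂ (n + 1)) M)) x

/-- The differential of a real function at `x`. -/
def dAt (f : M → ℝ) (x : M) : T n x →L[ℝ] ℝ := mvfderiv (𝓡∂ (n + 1)) f x

/-- A basis of the tangent space at `x`. -/
def tBasis (x : M) : Module.Basis (Fin (n + 1)) ℝ (T n x) :=
  (EuclideanSpace.basisFun (Fin (n + 1)) ℝ).toBasis

/-- An extension of a tangent vector at `x` to a vector field that is smooth near `x`. -/
def ext {x : M} (v : T n x) : (y : M) → T n y :=
  FiberBundle.extend (EuclideanSpace ℝ (Fin (n + 1))) v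

/-! ### Affine connections -/

/-- `D` is an affine connection on the (open) set `u`: a smooth torsion-free linear connection on
the tangent bundle of `u`. -/
structure IsAffineConnectionOn (D : ConnOp n M) (u : Set M) : Prop where
  isCovariantDerivativeOn :
    IsCovariantDerivativeOn (I := 𝓡∂ (n + 1)) (EuclideanSpace ℝ (Fin (n + 1))) D u
  smooth : ContMDiffCovariantDerivativeOn (I := 𝓡∂ (n + 1)) (EuclideanSpace ℝ (Fin (n + 1))) ∞ D u
  torsionFree : ∀ (X Y : (x : M) → T n x), ∀ x ∈ u, DiffVFAt X x → DiffVFAt Y x →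
    D Y x (X x) - D X x (Y x) = VectorField.mlieBracket (𝓡∂ (n + 1)) X Y x

/-- `D' = D + Υ` on `u`, i.e. `D'_ξ η = D_ξ η + Υ(ξ) η + Υ(η) ξ`. -/
def IsProjectiveChangeOn (D D' : ConnOp n M) (Υ : (x : M) → T n x →L[ℝ] ℝ) (u : Set M) : Prop :=
  ∀ (η : (x : M) → T n x), ∀ x ∈ u, DiffVFAt η x → ∀ ξ : T n x,
    D' η x ξ = D η x ξ + Υ x ξ • η x + Υ x (η x) • ξ

/-- The one-form `Υ` is smooth on `u`. -/
def SmoothOneFormOn (Υ : (x : M) → T n x →L[ℝ] ℝ) (u : Set M) : Prop :=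
  ∀ X : (x : M) → T n x, SmoothVF X u →
    ContMDiffOn (𝓡∂ (n + 1)) 𝓘(ℝ) ∞ (fun x => Υ x (X x)) u

/-- Projective equivalence of connections on `u`. -/
def ProjectivelyEquivalentOn (D D' : ConnOp n M) (u : Set M) : Prop :=
  ∃ Υ : (x : M) → T n x →L[ℝ] ℝ, SmoothOneFormOn Υ u ∧ IsProjectiveChangeOn D D' Υ u

/-- A projective structure on `M`: a projective equivalence class of affine connections on `M`. -/
structure ProjectiveStructure (n : ℕ) (M : Type*) [TopologicalSpace M]
    [ChartedSpace (EuclideanHalfSpace (n + 1)) M] [IsManifold (𝓡∂ (n + 1)) ∞ M] where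
  conns : Set (ConnOp n M)
  nonempty : conns.Nonempty
  isAffineConnection : ∀ D ∈ conns, IsAffineConnectionOn D Set.univ
  mem_iff : ∀ D ∈ conns, ∀ D' : ConnOp n M, IsAffineConnectionOn D' Set.univ →
    (D' ∈ conns ↔ ProjectivelyEquivalentOn D D' Set.univ)

/-- `nabla` is an affine connection on the interior which belongs to the restriction of the
projective class `p` to the interior. -/
def ProjectiveStructure.HasOnInterior (p : ProjectiveStructure n M) (nabla : ConnOp n M) : Prop :=
  IsAffineConnectionOn nabla ((𝓡∂ (n + 1)).interior M) ∧
    ∃ D ∈ p.conns, ProjectivelyEquivalentOn D nabla ((𝓡∂ (n + 1)).interior M)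

/-- The affine connection `nabla` on the interior does not extend smoothly to any neighbourhood of
any boundary point. -/
def DoesNotExtend (nabla : ConnOp n M) : Prop :=
  ∀ x ∈ (𝓡∂ (n + 1)).boundary M, ¬ ∃ (U : Set M) (D : ConnOp n M), IsOpen U ∧ x ∈ U ∧
    IsAffineConnectionOn D U ∧
    ∀ (η : (x : M) → T n x), ∀ y ∈ U ∩ (𝓡∂ (n + 1)).interior M, DiffVFAt η y →
      D η y = nabla η y

/-! ### Projective compactness -/

/-- `ρ` is a local defining function, on the open set `U`, for the boundary. -/
structure IsDefiningFunctionOn (ρ : M → ℝ) (U : Set M) : Prop where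
  smooth : ContMDiffOn (𝓡∂ (n + 1)) 𝓘(ℝ) ∞ ρ U
  nonneg : ∀ y ∈ U, 0 ≤ ρ y
  zero_iff : ∀ y ∈ U, ρ y = 0 ↔ y ∈ (𝓡∂ (n + 1)).boundary M
  d_ne_zero : ∀ y ∈ U, ρ y = 0 → dAt (n := n) ρ y ≠ 0

/-- The affine connection `nabla` on the interior is projectively compact of order `α`: near every
boundary point, `nabla + dρ / (α ρ)` extends to the boundary, for a local defining function `ρ`. -/
def IsProjectivelyCompact (α : ℝ) (nabla : ConnOp n M) : Prop :=
  ∀ x ∈ (𝓡∂ (n + 1)).boundary M, ∃ (U : Set M) (ρ : M → ℝ) (D : ConnOp n M), IsOpen U ∧ x ∈ U ∧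
    IsDefiningFunctionOn (n := n) ρ U ∧ IsAffineConnectionOn D U ∧
    IsProjectiveChangeOn nabla D (fun y => (α * ρ y)⁻¹ • dAt (n := n) ρ y)
      (U ∩ (𝓡∂ (n + 1)).interior M)

/-! ### Curvature -/

/-- The curvature `R(X, Y) Z = ∇_X ∇_Y Z - ∇_Y ∇_X Z - ∇_[X, Y] Z` on vector fields. -/
def curvature (D : ConnOp n M) (X Y Z : (x : M) → T n x) (x : M) : T n x :=
  D (fun y => D Z y (Y y)) x (X x) - D (fun y => D Z y (X y)) x (Y x)
    - D Z x (VectorField.mlieBracket (𝓡∂ (n + 1)) X Y x)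

/-- The Ricci curvature `Ric(v, w) = tr (u ↦ R(u, v) w)`. -/
def ricci (D : ConnOp n M) (x : M) (v w : T n x) : ℝ :=
  ∑ i, (tBasis x).repr (curvature D (ext (tBasis x i)) (ext v) (ext w) x) i

/-- The projective Schouten tensor `P_ab = (m Ric_ab + Ric_ba) / (m² - 1)`, where `m = n + 1` is the
dimension; it equals `Ric_ab / (m - 1)` if the Ricci tensor is symmetric. -/
def schouten (D : ConnOp n M) (x : M) (v w : T n x) : ℝ :=
  (((n : ℝ) + 1) * ricci D x v w + ricci D x w v) / (((n : ℝ) + 1) ^ 2 - 1)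

/-- The covariant derivative `(∇_u B)(v, w)` of a bilinear form field `B`. -/
def covDerivBilin (D : ConnOp n M) (B : (x : M) → T n x → T n x → ℝ) (x : M) (u v w : T n x) : ℝ :=
  dAt (fun y => B y (ext v y) (ext w y)) x u - B x (D (ext v) x u) w - B x v (D (ext w) x u)

/-- `∇ Ric = 0` on the interior. -/
def RicciParallel (nabla : ConnOp n M) : Prop :=
  ∀ x ∈ (𝓡∂ (n + 1)).interior M, ∀ u v w : T n x, covDerivBilin nabla (ricci nabla) x u v w = 0

/-- The Ricci curvature is non-degenerate on the interior. -/
def RicciNondegenerate (nabla : ConnOp n M) : Prop :=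
  ∀ x ∈ (𝓡∂ (n + 1)).interior M, ∀ v : T n x, (∀ w : T n x, ricci nabla x v w = 0) → v = 0

/-! ### Pseudo-Riemannian metrics -/

/-- `g` is a (smooth) pseudo-Riemannian metric on `u`. -/
structure IsPseudoRiemannianMetricOn (g : (x : M) → T n x →ₗ[ℝ] T n x →ₗ[ℝ] ℝ) (u : Set M) :
    Prop where
  symm : ∀ x ∈ u, ∀ v w : T n x, g x v w = g x w v
  nondegenerate : ∀ x ∈ u, ∀ v : T n x, (∀ w : T n x, g x v w = 0) → v = 0
  smooth : ∀ X Y : (x : M) → T n x, SmoothVF X u → SmoothVF Y u →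
    ContMDiffOn (𝓡∂ (n + 1)) 𝓘(ℝ) ∞ (fun x => g x (X x) (Y x)) u

/-- `D` is the Levi-Civita connection of `g` on `u`. -/
def IsLeviCivitaOn (D : ConnOp n M) (g : (x : M) → T n x →ₗ[ℝ] T n x →ₗ[ℝ] ℝ) (u : Set M) : Prop :=
  IsAffineConnectionOn D u ∧
    ∀ x ∈ u, ∀ a v w : T n x, covDerivBilin D (fun y v w => g y v w) x a v w = 0

/-- On the interior, `nabla` is the Levi-Civita connection of an Einstein metric (`Ric = c g` with
`c` constant) that is not Ricci-flat. -/
def IsLeviCivitaOfNonRicciFlatEinstein (nabla : ConnOp n M) : Prop :=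
  ∃ g : (x : M) → T n x →ₗ[ℝ] T n x →ₗ[ℝ] ℝ,
    IsPseudoRiemannianMetricOn g ((𝓡∂ (n + 1)).interior M) ∧
    IsLeviCivitaOn nabla g ((𝓡∂ (n + 1)).interior M) ∧
    ∃ c : ℝ, c ≠ 0 ∧ ∀ x ∈ (𝓡∂ (n + 1)).interior M, ∀ v w : T n x,
      ricci nabla x v w = c * g x v w

/-! ### Density bundles -/

/-- The fibre at `x` of the bundle of densities of order `r`, i.e. of the `r`-th power of the bundle
of volume densities. -/
abbrev Dens (n : ℕ) {M : Type*} [TopologicalSpace M] [ChartedSpace (EuclideanHalfSpace (n + 1)) M]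
    (r : ℝ) (x : M) : Type := densitySpace n r (T n x)

/-- The fibre at `x` of the bundle of densities of projective weight `w`. -/
abbrev ProjDens (n : ℕ) {M : Type*} [TopologicalSpace M]
    [ChartedSpace (EuclideanHalfSpace (n + 1)) M] (w : ℝ) (x : M) : Type :=
  Dens n (-w / ((n : ℝ) + 2)) x

/-- The density field `σ` is smooth on `u`: its values on smooth local frames are smooth. -/
def SmoothDensOn {r : ℝ} (σ : (x : M) → Dens n r x) (u : Set M) : Prop :=
  ∀ (e : Fin (n + 1) → (x : M) → T n x) (V : Set M), IsOpen V → V ⊆ u →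
    IsLocalFrameOn (𝓡∂ (n + 1)) (EuclideanSpace ℝ (Fin (n + 1))) ∞ e V →
    ContMDiffOn (𝓡∂ (n + 1)) 𝓘(ℝ) ∞ (fun x => (σ x).1 (fun i => e i x)) V

/-- The connection induced by `D` on densities of order `r`: on a local frame `e`,
`(∇_v σ)(e) = v (σ(e)) - r tr(θ(v)) σ(e)`, where `∇_v e_j = ∑ θ^i_j(v) e_i`. -/
def covDerivDens {r : ℝ} (D : ConnOp n M) (σ : (x : M) → Dens n r x) (x : M) (v : T n x) :
    Dens n r x :=
  densityOfBasis r (tBasis x)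
    (dAt (fun y => (σ y).1 (fun i => ext (tBasis x i) y)) x v
      - r * (∑ i, (tBasis x).repr (D (ext (tBasis x i)) x v) i) * (σ x).1 (tBasis x))

/-- `κ` is a smooth, nowhere vanishing section of the bundle of volume densities over the interior,
parallel for `nabla`. -/
structure IsParallelVolume (nabla : ConnOp n M) (κ : (x : M) → Dens n 1 x) : Prop where
  smooth : SmoothDensOn κ ((𝓡∂ (n + 1)).interior M)
  ne_zero : ∀ x ∈ (𝓡∂ (n + 1)).interior M, κ x ≠ 0
  parallel : ∀ x ∈ (𝓡∂ (n + 1)).interior M, ∀ v : T n x, covDerivDens nabla κ x v = 0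

/-- `nabla` is special, i.e. it preserves a volume density. -/
def IsSpecial (nabla : ConnOp n M) : Prop :=
  ∃ κ : (x : M) → Dens n 1 x, IsParallelVolume nabla κ

/-- `σ` is a defining density for the boundary. -/
structure IsDefiningDensity {r : ℝ} (σ : (x : M) → Dens n r x) : Prop where
  smooth : SmoothDensOn σ Set.univ
  zero_iff : ∀ x : M, σ x = 0 ↔ x ∈ (𝓡∂ (n + 1)).boundary M
  locally_defining : ∀ x ∈ (𝓡∂ (n + 1)).boundary M,
    ∃ (U : Set M) (σ' : (x : M) → Dens n r x) (ρ : M → ℝ), IsOpen U ∧ x ∈ U ∧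
      SmoothDensOn σ' U ∧ (∀ y ∈ U, σ' y ≠ 0) ∧ IsDefiningFunctionOn (n := n) ρ U ∧
      ∀ y ∈ U, σ y = ρ y • σ' y

/-! ### Tractors and the first BGG equation on densities of weight two -/

/-- Sections of the symmetric square of the standard cotractor bundle, in the splitting determined
by a connection in the projective class: triples `(τ, ν_a, ρ_ab)`. -/
structure S2Cotractor (n : ℕ) (M : Type*) [TopologicalSpace M]
    [ChartedSpace (EuclideanHalfSpace (n + 1)) M] where
  top : (x : M) → ProjDens n 2 x
  mid : (x : M) → T n x → ProjDens n 2 x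
  bot : (x : M) → T n x → T n x → ProjDens n 2 x

/-- The covariant derivative `(∇_u ν)(v)` of a density-valued one-form. -/
def covDerivDensForm {r : ℝ} (D : ConnOp n M) (ν : (x : M) → T n x → Dens n r x) (x : M)
    (u v : T n x) : Dens n r x :=
  covDerivDens D (fun y => ν y (ext v y)) x u - ν x (D (ext v) x u)

/-- The covariant derivative `(∇_u ρ)(v, w)` of a density-valued bilinear form. -/
def covDerivDensBilin {r : ℝ} (D : ConnOp n M) (ρ : (x : M) → T n x → T n x → Dens n r x) (x : M)
    (u v w : T n x) : Dens n r x :=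
  covDerivDens D (fun y => ρ y (ext v y) (ext w y)) x u - ρ x (D (ext v) x u) w
    - ρ x v (D (ext w) x u)

/-- `S` is parallel for the tractor connection, which in the splitting determined by `D` is
`(τ, ν_b, ρ_bc) ↦ (∇_a τ - 2 ν_a, ∇_a ν_b + P_ab τ - ρ_ab, ∇_a ρ_bc + P_ab ν_c + P_ac ν_b)`. -/
def S2Cotractor.IsParallel (D : ConnOp n M) (S : S2Cotractor n M) : Prop :=
  ∀ (x : M) (u v w : T n x),
    covDerivDens D S.top x u - (2 : ℝ) • S.mid x u = 0 ∧
    covDerivDensForm D S.mid x u v + schouten D x u v • S.top x - S.bot x u v = 0 ∧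
    covDerivDensBilin D S.bot x u v w + schouten D x u v • S.mid x w
      + schouten D x u w • S.mid x v = 0

/-- The BGG splitting operator `L(τ) = (τ, ½ ∇_a τ, ½ ∇_(a ∇_b) τ + P_(ab) τ)`, in the splitting
determined by `D`. -/
def splitting (D : ConnOp n M) (τ : (x : M) → ProjDens n 2 x) : S2Cotractor n M where
  top := τ
  mid := fun x v => (1 / 2 : ℝ) • covDerivDens D τ x v
  bot := fun x v w =>
    (1 / 2 : ℝ) •
      (covDerivDensForm D (fun y a => (1 / 2 : ℝ) • covDerivDens D τ y a) x v w
        + covDerivDensForm D (fun y a => (1 / 2 : ℝ) • covDerivDens D τ y a) x w v)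
      + ((1 / 2 : ℝ) * (schouten D x v w + schouten D x w v)) • τ x

/-- `τ` is a normal solution of the first BGG equation on densities of weight two, i.e. the tractor
section `L(τ)` is parallel (the equation itself, `∇_(a ρ_bc) + 2 P_(ab ν_c) = 0` for the components
of `L(τ)`, only asks for a part of this to vanish; parallelism is tested in the splittings given by all
connections in the class). -/
def IsNormalBGGSolution (p : ProjectiveStructure n M) (τ : (x : M) → ProjDens n 2 x) : Prop :=
  ∀ D ∈ p.conns, (splitting D τ).IsParallel D

/-- Non-degeneracy at every point of `S` as a symmetric bilinear form on standard tractors, which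
in a splitting are pairs `(a, v)`, up to a twist by densities of weight `-1`. -/
def S2Cotractor.IsNondegenerate (S : S2Cotractor n M) : Prop :=
  ∀ (x : M) (a : ℝ) (v : T n x),
    (∀ (b : ℝ) (w : T n x),
      (a * b) • S.top x + a • S.mid x w + b • S.mid x v + S.bot x v w = 0) → a = 0 ∧ v = 0

end Manifold

end ProjCompact

end

noncomputable section

open scoped Matrix

set_option linter.unusedSectionVars false

namespace ProjCompact

section

variable {n : ℕ} {M : Type*} [TopologicalSpace M] [ChartedSpace (EuclideanHalfSpace (n + 1)) M]
  [IsManifold (𝓡∂ (n + 1)) ∞ M]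

/-! Write ∇ = D + Υ on the interior, with D in the projective class and hence smooth up to the
boundary. If κ is ∇-parallel, so is τ = |κ|^(-2/(n+2)), and in the splitting of ∇ the tractor L(τ)
is (τ, 0, P τ). Here P = Ric/n, the Ricci tensor being symmetric because ∇ is special
(`IsParallelVolume.Ric_symm`), and ∇Ric = 0 makes this tractor parallel. Expressed through D, its
components are s, -Υ s and (P + Υ⊗Υ) s, where s represents τ in a chart. That these satisfy the
tractor equations of D on the interior is a coordinate computation based on the change of the
Schouten tensor (`Sch_change`, `nuC_int`, `rhoC_int`, `cdF_add_Sch_int`, `cdB_add_Sch_int`).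

Although Υ is singular at the boundary, the tractor connection of D is not. The components of L(τ)
form a symmetric matrix H with dH = W H + H Wᵀ, where W is smooth up to the boundary (`pd_Hm`). A
solution of such a closed linear system on a half-ball is bounded by Gronwall, hence Lipschitz,
hence extends continuously; the equation then bootstraps the extension to a smooth one
(`exists_contDiffOn_extension`, `exists_smooth_extension`). On the interior H is invertible because
Ric is non-degenerate (`Hm_det_ne_zero`), and its inverse solves the dual system (`pd_matrix_inv`),
so the inverse extends too and H stays invertible on the boundary. All identities pass to the
boundary because the interior is dense (`eq_zero_of_int`). The result is `exists_density_extension`.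

That ∇ does not extend enters only now. Where the extended density is non-zero, Υ = -ν/s is smooth,
so ∇ would extend; hence s = 0 on the boundary (`DoesNotExtend.eq_zero`). If also ds = 0 at a
boundary point, then s and ν vanish there, H has a zero row, and invertibility fails; so s is a
defining function. Finally ν = -Υ s says that Υ + ds/(2s) is a constant multiple of the trace of the
connection form of D, which is smooth up to the boundary: this is projective compactness of order
two (`isProjectivelyCompact_two`).

For the equivalence (`isLeviCivita_iff`), an Einstein metric has parallel volume density and Ric = c
g with c ≠ 0; conversely Ric itself serves as the metric.

All computations take place in coordinate frames, whose fields commute. The definitions use fields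
`ext v` instead, so the coordinate formulas also show that the choice of extension does not matter.
-/

lemma two_le_infty : (2 : WithTop ℕ∞) ≤ ∞ :=
  WithTop.coe_le_coe.2 (le_top : (2 : ℕ∞) ≤ ⊤)

/-! ### The coordinate frame of a chart -/

/-- The real function `f` is smooth on `u`. -/
abbrev SmoothFn (n : ℕ) {M : Type*} [TopologicalSpace M]
    [ChartedSpace (EuclideanHalfSpace (n + 1)) M] (f : M → ℝ) (u : Set M) : Prop :=
  ContMDiffOn (𝓡∂ (n + 1)) 𝓘(ℝ) ∞ f u

/-- The real function `f` is differentiable at `x`. -/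
abbrev DiffFnAt (n : ℕ) {M : Type*} [TopologicalSpace M]
    [ChartedSpace (EuclideanHalfSpace (n + 1)) M] (f : M → ℝ) (x : M) : Prop :=
  MDifferentiableAt (𝓡∂ (n + 1)) 𝓘(ℝ) f x

/-- The domain of the preferred chart at `p`. -/
abbrev dom (n : ℕ) {M : Type*} [TopologicalSpace M]
    [ChartedSpace (EuclideanHalfSpace (n + 1)) M] (p : M) : Set M :=
  (chartAt (EuclideanHalfSpace (n + 1)) p).source

/-- The coordinate vector fields of the preferred chart at `p`. -/
def fr (p : M) (i : Fin (n + 1)) : (y : M) → T n y :=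
  (trivializationAt (EuclideanSpace ℝ (Fin (n + 1))) (TangentSpace (𝓡∂ (n + 1)))
    p).localFrame (EuclideanSpace.basisFun (Fin (n + 1)) ℝ).toBasis i

/-- The coordinate one-forms of the preferred chart at `p`. -/
def co (p : M) (i : Fin (n + 1)) (y : M) : T n y →ₗ[ℝ] ℝ :=
  (trivializationAt (EuclideanSpace ℝ (Fin (n + 1))) (TangentSpace (𝓡∂ (n + 1)))
    p).localFrameCoeff (𝓡∂ (n + 1)) (EuclideanSpace.basisFun (Fin (n + 1)) ℝ).toBasis i y

lemma dom_eq_baseSet (p : M) : dom n p = (trivializationAt (EuclideanSpace ℝ (Fin (n + 1)))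
    (TangentSpace (𝓡∂ (n + 1))) p).baseSet := by
  simp [dom]

lemma mem_baseSet {p y : M} (hy : y ∈ dom n p) :
    y ∈ (trivializationAt (EuclideanSpace ℝ (Fin (n + 1)))
      (TangentSpace (𝓡∂ (n + 1))) p).baseSet := by
  rwa [← dom_eq_baseSet]

lemma isOpen_dom (p : M) : IsOpen (dom n p) := (chartAt _ p).open_source

lemma mem_dom (p : M) : p ∈ dom n p := mem_chart_source _ p

/-- The coordinate basis of the tangent space. -/
def frBasis (p : M) {y : M} (hy : y ∈ dom n p) : Module.Basis (Fin (n + 1)) ℝ (T n y) :=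
  (trivializationAt (EuclideanSpace ℝ (Fin (n + 1))) (TangentSpace (𝓡∂ (n + 1)))
    p).basisAt (EuclideanSpace.basisFun (Fin (n + 1)) ℝ).toBasis (mem_baseSet hy)

lemma frBasis_apply (p : M) {y : M} (hy : y ∈ dom n p) (i : Fin (n + 1)) :
    frBasis p hy i = fr p i y := by
  rw [fr, Bundle.Trivialization.localFrame_apply_of_mem_baseSet _ _ (mem_baseSet hy)]; rfl

lemma co_apply (p : M) {y : M} (hy : y ∈ dom n p) (i : Fin (n + 1)) (v : T n y) :
    co p i y v = (frBasis p hy).repr v i := by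
  classical
  -- Coefficients are evaluated on fields; any field with value `v` at `y` will do, and the one
  -- supported at `y` needs no regularity.
  have := Bundle.Trivialization.localFrameCoeff_apply_of_mem_baseSet (I := 𝓡∂ (n + 1))
    (trivializationAt (EuclideanSpace ℝ (Fin (n + 1))) (TangentSpace (𝓡∂ (n + 1))) p)
    (EuclideanSpace.basisFun (Fin (n + 1)) ℝ).toBasis (x := y) (mem_baseSet hy)
    (fun z => if h : z = y then h ▸ v else 0) i
  simp only [dif_pos] at this
  exact this

lemma sum_co_fr (p : M) {y : M} (hy : y ∈ dom n p) (v : T n y) :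
    ∑ i, co p i y v • fr p i y = v := by
  simp_rw [co_apply p hy, ← frBasis_apply p hy]
  exact (frBasis p hy).sum_repr v

lemma co_fr (p : M) {y : M} (hy : y ∈ dom n p) (i j : Fin (n + 1)) :
    co p i y (fr p j y) = if i = j then 1 else 0 := by
  rw [co_apply p hy, ← frBasis_apply p hy]
  simp [Finsupp.single_apply, eq_comm]

lemma fr_smooth (p : M) (i : Fin (n + 1)) : SmoothVF (fr p i) (dom n p) := by
  rw [dom_eq_baseSet]
  exact Bundle.Trivialization.contMDiffOn_localFrame_baseSet _ _ _ i

lemma smoothVF_iff (p : M) {X : (x : M) → T n x} {u : Set M} (hu : IsOpen u) (hup : u ⊆ dom n p) :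
    SmoothVF X u ↔ ∀ i, SmoothFn n (fun y => co p i y (X y)) u :=
  contMDiffOn_iff_localFrameCoeff
    (EuclideanSpace.basisFun (Fin (n + 1)) ℝ).toBasis hu (by rwa [← dom_eq_baseSet])

lemma diffVFAt_iff (p : M) {X : (x : M) → T n x} {y : M} (hy : y ∈ dom n p) :
    DiffVFAt X y ↔ ∀ i, DiffFnAt n (fun y => co p i y (X y)) y :=
  mdifferentiableAt_iff_localFrameCoeff
    (EuclideanSpace.basisFun (Fin (n + 1)) ℝ).toBasis (mem_baseSet hy)

lemma SmoothVF.diffVFAt {X : (x : M) → T n x} {u : Set M} (hX : SmoothVF X u) (hu : IsOpen u)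
    {y : M} (hy : y ∈ u) : DiffVFAt X y :=
  (hX.contMDiffAt (hu.mem_nhds hy)).mdifferentiableAt (by simp)

lemma SmoothFn.diffFnAt {f : M → ℝ} {u : Set M} (hf : SmoothFn n f u) (hu : IsOpen u)
    {y : M} (hy : y ∈ u) : DiffFnAt n f y :=
  (hf.contMDiffAt (hu.mem_nhds hy)).mdifferentiableAt (by simp)

lemma fr_diff (p : M) (i : Fin (n + 1)) {y : M} (hy : y ∈ dom n p) : DiffVFAt (fr p i) y :=
  (fr_smooth p i).diffVFAt (isOpen_dom p) hy

lemma fr_eq_symmL {p y : M} (hy : y ∈ dom n p) (i : Fin (n + 1)) : fr p i y =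
    (trivializationAt (EuclideanSpace ℝ (Fin (n + 1))) (TangentSpace (𝓡∂ (n + 1))) p).symmL ℝ y
      ((EuclideanSpace.basisFun (Fin (n + 1)) ℝ).toBasis i) := by
  rw [← frBasis_apply p hy]
  simp [frBasis, Bundle.Trivialization.basisAt,
    Bundle.Trivialization.symmL_apply _ (mem_baseSet hy)]

lemma ext_apply_self {x : M} (v : T n x) : ext v x = v := by
  simp [ext]

/-- The extension is constant in the trivialization at its base point, so its coefficients in the
coordinate frame of the chart at `x` do not vary. In the chart at another point they do, which is
why derivatives of `ext v` appear in later formulas. -/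
lemma ext_eq_sum {x : M} (v : T n x) {y : M} (hy : y ∈ dom n x) :
    ext v y = ∑ i, co x i x v • fr x i y := by
  have h : ∀ (z : M) (hz : z ∈ dom n x) (i : Fin (n + 1)), fr x i z =
      (trivializationAt (EuclideanSpace ℝ (Fin (n + 1))) (TangentSpace (𝓡∂ (n + 1))) x).symmL ℝ z
        ((EuclideanSpace.basisFun (Fin (n + 1)) ℝ).toBasis i) := fun z hz i => fr_eq_symmL hz i
  have hv : v = (trivializationAt (EuclideanSpace ℝ (Fin (n + 1))) (TangentSpace (𝓡∂ (n + 1)))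
      x).symmL ℝ x (∑ i, co x i x v • (EuclideanSpace.basisFun (Fin (n + 1)) ℝ).toBasis i) := by
    conv_lhs => rw [← sum_co_fr x (mem_dom x) v]
    simp only [map_sum, map_smul, h x (mem_dom x)]
  simp only [h y hy, ← map_smul, ← map_sum]
  unfold ext FiberBundle.extend
  conv_lhs => rw [hv]
  rw [Bundle.Trivialization.symmL_apply _ (mem_baseSet (mem_dom x)),
    Bundle.Trivialization.symmL_apply _ (mem_baseSet hy), Bundle.Trivialization.apply_mk_symm _ (mem_baseSet (mem_dom x))]

lemma ext_smooth {x : M} (v : T n x) : SmoothVF (ext v) (dom n x) := by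
  rw [smoothVF_iff x (isOpen_dom x) le_rfl]
  intro i
  refine ContMDiffOn.congr (f := fun _ => co x i x v) contMDiffOn_const fun y hy => ?_
  rw [ext_eq_sum v hy]
  simp [co_fr x hy]

lemma ext_diff {x : M} (v : T n x) : DiffVFAt (ext v) x :=
  (ext_smooth v).diffVFAt (isOpen_dom x) (mem_dom x)

/-! ### Coordinate derivatives -/

/-- The partial derivatives of a function in the preferred chart at `p`. -/
def pd (p : M) (i : Fin (n + 1)) (f : M → ℝ) (y : M) : ℝ := dAt (n := n) f y (fr p i y)

lemma dAt_eq_sum (p : M) {y : M} (hy : y ∈ dom n p) (f : M → ℝ) (v : T n y) :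
    dAt f y v = ∑ i, co p i y v * pd p i f y := by
  conv_lhs => rw [← sum_co_fr p hy v]
  simp [pd]

lemma dAt_congr {f g : M → ℝ} {y : M} (h : f =ᶠ[𝓝 y] g) : dAt (n := n) f y = dAt g y := by
  ext v
  simp only [dAt, mvfderiv]
  have h1 := h.mfderiv_eq (I := 𝓡∂ (n + 1)) (I' := 𝓘(ℝ))
  have h2 := congrArg (fun L => L v) h1
  exact h2

lemma pd_congr (p : M) (i : Fin (n + 1)) {f g : M → ℝ} {y : M} (h : f =ᶠ[𝓝 y] g) :
    pd p i f y = pd p i g y := by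
  simp only [pd, dAt_congr h]

lemma pd_congr_of_eqOn (p : M) (i : Fin (n + 1)) {f g : M → ℝ} {u : Set M} (hu : IsOpen u)
    (h : ∀ y ∈ u, f y = g y) {y : M} (hy : y ∈ u) : pd p i f y = pd p i g y :=
  pd_congr p i (Filter.eventuallyEq_of_mem (hu.mem_nhds hy) h)

lemma dAt_add {f g : M → ℝ} {y : M} (hf : DiffFnAt n f y) (hg : DiffFnAt n g y) (v : T n y) :
    dAt (fun z => f z + g z) y v = dAt f y v + dAt g y v := by
  simp [dAt, mvfderiv_fun_add hf hg]

lemma dAt_mul {f g : M → ℝ} {y : M} (hf : DiffFnAt n f y) (hg : DiffFnAt n g y) (v : T n y) :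
    dAt (fun z => f z * g z) y v = f y * dAt g y v + g y * dAt f y v := by
  simp [dAt, mvfderiv_fun_mul hf hg]

lemma dAt_const (c : ℝ) {y : M} (v : T n y) : dAt (fun _ => c) y v = 0 := by
  simp [dAt, mvfderiv_const]

lemma dAt_sum {ι : Type*} (s : Finset ι) {f : ι → M → ℝ} {y : M}
    (hf : ∀ i ∈ s, DiffFnAt n (f i) y) (v : T n y) :
    dAt (fun z => ∑ i ∈ s, f i z) y v = ∑ i ∈ s, dAt (f i) y v := by
  classical
  have hd : ∀ t ⊆ s, DiffFnAt n (fun z => ∑ i ∈ t, f i z) y := fun t ht => by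
    induction t using Finset.induction_on with
    | empty => simpa using mdifferentiableAt_const
    | insert a t ha ih =>
      simp only [Finset.sum_insert ha]
      exact (hf a (ht (Finset.mem_insert_self a t))).add
        (ih ((Finset.subset_insert a t).trans ht))
  suffices h : ∀ t ⊆ s, dAt (fun z => ∑ i ∈ t, f i z) y v = ∑ i ∈ t, dAt (f i) y v from h s le_rfl
  intro t
  induction t using Finset.induction_on with
  | empty => intro _; simpa using dAt_const 0 v
  | insert a t ha ih =>
    intro ht
    have ht' := (Finset.subset_insert a t).trans ht
    simp only [Finset.sum_insert ha]
    rw [dAt_add (hf a (ht (Finset.mem_insert_self a t))) (hd t ht'), ih ht']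

lemma dAt_comp {f : M → ℝ} {F : ℝ → ℝ} {F' : ℝ} {y : M} (hf : DiffFnAt n f y)
    (hF : HasDerivAt F F' (f y)) (v : T n y) : dAt (fun z => F (f z)) y v = F' * dAt f y v := by
  have h := (hF.hasFDerivAt.hasMFDerivAt.comp y hf.hasMFDerivAt).mfderiv
  have h2 := congrArg (fun L => L v) h
  refine h2.trans ?_
  simp only [dAt, mvfderiv]
  exact mul_comm (G := ℝ) _ _

/-! ### Algebra of smooth functions. -/

namespace SmoothFn

variable {f g : M → ℝ} {u : Set M}

lemma const (c : ℝ) (u : Set M) : SmoothFn n (fun _ => c) u := contMDiffOn_const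

lemma add (hf : SmoothFn n f u) (hg : SmoothFn n g u) : SmoothFn n (fun y => f y + g y) u :=
  ContMDiffOn.add hf hg

lemma sub (hf : SmoothFn n f u) (hg : SmoothFn n g u) : SmoothFn n (fun y => f y - g y) u :=
  ContMDiffOn.sub hf hg

lemma mul (hf : SmoothFn n f u) (hg : SmoothFn n g u) : SmoothFn n (fun y => f y * g y) u :=
  ContMDiffOn.mul hf hg

lemma neg (hf : SmoothFn n f u) : SmoothFn n (fun y => - f y) u := ContMDiffOn.neg hf

lemma const_mul (c : ℝ) (hf : SmoothFn n f u) : SmoothFn n (fun y => c * f y) u :=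
  (const c u).mul hf

lemma sum {ι : Type*} (s : Finset ι) {f : ι → M → ℝ} (hf : ∀ i ∈ s, SmoothFn n (f i) u) :
    SmoothFn n (fun y => ∑ i ∈ s, f i y) u := contMDiffOn_finsetSum hf

lemma prod {ι : Type*} (s : Finset ι) {f : ι → M → ℝ} (hf : ∀ i ∈ s, SmoothFn n (f i) u) :
    SmoothFn n (fun y => ∏ i ∈ s, f i y) u := contMDiffOn_finsetProd hf

lemma comp (hf : SmoothFn n f u) {F : ℝ → ℝ} (hF : ∀ y ∈ u, ContDiffAt ℝ ∞ F (f y)) :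
    SmoothFn n (fun y => F (f y)) u := fun y hy =>
  (hF y hy).contMDiffAt.comp_contMDiffWithinAt y (hf y hy)

lemma div (hf : SmoothFn n f u) (hg : SmoothFn n g u) (h : ∀ y ∈ u, g y ≠ 0) :
    SmoothFn n (fun y => f y / g y) u := by
  simp only [div_eq_mul_inv]
  exact hf.mul (hg.comp (F := fun t => t⁻¹) fun y hy => contDiffAt_inv ℝ (h y hy))

end SmoothFn

/-- The part of the range of the preferred chart at `p` which corresponds to `u`. -/
def chartSet (p : M) (u : Set M) : Set (EuclideanSpace ℝ (Fin (n + 1))) :=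
  (extChartAt (𝓡∂ (n + 1)) p).target ∩ (extChartAt (𝓡∂ (n + 1)) p).symm ⁻¹' u

/-- Relative to the half-space the image of an open set is a neighbourhood of each of its points,
boundary points included. So derivatives within the half-space may be taken within `chartSet`, where
coordinate expressions are smooth, and can be iterated. -/
lemma chartSet_mem_nhdsWithin (p : M) {u : Set M} (hu : IsOpen u)
    {z : EuclideanSpace ℝ (Fin (n + 1))} (hz : z ∈ chartSet p u) :
    chartSet p u ∈ 𝓝[Set.range (𝓡∂ (n + 1))] z := by
  refine Filter.inter_mem (extChartAt_target_mem_nhdsWithin_of_mem hz.1) ?_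
  have h1 := (continuousOn_extChartAt_symm (I := 𝓡∂ (n + 1)) p z hz.1).preimage_mem_nhdsWithin
    (hu.mem_nhds hz.2)
  have h2 : (extChartAt (𝓡∂ (n + 1)) p).target ∈ 𝓝[Set.range (𝓡∂ (n + 1))] z :=
    extChartAt_target_mem_nhdsWithin_of_mem hz.1
  exact nhdsWithin_le_of_mem h2 h1

lemma chartSet_subset_range (p : M) (u : Set M) :
    chartSet (n := n) p u ⊆ Set.range (𝓡∂ (n + 1)) :=
  fun _ hz => extChartAt_target_subset_range p hz.1

lemma nhdsWithin_chartSet (p : M) {u : Set M} (hu : IsOpen u)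
    {z : EuclideanSpace ℝ (Fin (n + 1))} (hz : z ∈ chartSet p u) :
    𝓝[chartSet p u] z = 𝓝[Set.range (𝓡∂ (n + 1))] z :=
  le_antisymm (nhdsWithin_mono z (chartSet_subset_range p u))
    (nhdsWithin_le_of_mem (chartSet_mem_nhdsWithin p hu hz))

lemma uniqueDiffOn_chartSet (p : M) {u : Set M} (hu : IsOpen u) :
    UniqueDiffOn ℝ (chartSet (n := n) p u) := fun z hz =>
  ((𝓡∂ (n + 1)).uniqueDiffOn z (chartSet_subset_range p u hz)).mono_nhds
    (nhdsWithin_chartSet p hu hz).ge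

lemma fderivWithin_chartSet (p : M) {u : Set M} (hu : IsOpen u)
    {z : EuclideanSpace ℝ (Fin (n + 1))} (hz : z ∈ chartSet p u)
    (F : EuclideanSpace ℝ (Fin (n + 1)) → ℝ) :
    fderivWithin ℝ F (chartSet p u) z = fderivWithin ℝ F (Set.range (𝓡∂ (n + 1))) z :=
  fderivWithin_congr_set (by
    filter_upwards [mem_nhdsWithin_iff_eventually.1 (chartSet_mem_nhdsWithin p hu hz)] with w hw
    exact propext ⟨fun h => chartSet_subset_range p u h, hw⟩)

lemma extChartAt_mem_chartSet {p : M} {u : Set M} (hup : u ⊆ dom n p) {y : M} (hy : y ∈ u) :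
    extChartAt (𝓡∂ (n + 1)) p y ∈ chartSet p u := by
  have h : y ∈ (extChartAt (𝓡∂ (n + 1)) p).source := by simpa using hup hy
  exact ⟨(extChartAt (𝓡∂ (n + 1)) p).map_source h, by
    rwa [Set.mem_preimage, (extChartAt (𝓡∂ (n + 1)) p).left_inv h]⟩

lemma extChartAt_symm_extChartAt {p y : M} (hy : y ∈ dom n p) :
    (extChartAt (𝓡∂ (n + 1)) p).symm (extChartAt (𝓡∂ (n + 1)) p y) = y :=
  (extChartAt (𝓡∂ (n + 1)) p).left_inv (by simpa using hy)

lemma SmoothFn.contDiffOn_chartSet (p : M) {f : M → ℝ} {u : Set M} (hf : SmoothFn n f u) :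
    ContDiffOn ℝ ∞ (f ∘ (extChartAt (𝓡∂ (n + 1)) p).symm) (chartSet p u) := by
  rw [← contMDiffOn_iff_contDiffOn]
  exact ContMDiffOn.comp hf ((contMDiffOn_extChartAt_symm p).mono Set.inter_subset_left)
    fun z hz => hz.2

lemma ContDiffOn.smoothFn_of_chartSet (p : M) {F : EuclideanSpace ℝ (Fin (n + 1)) → ℝ}
    {u : Set M} (hup : u ⊆ dom n p) (hF : ContDiffOn ℝ ∞ F (chartSet p u)) :
    SmoothFn n (F ∘ extChartAt (𝓡∂ (n + 1)) p) u := by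
  rw [← contMDiffOn_iff_contDiffOn] at hF
  exact hF.comp (contMDiffOn_extChartAt.mono hup) fun z hz => extChartAt_mem_chartSet hup hz

lemma pd_eq_fderivWithin (p : M) (i : Fin (n + 1)) {f : M → ℝ} {y : M} (hy : y ∈ dom n p)
    (hf : DiffFnAt n f y) : pd p i f y = fderivWithin ℝ (f ∘ (extChartAt (𝓡∂ (n + 1)) p).symm)
      (Set.range (𝓡∂ (n + 1))) (extChartAt (𝓡∂ (n + 1)) p y)
        (EuclideanSpace.basisFun (Fin (n + 1)) ℝ i) := by
  have hy' : extChartAt (𝓡∂ (n + 1)) p y ∈ (extChartAt (𝓡∂ (n + 1)) p).target :=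
    (extChartAt (𝓡∂ (n + 1)) p).map_source (by simpa using hy)
  have h := mvfderiv_comp_mfderivWithin_of_eq (I := 𝓡∂ (n + 1))
    (I' := 𝓘(ℝ, EuclideanSpace ℝ (Fin (n + 1)))) hf
    (mdifferentiableWithinAt_extChartAt_symm hy')
    ((𝓡∂ (n + 1)).uniqueDiffOn.uniqueMDiffOn _ (extChartAt_target_subset_range p hy'))
    (extChartAt_symm_extChartAt hy)
  have h2 := congrArg (fun L => L (EuclideanSpace.basisFun (Fin (n + 1)) ℝ i)) h
  rw [pd, fr_eq_symmL hy, TangentBundle.symmL_trivializationAt hy]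
  simp only [mvfderivWithin, mfderivWithin_eq_fderivWithin] at h2
  simp only [OrthonormalBasis.coe_toBasis]
  exact h2.symm

lemma pd_eq_fderivWithin_chartSet (p : M) (i : Fin (n + 1)) {f : M → ℝ} {u : Set M}
    (hu : IsOpen u) (hup : u ⊆ dom n p) (hf : SmoothFn n f u) {y : M} (hy : y ∈ u) :
    pd p i f y = fderivWithin ℝ (f ∘ (extChartAt (𝓡∂ (n + 1)) p).symm)
      (chartSet p u) (extChartAt (𝓡∂ (n + 1)) p y)
        (EuclideanSpace.basisFun (Fin (n + 1)) ℝ i) := by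
  rw [pd_eq_fderivWithin p i (hup hy) (hf.diffFnAt hu hy),
    fderivWithin_chartSet p hu (extChartAt_mem_chartSet hup hy)]

lemma pd_smooth (p : M) (i : Fin (n + 1)) {f : M → ℝ} {u : Set M} (hu : IsOpen u)
    (hup : u ⊆ dom n p) (hf : SmoothFn n f u) : SmoothFn n (pd p i f) u := by
  have h := (hf.contDiffOn_chartSet p).fderivWithin (m := ∞)
    (uniqueDiffOn_chartSet (n := n) p hu) (by simp)
  have h2 := h.clm_apply (contDiffOn_const (c := EuclideanSpace.basisFun (Fin (n + 1)) ℝ i))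
  exact (ContDiffOn.smoothFn_of_chartSet (n := n) p hup h2).congr fun y hy =>
    pd_eq_fderivWithin_chartSet p i hu hup hf hy

lemma pd_comm (p : M) (i j : Fin (n + 1)) {f : M → ℝ} {u : Set M} (hu : IsOpen u)
    (hup : u ⊆ dom n p) (hf : SmoothFn n f u) {y : M} (hy : y ∈ u) :
    pd p i (pd p j f) y = pd p j (pd p i f) y := by
  have hz := extChartAt_mem_chartSet hup hy
  have hS := uniqueDiffOn_chartSet (n := n) p hu
  have key : ∀ i j, pd p i (pd p j f) y = fderivWithin ℝ (fderivWithin ℝ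
      (f ∘ (extChartAt (𝓡∂ (n + 1)) p).symm) (chartSet p u)) (chartSet p u)
      (extChartAt (𝓡∂ (n + 1)) p y) (EuclideanSpace.basisFun (Fin (n + 1)) ℝ i)
      (EuclideanSpace.basisFun (Fin (n + 1)) ℝ j) := by
    intro i j
    rw [pd_eq_fderivWithin_chartSet p i hu hup (pd_smooth p j hu hup hf) hy]
    have h : ∀ z ∈ chartSet p u, (pd p j f ∘ (extChartAt (𝓡∂ (n + 1)) p).symm) z =
        fderivWithin ℝ (f ∘ (extChartAt (𝓡∂ (n + 1)) p).symm) (chartSet p u) z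
          (EuclideanSpace.basisFun (Fin (n + 1)) ℝ j) := by
      intro z hz
      rw [Function.comp_apply, pd_eq_fderivWithin_chartSet p j hu hup hf hz.2,
        (extChartAt (𝓡∂ (n + 1)) p).right_inv hz.1]
    rw [fderivWithin_congr h (h _ hz)]
    have hd := ((hf.contDiffOn_chartSet p).fderivWithin (m := ∞) hS (by simp)).differentiableOn
      (by simp) _ hz
    rw [fderivWithin_clm_apply (hS _ hz) hd (differentiableWithinAt_const _)]
    simp
  rw [key i j, key j i]
  -- Second derivatives within a set are symmetric at limits of interior points, so the partial
  -- derivatives commute at boundary points too.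
  have hc : extChartAt (𝓡∂ (n + 1)) p y ∈ closure (interior (chartSet p u)) := by
    rw [chartSet, Set.inter_comm]
    exact extChartAt_mem_closure_interior (by rw [hu.interior_eq]; exact subset_closure hy)
      (by simpa using hup hy)
  exact ((hf.contDiffOn_chartSet p).contDiffWithinAt hz).isSymmSndFDerivWithinAt
    (by rw [minSmoothness_of_isRCLikeNormedField]; exact two_le_infty)
    hS hc hz _ _

/-- This exhibits the coordinate fields as pullbacks of constant fields, the form in which
naturality of the Lie bracket applies. -/
lemma fr_eq_inverse {p y : M} (hy : y ∈ dom n p) (i : Fin (n + 1)) :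
    fr p i y = (mfderiv (𝓡∂ (n + 1)) 𝓘(ℝ, EuclideanSpace ℝ (Fin (n + 1)))
      (extChartAt (𝓡∂ (n + 1)) p) y).inverse (EuclideanSpace.basisFun (Fin (n + 1)) ℝ i) := by
  rw [fr_eq_symmL hy, ← TangentBundle.continuousLinearMapAt_trivializationAt hy,
    ← Bundle.Trivialization.coe_continuousLinearEquivAt_eq' _ (mem_baseSet hy)]
  erw [ContinuousLinearMap.inverse_equiv]
  have h := congrArg (fun L => L (EuclideanSpace.basisFun (Fin (n + 1)) ℝ i))
    (Bundle.Trivialization.symm_continuousLinearEquivAt_eq' (R := ℝ)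
      (trivializationAt (EuclideanSpace ℝ (Fin (n + 1))) (TangentSpace (𝓡∂ (n + 1))) p)
      (mem_baseSet hy))
  simp only [OrthonormalBasis.coe_toBasis]
  exact h.symm

/-- Constant fields commute, and the bracket is compatible with pullback along the chart. -/
lemma mlieBracket_fr (p : M) (i j : Fin (n + 1)) {y : M} (hy : y ∈ dom n p) :
    VectorField.mlieBracket (𝓡∂ (n + 1)) (fr p i) (fr p j) y = 0 := by
  let V (k : Fin (n + 1)) (z : EuclideanSpace ℝ (Fin (n + 1))) :
    TangentSpace 𝓘(ℝ, EuclideanSpace ℝ (Fin (n + 1))) z := EuclideanSpace.basisFun (Fin (n + 1)) ℝ k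
  have hmp : ∀ k, fr p k =ᶠ[𝓝 y] VectorField.mpullback (𝓡∂ (n + 1))
      𝓘(ℝ, EuclideanSpace ℝ (Fin (n + 1))) (extChartAt (𝓡∂ (n + 1)) p) (V k) := by
    intro k
    filter_upwards [(isOpen_dom p).mem_nhds hy] with z hz
    rw [fr_eq_inverse hz, VectorField.mpullback_apply]
  have hc : ∀ k, MDifferentiableAt 𝓘(ℝ, EuclideanSpace ℝ (Fin (n + 1)))
      (𝓘(ℝ, EuclideanSpace ℝ (Fin (n + 1))).prod 𝓘(ℝ, EuclideanSpace ℝ (Fin (n + 1))))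
      (fun z => (⟨z, V k z⟩ :
        TangentBundle 𝓘(ℝ, EuclideanSpace ℝ (Fin (n + 1))) (EuclideanSpace ℝ (Fin (n + 1)))))
      (extChartAt (𝓡∂ (n + 1)) p y) := by
    intro k
    exact ((contMDiff_vectorSpace_iff_contDiff (n := 1)).2 contDiff_const).mdifferentiableAt
      (by simp)
  have h0 : VectorField.mlieBracket 𝓘(ℝ, EuclideanSpace ℝ (Fin (n + 1))) (V i) (V j) = 0 := by
    rw [← VectorField.mlieBracketWithin_univ, VectorField.mlieBracketWithin_eq_lieBracketWithin]
    funext z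
    simp only [VectorField.lieBracketWithin_univ, VectorField.lieBracket, V]
    erw [fderiv_fun_const, fderiv_fun_const]
    simp
    rfl
  have : IsManifold (𝓡∂ (n + 1)) (minSmoothness ℝ 2) M := by
    rw [minSmoothness_of_isRCLikeNormedField]; infer_instance
  have : IsManifold 𝓘(ℝ, EuclideanSpace ℝ (Fin (n + 1))) (minSmoothness ℝ 2)
      (EuclideanSpace ℝ (Fin (n + 1))) := by
    rw [minSmoothness_of_isRCLikeNormedField]; infer_instance
  rw [(hmp i).mlieBracket_vectorField_eq (hmp j), ← VectorField.mpullback_mlieBracket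
    (n := ∞) (hc i) (hc j) (contMDiffAt_extChartAt' hy)
    (by rw [minSmoothness_of_isRCLikeNormedField]; exact two_le_infty), h0]
  simp

/-- A vector field that is smooth near a point agrees near that point with a global one. -/
lemma SmoothVF.exists_global [T2Space M] {X : (x : M) → T n x} {u : Set M} (hX : SmoothVF X u)
    (hu : IsOpen u) {y : M} (hy : y ∈ u) :
    ∃ X' : (x : M) → T n x, SmoothVF X' Set.univ ∧ ∀ᶠ z in 𝓝 y, X' z = X z := by
  obtain ⟨f, hf⟩ := (SmoothBumpFunction.nhds_basis_support (I := 𝓡∂ (n + 1))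
    (hu.mem_nhds hy)).ex_mem
  refine ⟨(f : M → ℝ) • X, ?_, ?_⟩
  · exact (ContMDiffOn.smul_section_of_tsupport (f.contMDiff.contMDiffOn) hu hf hX).contMDiffOn
  · filter_upwards [f.eventuallyEq_one] with z hz
    simp [hz]

end

section

variable {n : ℕ} {M : Type*} [TopologicalSpace M] [ChartedSpace (EuclideanHalfSpace (n + 1)) M]
  [IsManifold (𝓡∂ (n + 1)) ∞ M]

/-! ### Connection coefficients -/

/-- The Christoffel symbols `Γ^k_ij` of `D` in the preferred chart at `p`. -/
def Gam (D : ConnOp n M) (p : M) (k i j : Fin (n + 1)) (y : M) : ℝ :=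
  co p k y (D (fr p j) y (fr p i y))

lemma IsAffineConnectionOn.congr {D : ConnOp n M} {u : Set M} (hD : IsAffineConnectionOn D u)
    (hu : IsOpen u) {X Y : (x : M) → T n x} {y : M} (hy : y ∈ u) (hX : DiffVFAt X y)
    (hXY : ∀ᶠ z in 𝓝 y, X z = Y z) : D X y = D Y y := by
  refine hD.isCovariantDerivativeOn.congr_of_eventuallyEq hX ?_ (hu.mem_nhds hy) hXY
  refine MDifferentiableAt.congr_of_eventuallyEq hX ?_
  filter_upwards [hXY] with z hz
  simp [hz]

/-- Smoothness of a connection is only postulated for fields smooth on all of `u`. A field smooth on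
a smaller open set is replaced near the point by a cut-off one; the Hausdorff property supplies the
bump function. -/
lemma IsAffineConnectionOn.contMDiffAt_hom [T2Space M] {D : ConnOp n M} {u : Set M}
    (hD : IsAffineConnectionOn D u) (hu : IsOpen u) {w : Set M} (hw : IsOpen w) (hwu : w ⊆ u)
    {X : (x : M) → T n x} (hX : SmoothVF X w) {y : M} (hy : y ∈ w) :
    ContMDiffAt (𝓡∂ (n + 1)) ((𝓡∂ (n + 1)).prod 𝓘(ℝ, EuclideanSpace ℝ (Fin (n + 1)) →L[ℝ]
      EuclideanSpace ℝ (Fin (n + 1)))) ∞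
      (fun z => (⟨z, D X z⟩ : Bundle.TotalSpace (EuclideanSpace ℝ (Fin (n + 1)) →L[ℝ]
        EuclideanSpace ℝ (Fin (n + 1))) fun z => T n z →L[ℝ] T n z)) y := by
  obtain ⟨X', hX', h⟩ := hX.exists_global hw hy
  have h1 := hD.smooth.contMDiff (σ := X') (by simpa using! hX'.mono (Set.subset_univ u))
  refine (h1.contMDiffAt (hu.mem_nhds (hwu hy))).congr_of_eventuallyEq ?_
  filter_upwards [h.eventually_nhds, hw.mem_nhds hy] with z hz hzw
  rw [hD.congr hu (hwu hzw) (hX'.diffVFAt isOpen_univ trivial) hz]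

lemma IsAffineConnectionOn.diffVFAt [T2Space M] {D : ConnOp n M} {u : Set M}
    (hD : IsAffineConnectionOn D u) (hu : IsOpen u) {w : Set M} (hw : IsOpen w) (hwu : w ⊆ u)
    {X : (x : M) → T n x} (hX : SmoothVF X w) {y : M} (hy : y ∈ w) {Y : (x : M) → T n x}
    (hY : DiffVFAt Y y) : DiffVFAt (fun z => D X z (Y z)) y :=
  ((hD.contMDiffAt_hom hu hw hwu hX hy).mdifferentiableAt (by simp)).clm_bundle_apply hY

lemma IsAffineConnectionOn.smoothVF [T2Space M] {D : ConnOp n M} {u : Set M}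
    (hD : IsAffineConnectionOn D u) (hu : IsOpen u) {w : Set M} (hw : IsOpen w) (hwu : w ⊆ u)
    {X Y : (x : M) → T n x} (hX : SmoothVF X w) (hY : SmoothVF Y w) :
    SmoothVF (fun z => D X z (Y z)) w := fun y hy =>
  ((hD.contMDiffAt_hom hu hw hwu hX hy).clm_bundle_apply
    (hY.contMDiffAt (hw.mem_nhds hy))).contMDiffWithinAt

lemma Gam_smooth [T2Space M] {D : ConnOp n M} {u : Set M} (hD : IsAffineConnectionOn D u)
    (hu : IsOpen u) {p : M} {w : Set M} (hw : IsOpen w) (hwu : w ⊆ u) (hwp : w ⊆ dom n p)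
    (k i j : Fin (n + 1)) : SmoothFn n (Gam D p k i j) w :=
  (smoothVF_iff p hw hwp).1 (hD.smoothVF hu hw hwu ((fr_smooth p j).mono hwp)
    ((fr_smooth p i).mono hwp)) k

lemma diffVFAt_sum {ι : Type*} (s : Finset ι) {X : ι → (x : M) → T n x} {y : M}
    (hX : ∀ i ∈ s, DiffVFAt (X i) y) : DiffVFAt (fun z => ∑ i ∈ s, X i z) y :=
  MDifferentiableAt.sum_section hX

lemma eventually_eq_sum_fr (p : M) (X : (x : M) → T n x) {y : M} (hy : y ∈ dom n p) :
    ∀ᶠ z in 𝓝 y, X z = ∑ j, co p j z (X z) • fr p j z := by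
  filter_upwards [(isOpen_dom p).mem_nhds hy] with z hz
  exact (sum_co_fr p hz (X z)).symm

/-- A tensorial operation on vector fields is determined by its values on a coordinate frame. -/
lemma tensorialAt_expand {A : Type*} [AddCommGroup A] [Module ℝ A] (p : M) {y : M}
    (hy : y ∈ dom n p) {Φ : ((x : M) → T n x) → A}
    (hΦ : TensorialAt (𝓡∂ (n + 1)) (EuclideanSpace ℝ (Fin (n + 1))) Φ y) {X : (x : M) → T n x}
    (hX : DiffVFAt X y) : Φ X = ∑ i, co p i y (X y) • Φ (fr p i) := by
  have h1 : ∀ i, DiffVFAt (((fun _ => co p i y (X y)) : M → ℝ) • fr p i) y := fun i =>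
    mdifferentiableAt_const.smul_section (fr_diff p i hy)
  -- The coefficients are frozen at `y`: the two fields agree only at this point, which suffices for
  -- a tensorial operation.
  have h2 : Φ X = Φ (fun z => ∑ i, (((fun _ => co p i y (X y)) : M → ℝ) • fr p i) z) := by
    refine hΦ.pointwise hX (diffVFAt_sum _ fun i _ => h1 i) ?_
    simpa using (sum_co_fr p hy (X y)).symm
  rw [h2, hΦ.sum _ fun i _ => h1 i]
  exact Finset.sum_congr rfl fun i _ => hΦ.smul mdifferentiableAt_const (fr_diff p i hy)

/-- The covariant derivative of a vector field in coordinates. -/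
lemma IsAffineConnectionOn.co_apply {D : ConnOp n M} {u : Set M} (hD : IsAffineConnectionOn D u)
    (hu : IsOpen u) (p : M) {y : M} (hyu : y ∈ u) (hy : y ∈ dom n p) {X : (x : M) → T n x}
    (hX : DiffVFAt X y) (k : Fin (n + 1)) (v : T n y) :
    co p k y (D X y v) = dAt (fun z => co p k z (X z)) y v
      + ∑ j, co p j y (X y) * co p k y (D (fr p j) y v) := by
  have hd := (diffVFAt_iff p hy).1 hX
  rw [hD.congr hu hyu hX (eventually_eq_sum_fr p X hy)]
  have hsum : ∀ s : Finset (Fin (n + 1)), D (fun z => ∑ j ∈ s, co p j z (X z) • fr p j z) y v =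
      ∑ j ∈ s, (co p j y (X y) • D (fr p j) y v + dAt (fun z => co p j z (X z)) y v • fr p j y) := by
    intro s
    induction s using Finset.induction_on with
    | empty =>
      have := hD.isCovariantDerivativeOn.zero hyu
      simp only [Finset.sum_empty]
      exact congrArg (fun L => L v) this
    | insert a s ha ih =>
      have h1 : DiffVFAt (fun z => co p a z (X z) • fr p a z) y :=
        (hd a).smul_section (fr_diff p a hy)
      have h2 : DiffVFAt (fun z => ∑ j ∈ s, co p j z (X z) • fr p j z) y :=
        diffVFAt_sum _ fun j _ => (hd j).smul_section (fr_diff p j hy)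
      have h3 := hD.isCovariantDerivativeOn.add h1 h2 hyu
      have h4 := hD.isCovariantDerivativeOn.leibniz (fr_diff p a hy) (hd a) hyu
      simp only [Finset.sum_insert ha, ← ih]
      have h5 := congrArg (fun L => L v) h3
      have h6 := congrArg (fun L => L v) h4
      refine h5.trans ?_
      simp only [add_apply]
      congr 1
  rw [hsum, map_sum]
  simp only [map_add, map_smul, smul_eq_mul, co_fr p hy, Finset.sum_add_distrib]
  simp [add_comm]

lemma IsAffineConnectionOn.co_fr_apply {D : ConnOp n M} (p : M) {y : M} (hy : y ∈ dom n p)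
    (j k : Fin (n + 1)) (v : T n y) :
    co p k y (D (fr p j) y v) = ∑ i, co p i y v * Gam D p k i j y := by
  conv_lhs => rw [← sum_co_fr p hy v]
  simp [Gam]

/-- Components of a covariant derivative. -/
lemma IsAffineConnectionOn.co_apply_fr {D : ConnOp n M} {u : Set M}
    (hD : IsAffineConnectionOn D u)
    (hu : IsOpen u) (p : M) {y : M} (hyu : y ∈ u) (hy : y ∈ dom n p) {X : (x : M) → T n x}
    (hX : DiffVFAt X y) (k i : Fin (n + 1)) :
    co p k y (D X y (fr p i y)) = pd p i (fun z => co p k z (X z)) y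
      + ∑ j, co p j y (X y) * Gam D p k i j y :=
  hD.co_apply hu p hyu hy hX k _

lemma Gam_symm {D : ConnOp n M} {u : Set M} (hD : IsAffineConnectionOn D u) {p y : M}
    (hyu : y ∈ u) (hy : y ∈ dom n p) (k i j : Fin (n + 1)) :
    Gam D p k i j y = Gam D p k j i y := by
  have h := hD.torsionFree (fr p i) (fr p j) y hyu (fr_diff p i hy) (fr_diff p j hy)
  rw [mlieBracket_fr p i j hy, sub_eq_zero] at h
  simp only [Gam, h]

/-! ### Curvature in coordinates -/

/-- The derivative of `f` from the Leibniz rule cancels against the one produced by the bracket. -/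
lemma curvature_tensorial_left [T2Space M] {D : ConnOp n M} {u : Set M}
    (hD : IsAffineConnectionOn D u) (hu : IsOpen u) {w : Set M} (hw : IsOpen w) (hwu : w ⊆ u)
    {Z : (x : M) → T n x} (hZ : SmoothVF Z w) {y : M} (hy : y ∈ w) (Y : (x : M) → T n x) :
    TensorialAt (𝓡∂ (n + 1)) (EuclideanSpace ℝ (Fin (n + 1)))
      (fun X => curvature D X Y Z y) y where
  smul {f X} hf hX := by
    have h1 := hD.isCovariantDerivativeOn.leibniz (hD.diffVFAt hu hw hwu hZ hy hX) hf (hwu hy)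
    have h2 : (fun z => D Z z ((f • X) z)) = f • fun z => D Z z (X z) := by
      funext z; simp
    simp only [curvature]
    rw [h2, h1, VectorField.mlieBracket_smul_left hf hX]
    simp only [add_apply, smul_apply, map_add, map_smul,
      Pi.smul_apply', ContinuousLinearMap.smulRight_apply]
    module
  add {X X'} hX hX' := by
    have h1 := hD.isCovariantDerivativeOn.add (hD.diffVFAt hu hw hwu hZ hy hX)
      (hD.diffVFAt hu hw hwu hZ hy hX') (hwu hy)
    have h2 : (fun z => D Z z ((X + X') z)) =
        (fun z => D Z z (X z)) + fun z => D Z z (X' z) := by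
      funext z; simp
    simp only [curvature]
    rw [h2, h1, VectorField.mlieBracket_add_left hX hX']
    simp only [add_apply, map_add, Pi.add_apply]
    abel

lemma curvature_swap (D : ConnOp n M) (X Y Z : (x : M) → T n x) (y : M) :
    curvature D X Y Z y = - curvature D Y X Z y := by
  simp only [curvature]
  rw [VectorField.mlieBracket_swap_apply, map_neg]
  abel

lemma curvature_tensorial_mid [T2Space M] {D : ConnOp n M} {u : Set M}
    (hD : IsAffineConnectionOn D u) (hu : IsOpen u) {w : Set M} (hw : IsOpen w) (hwu : w ⊆ u)
    {Z : (x : M) → T n x} (hZ : SmoothVF Z w) {y : M} (hy : y ∈ w) (X : (x : M) → T n x) :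
    TensorialAt (𝓡∂ (n + 1)) (EuclideanSpace ℝ (Fin (n + 1)))
      (fun Y => curvature D X Y Z y) y where
  smul {f Y} hf hY := by
    simp only [curvature_swap D X]
    rw [(curvature_tensorial_left hD hu hw hwu hZ hy X).smul hf hY, smul_neg]
  add {Y Y'} hY hY' := by
    simp only [curvature_swap D X]
    rw [(curvature_tensorial_left hD hu hw hwu hZ hy X).add hY hY', neg_add]

/-- The components `R_ij^l_m` of the curvature in the preferred chart at `p`. -/
def Rm (D : ConnOp n M) (p : M) (l i j m : Fin (n + 1)) (y : M) : ℝ :=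
  pd p i (Gam D p l j m) y - pd p j (Gam D p l i m) y
    + ∑ k, (Gam D p l i k y * Gam D p k j m y - Gam D p l j k y * Gam D p k i m y)

/-- Since two derivatives fall on `Z`, this slot is expanded directly rather than by tensoriality.
Second derivatives cancel by `pd_comm`, and the first-derivative terms are symmetric in `i` and `j`.
-/
lemma co_curvature_fr [T2Space M] {D : ConnOp n M} {u : Set M}
    (hD : IsAffineConnectionOn D u) (hu : IsOpen u) {p : M} {w : Set M} (hw : IsOpen w)
    (hwu : w ⊆ u) (hwp : w ⊆ dom n p) {Z : (x : M) → T n x} (hZ : SmoothVF Z w) {y : M} (hy : y ∈ w)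
    (l i j : Fin (n + 1)) : co p l y (curvature D (fr p i) (fr p j) Z y) =
      ∑ m, co p m y (Z y) * Rm D p l i j m y := by
  have key : ∀ i j, co p l y (D (fun z => D Z z (fr p j z)) y (fr p i y)) =
      pd p i (pd p j (fun z => co p l z (Z z))) y
      + ∑ m, (pd p i (fun z => co p m z (Z z)) y * Gam D p l j m y
        + co p m y (Z y) * pd p i (Gam D p l j m) y)
      + ∑ m, (pd p j (fun z => co p m z (Z z)) y * Gam D p l i m y)
      + ∑ m, ∑ k, co p m y (Z y) * (Gam D p l i k y * Gam D p k j m y) := by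
    intro i j
    have hZl := (smoothVF_iff p hw hwp).1 hZ
    have hG := fun a b c => Gam_smooth hD hu (p := p) hw hwu hwp a b c
    rw [hD.co_apply_fr hu p (hwu hy) (hwp hy)
      (hD.diffVFAt hu hw hwu hZ hy (fr_diff p j (hwp hy)))]
    have h1 : ∀ k, ∀ z ∈ w, co p k z (D Z z (fr p j z)) =
        pd p j (fun z => co p k z (Z z)) z + ∑ m, co p m z (Z z) * Gam D p k j m z := fun k z hz =>
      hD.co_apply_fr hu p (hwu hz) (hwp hz) (hZ.diffVFAt hw hz) k j
    rw [pd_congr_of_eqOn p i hw (h1 l) hy]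
    have hd1 := (pd_smooth p j hw hwp (hZl l)).diffFnAt hw hy
    have hd2 : ∀ m, DiffFnAt n (fun z => co p m z (Z z) * Gam D p l j m z) y := fun m =>
      ((hZl m).mul (hG l j m)).diffFnAt hw hy
    rw [pd, dAt_add hd1 ((SmoothFn.sum _ fun m _ => (hZl m).mul (hG l j m)).diffFnAt hw hy),
      dAt_sum _ fun m _ => hd2 m]
    have h2 : ∀ m, dAt (fun z => co p m z (Z z) * Gam D p l j m z) y (fr p i y) =
        co p m y (Z y) * pd p i (Gam D p l j m) y
          + Gam D p l j m y * pd p i (fun z => co p m z (Z z)) y := fun m =>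
      dAt_mul ((hZl m).diffFnAt hw hy) ((hG l j m).diffFnAt hw hy) _
    simp only [h2, h1 _ y hy]
    simp only [add_mul, Finset.sum_mul, Finset.sum_add_distrib]
    rw [Finset.sum_comm (f := fun k m => co p m y (Z y) * Gam D p k j m y * Gam D p l i k y)]
    simp only [← pd.eq_def, mul_comm, mul_assoc]
    ring
  simp only [curvature, map_sub]
  rw [key i j, key j i, mlieBracket_fr p i j (hwp hy)]
  rw [pd_comm p i j hw hwp ((smoothVF_iff p hw hwp).1 hZ l) hy]
  simp only [map_zero, Rm, mul_add, mul_sub, Finset.sum_add_distrib, Finset.sum_sub_distrib,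
    Finset.mul_sum]
  ring

lemma co_curvature [T2Space M] {D : ConnOp n M} {u : Set M}
    (hD : IsAffineConnectionOn D u) (hu : IsOpen u) {p : M} {w : Set M} (hw : IsOpen w)
    (hwu : w ⊆ u) {Z : (x : M) → T n x} (hZ : SmoothVF Z w) {y : M} (hy : y ∈ w) (hyp : y ∈ dom n p)
    {X Y : (x : M) → T n x} (hX : DiffVFAt X y) (hY : DiffVFAt Y y)
    (l : Fin (n + 1)) : co p l y (curvature D X Y Z y) =
      ∑ i, co p i y (X y) * ∑ j, co p j y (Y y) * ∑ m, co p m y (Z y) * Rm D p l i j m y := by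
  have hw' : IsOpen (w ∩ dom n p) := hw.inter (isOpen_dom p)
  have hZ' : SmoothVF Z (w ∩ dom n p) := hZ.mono Set.inter_subset_left
  rw [tensorialAt_expand p hyp (curvature_tensorial_left hD hu hw hwu hZ hy Y) hX, map_sum]
  refine Finset.sum_congr rfl fun i _ => ?_
  rw [tensorialAt_expand p hyp
    (curvature_tensorial_mid hD hu hw hwu hZ hy (fr p i)) hY, map_smul, map_sum,
    smul_eq_mul]
  congr 1
  refine Finset.sum_congr rfl fun j _ => ?_
  rw [map_smul, smul_eq_mul, co_curvature_fr hD hu hw' (Set.inter_subset_left.trans hwu)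
    Set.inter_subset_right hZ' ⟨hy, hyp⟩]

/-- Both sides are the trace of `L`. This turns the contraction in the definition of `ricci` into
one over the coordinate frame. -/
lemma sum_tBasis_repr_eq (p : M) {y : M} (hy : y ∈ dom n p) (L : T n y →ₗ[ℝ] T n y) :
    ∑ i, (tBasis y).repr (L (tBasis y i)) i = ∑ i, co p i y (L (fr p i y)) := by
  have h1 := LinearMap.trace_eq_matrix_trace ℝ (tBasis (n := n) y) L
  have h2 := LinearMap.trace_eq_matrix_trace ℝ (frBasis p hy) L
  rw [h1] at h2
  simp only [Matrix.trace, Matrix.diag, LinearMap.toMatrix_apply] at h2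
  rw [h2]
  simp only [co_apply p hy, frBasis_apply]

/-- The components of the Ricci curvature in the preferred chart at `p`. -/
def Ric (D : ConnOp n M) (p : M) (j m : Fin (n + 1)) (y : M) : ℝ := ∑ i, Rm D p i i j m y

lemma ricci_eq [T2Space M] {D : ConnOp n M} {u : Set M}
    (hD : IsAffineConnectionOn D u) (hu : IsOpen u) {p y : M} (hy : y ∈ u) (hyp : y ∈ dom n p)
    (v w : T n y) :
    ricci D y v w = ∑ j, ∑ m, co p j y v * co p m y w * Ric D p j m y := by
  have hw' : IsOpen (u ∩ dom n y) := hu.inter (isOpen_dom y)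
  have hZ : SmoothVF (ext w) (u ∩ dom n y) := (ext_smooth w).mono Set.inter_subset_right
  have hy' : y ∈ u ∩ dom n y := ⟨hy, mem_dom y⟩
  -- The map a ↦ R(a, v)w is defined through its values on the frame, so that it is visibly linear;
  -- tensoriality identifies it with the curvature on `ext a`.
  let L : T n y →ₗ[ℝ] T n y := ∑ i, (co p i y).smulRight (curvature D (fr p i) (ext v) (ext w) y)
  have hL : ∀ a : T n y, L a = curvature D (ext a) (ext v) (ext w) y := by
    intro a
    rw [tensorialAt_expand p hyp (curvature_tensorial_left hD hu hw' Set.inter_subset_left hZ hy'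
      (ext v)) (ext_diff a)]
    simp [L, ext_apply_self]
  simp only [ricci, ← hL]
  rw [sum_tBasis_repr_eq p hyp]
  simp only [hL]
  simp only [co_curvature hD hu hw' Set.inter_subset_left hZ hy' hyp (ext_diff _) (ext_diff v),
    ext_apply_self, co_fr p hyp, Ric]
  simp only [ite_mul, one_mul, zero_mul, Finset.sum_ite_eq', Finset.mem_univ, if_true]
  rw [Finset.sum_comm]
  refine Finset.sum_congr rfl fun j _ => ?_
  simp only [Finset.mul_sum]
  rw [Finset.sum_comm]
  simp only [mul_assoc]

end

section

/-! ### Densities are determined by their value on one basis. -/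

section Density

variable {n : ℕ} {r : ℝ} {V : Type*} [AddCommGroup V] [Module ℝ V]

lemma density_apply_basis (φ : densitySpace n r V) (b f : Module.Basis (Fin (n + 1)) ℝ V) :
    φ.1 f = |b.det f| ^ r * φ.1 b := by
  have h := φ.2.1 (b.equiv f (Equiv.refl _)) b
  have h2 := Module.Basis.det_comp b (b.equiv f (Equiv.refl _) : V →ₗ[ℝ] V) b
  simp only [LinearEquiv.coe_coe, Function.comp_def, Module.Basis.equiv_apply, Equiv.refl_apply,
    Module.Basis.det_self, mul_one] at h h2
  rw [h2, ← h]

lemma density_ext (φ ψ : densitySpace n r V) (b : Module.Basis (Fin (n + 1)) ℝ V)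
    (h : φ.1 b = ψ.1 b) : φ = ψ := by
  apply Subtype.ext
  funext e
  by_cases he : LinearIndependent ℝ e
  · have hfin : Module.finrank ℝ V = n + 1 := by
      rw [Module.finrank_eq_card_basis b, Fintype.card_fin]
    have hb : (⇑(basisOfLinearIndependentOfCardEqFinrank he (by simp [hfin])) :
        Fin (n + 1) → V) = e := coe_basisOfLinearIndependentOfCardEqFinrank he _
    rw [← hb, density_apply_basis φ b, density_apply_basis ψ b, h]
  · rw [φ.2.2 e he, ψ.2.2 e he]

lemma density_eq_zero_iff (φ : densitySpace n r V) (b : Module.Basis (Fin (n + 1)) ℝ V) :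
    φ = 0 ↔ φ.1 b = 0 :=
  ⟨fun h => by simp [h], fun h => density_ext φ 0 b h⟩

end Density

/-! ### Derivatives of products, determinants and powers. -/

section Determinant

variable {n : ℕ} {M : Type*} [TopologicalSpace M] [ChartedSpace (EuclideanHalfSpace (n + 1)) M]
  [IsManifold (𝓡∂ (n + 1)) ∞ M]

lemma DiffFnAt.add {f g : M → ℝ} {y : M} (hf : DiffFnAt n f y) (hg : DiffFnAt n g y) :
    DiffFnAt n (fun z => f z + g z) y := MDifferentiableAt.add hf hg

lemma DiffFnAt.mul {f g : M → ℝ} {y : M} (hf : DiffFnAt n f y) (hg : DiffFnAt n g y) :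
    DiffFnAt n (fun z => f z * g z) y := MDifferentiableAt.mul hf hg

lemma DiffFnAt.const (c : ℝ) (y : M) : DiffFnAt n (fun _ => c) y := mdifferentiableAt_const

lemma DiffFnAt.const_mul {f : M → ℝ} {y : M} (c : ℝ) (hf : DiffFnAt n f y) :
    DiffFnAt n (fun z => c * f z) y := (DiffFnAt.const c y).mul hf

lemma DiffFnAt.sum {ι : Type*} (s : Finset ι) {f : ι → M → ℝ} {y : M}
    (hf : ∀ i ∈ s, DiffFnAt n (f i) y) : DiffFnAt n (fun z => ∑ i ∈ s, f i z) y := by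
  classical
  induction s using Finset.induction_on with
  | empty => simpa using DiffFnAt.const 0 y
  | insert a s ha ih =>
    simp only [Finset.sum_insert ha]
    exact (hf a (Finset.mem_insert_self a s)).add
      (ih fun i hi => hf i (Finset.mem_insert_of_mem hi))

lemma DiffFnAt.comp {f : M → ℝ} {y : M} (hf : DiffFnAt n f y) {F : ℝ → ℝ}
    (hF : DifferentiableAt ℝ F (f y)) : DiffFnAt n (fun z => F (f z)) y :=
  hF.mdifferentiableAt.comp y hf

lemma DiffFnAt.congr {f g : M → ℝ} {y : M} (hf : DiffFnAt n f y) (h : g =ᶠ[𝓝 y] f) :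
    DiffFnAt n g y := MDifferentiableAt.congr_of_eventuallyEq hf h

lemma DiffFnAt.prod {ι : Type*} (s : Finset ι) {f : ι → M → ℝ} {y : M}
    (hf : ∀ i ∈ s, DiffFnAt n (f i) y) : DiffFnAt n (fun z => ∏ i ∈ s, f i z) y := by
  classical
  induction s using Finset.induction_on with
  | empty => simpa using mdifferentiableAt_const
  | insert a s ha ih =>
    simp only [Finset.prod_insert ha]
    exact (hf a (Finset.mem_insert_self a s)).mul
      (ih fun i hi => hf i (Finset.mem_insert_of_mem hi))

lemma dAt_prod {ι : Type*} [DecidableEq ι] (s : Finset ι) {f : ι → M → ℝ} {y : M}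
    (hf : ∀ i ∈ s, DiffFnAt n (f i) y) (v : T n y) :
    dAt (fun z => ∏ i ∈ s, f i z) y v = ∑ i ∈ s, (∏ j ∈ s.erase i, f j y) * dAt (f i) y v := by
  induction s using Finset.induction_on with
  | empty => simpa using dAt_const 1 v
  | insert a s ha ih =>
    have hs : ∀ i ∈ s, DiffFnAt n (f i) y := fun i hi => hf i (Finset.mem_insert_of_mem hi)
    simp only [Finset.prod_insert ha]
    rw [dAt_mul (hf a (Finset.mem_insert_self a s)) (DiffFnAt.prod s hs), ih hs,
      Finset.sum_insert ha, Finset.erase_insert ha, add_comm, Finset.mul_sum]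
    congr 1
    refine Finset.sum_congr rfl fun i hi => ?_
    have hai : a ≠ i := fun h => ha (h ▸ hi)
    rw [Finset.erase_insert_of_ne hai, Finset.prod_insert (fun h => ha (Finset.mem_of_mem_erase h)),
      mul_assoc]

lemma SmoothFn.det {ι : Type*} [Fintype ι] [DecidableEq ι] {A : M → Matrix ι ι ℝ} {u : Set M}
    (hA : ∀ i j, SmoothFn n (fun z => A z i j) u) : SmoothFn n (fun z => (A z).det) u := by
  simp only [Matrix.det_apply']
  exact SmoothFn.sum _ fun σ _ => (SmoothFn.prod _ fun i _ => hA (σ i) i).const_mul _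

lemma DiffFnAt.det {ι : Type*} [Fintype ι] [DecidableEq ι] {A : M → Matrix ι ι ℝ} {y : M}
    (hA : ∀ i j, DiffFnAt n (fun z => A z i j) y) : DiffFnAt n (fun z => (A z).det) y := by
  simp only [Matrix.det_apply']
  exact DiffFnAt.sum _ fun σ _ => (DiffFnAt.prod Finset.univ fun i _ => hA (σ i) i).const_mul _

/-- Jacobi's formula, for a derivative of the form `dA = A Θ`. -/
lemma dAt_det {ι : Type*} [Fintype ι] [DecidableEq ι] {A : M → Matrix ι ι ℝ} {y : M}
    (hA : ∀ i j, DiffFnAt n (fun z => A z i j) y) (v : T n y) (Θ : Matrix ι ι ℝ)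
    (hΘ : ∀ i j, dAt (fun z => A z i j) y v = ∑ k, A y i k * Θ k j) :
    dAt (fun z => (A z).det) y v = Θ.trace * (A y).det := by
  have h1 : dAt (fun z => (A z).det) y v =
      ∑ i, ((A y).updateCol i (fun k => dAt (fun z => A z k i) y v)).det := by
    simp only [Matrix.det_apply']
    have hp : ∀ σ : Equiv.Perm ι, DiffFnAt n (fun z => ∏ i, A z (σ i) i) y := fun σ =>
      DiffFnAt.prod Finset.univ fun i _ => hA (σ i) i
    rw [dAt_sum _ fun σ _ => (hp σ).const_mul _, Finset.sum_comm]
    refine Finset.sum_congr rfl fun σ _ => ?_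
    rw [dAt_mul (DiffFnAt.const _ y) (hp σ), dAt_const,
      dAt_prod _ (fun i _ => hA (σ i) i), mul_zero, add_zero, Finset.mul_sum]
    refine Finset.sum_congr rfl fun i _ => ?_
    rw [← Finset.mul_prod_erase Finset.univ _ (Finset.mem_univ i)]
    simp only [Matrix.updateCol_self]
    rw [mul_comm (dAt _ _ _)]
    congr 2
    refine Finset.prod_congr rfl fun j hj => ?_
    rw [Matrix.updateCol_ne (Finset.ne_of_mem_erase hj)]
  rw [h1, Matrix.trace, Finset.sum_mul]
  refine Finset.sum_congr rfl fun i _ => ?_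
  -- The differentiated column is a combination of the columns of `A y`; inside the determinant only
  -- its multiple of the `i`-th column survives, contributing `Θ i i`.
  have h2 : (fun k => dAt (fun z => A z k i) y v) = fun k => ∑ l, (Θ l i) • (A y)ᵀ l k := by
    funext k
    rw [hΘ]
    simp [mul_comm]
  have h3 := Matrix.det_updateCol_sum (A y) i (fun l => Θ l i)
  rw [h2]
  simpa using h3

lemma hasDerivAt_abs_rpow (r : ℝ) {t : ℝ} (ht : t ≠ 0) :
    HasDerivAt (fun s : ℝ => |s| ^ r) (r * |t| ^ r / t) t := by
  have h := (hasDerivAt_abs ht).rpow_const (p := r) (Or.inl (abs_ne_zero.2 ht))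
  convert h using 1
  rw [Real.rpow_sub_one (abs_ne_zero.2 ht)]
  rcases lt_or_gt_of_ne ht with h | h
  · simp [abs_of_neg h, h]; field_simp
  · simp [abs_of_pos h, h]; field_simp

lemma contDiffAt_abs_rpow (r : ℝ) {t : ℝ} (ht : t ≠ 0) :
    ContDiffAt ℝ ∞ (fun s : ℝ => |s| ^ r) t :=
  (contDiffAt_abs ht).rpow_const_of_ne (abs_ne_zero.2 ht)

end Determinant

variable {n : ℕ} {M : Type*} [TopologicalSpace M] [ChartedSpace (EuclideanHalfSpace (n + 1)) M]
  [IsManifold (𝓡∂ (n + 1)) ∞ M] {r : ℝ}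

/-! ### Densities in coordinates -/

/-- The component of a density field with respect to the coordinate frame of the chart at `p`. -/
def dcomp (p : M) (σ : (x : M) → Dens n r x) (y : M) : ℝ := (σ y).1 (fun i => fr p i y)

lemma frBasis_coe (p : M) {y : M} (hy : y ∈ dom n p) :
    (⇑(frBasis p hy) : Fin (n + 1) → T n y) = fun i => fr p i y :=
  funext (frBasis_apply p hy)

lemma frBasis_det (p : M) {y : M} (hy : y ∈ dom n p) (e : Fin (n + 1) → T n y) :
    (frBasis p hy).det e = (Matrix.of fun i j => co p i y (e j)).det := by
  rw [Module.Basis.det_apply]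
  congr 1
  ext i j
  rw [Module.Basis.toMatrix_apply, Matrix.of_apply, co_apply p hy]

lemma density_apply_frame (p : M) {y : M} (hy : y ∈ dom n p) (φ : Dens n r y)
    {e : Fin (n + 1) → T n y} (he : LinearIndependent ℝ e) :
    φ.1 e = |(Matrix.of fun i j => co p i y (e j)).det| ^ r * φ.1 (fun i => fr p i y) := by
  have hfin : Module.finrank ℝ (T n y) = n + 1 := by
    rw [Module.finrank_eq_card_basis (tBasis y), Fintype.card_fin]
  have hb : (⇑(basisOfLinearIndependentOfCardEqFinrank he (by simp [hfin])) :
      Fin (n + 1) → T n y) = e := coe_basisOfLinearIndependentOfCardEqFinrank he _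
  rw [← hb, density_apply_basis φ (frBasis p hy), frBasis_coe, frBasis_det]

lemma frame_det_ne_zero (p : M) {y : M} (hy : y ∈ dom n p)
    {e : Fin (n + 1) → T n y} (he : LinearIndependent ℝ e) :
    (Matrix.of fun i j => co p i y (e j)).det ≠ 0 := by
  have hfin : Module.finrank ℝ (T n y) = n + 1 := by
    rw [Module.finrank_eq_card_basis (tBasis y), Fintype.card_fin]
  have hb : (⇑(basisOfLinearIndependentOfCardEqFinrank he (by simp [hfin])) :
      Fin (n + 1) → T n y) = e := coe_basisOfLinearIndependentOfCardEqFinrank he _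
  rw [← frBasis_det p hy, ← hb]
  exact ((frBasis p hy).isUnit_det _).ne_zero

lemma eq_of_dcomp_eq (p : M) {y : M} (hy : y ∈ dom n p) (φ ψ : Dens n r y)
    (h : φ.1 (fun i => fr p i y) = ψ.1 (fun i => fr p i y)) : φ = ψ :=
  density_ext φ ψ (frBasis p hy) (by rwa [frBasis_coe])

lemma fr_isLocalFrameOn (p : M) {u : Set M} (hup : u ⊆ dom n p) :
    IsLocalFrameOn (𝓡∂ (n + 1)) (EuclideanSpace ℝ (Fin (n + 1))) ∞ (fr (n := n) p) u := by
  refine IsLocalFrameOn.mono ?_ (hup.trans (dom_eq_baseSet (n := n) p).subset)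
  exact Bundle.Trivialization.isLocalFrameOn_localFrame_baseSet _ _ _ _

lemma SmoothDensOn.dcomp {σ : (x : M) → Dens n r x} {u : Set M} (hσ : SmoothDensOn σ u) (p : M)
    {w : Set M} (hw : IsOpen w) (hwu : w ⊆ u) (hwp : w ⊆ dom n p) :
    SmoothFn n (dcomp p σ) w :=
  hσ (fr p) w hw hwu (fr_isLocalFrameOn p hwp)

/-- Passing to another smooth frame multiplies the component by |det|^r of a smooth, nowhere
vanishing determinant, so testing on coordinate frames is enough. -/
lemma smoothDensOn_of_dcomp {σ : (x : M) → Dens n r x} {u : Set M}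
    (h : ∀ x ∈ u, ∃ (p : M) (w : Set M), IsOpen w ∧ x ∈ w ∧ w ⊆ dom n p ∧
      SmoothFn n (dcomp p σ) w) : SmoothDensOn σ u := by
  intro e V hV hVu he x hx
  obtain ⟨p, w, hw, hxw, hwp, hs⟩ := h x (hVu hx)
  have hVw : IsOpen (V ∩ w) := hV.inter hw
  have hli : ∀ z ∈ V ∩ w, LinearIndependent ℝ fun i => e i z := fun z hz =>
    he.linearIndependent hz.1
  have h1 : SmoothFn n (fun z => |(Matrix.of fun i j => co p i z (e j z)).det| ^ r * dcomp p σ z)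
      (V ∩ w) := by
    refine SmoothFn.mul ?_ (hs.mono Set.inter_subset_right)
    refine SmoothFn.comp (F := fun t => |t| ^ r) (SmoothFn.det fun i j => ?_) fun z hz =>
      contDiffAt_abs_rpow r (frame_det_ne_zero p (hwp hz.2) (hli z hz))
    exact (smoothVF_iff p hVw (Set.inter_subset_right.trans hwp)).1
      ((he.contMDiffOn j).mono Set.inter_subset_left) i
  have h2 : SmoothFn n (fun z => (σ z).1 fun i => e i z) (V ∩ w) :=
    h1.congr fun z hz => density_apply_frame p (hwp hz.2) (σ z) (hli z hz)
  exact ((h2.contMDiffAt (hVw.mem_nhds ⟨hx, hxw⟩))).contMDiffWithinAt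

/-- The trace of the connection form of `D`, in the preferred chart at `p`. -/
def gam (D : ConnOp n M) (p : M) (i : Fin (n + 1)) (y : M) : ℝ := ∑ k, Gam D p k i k y

/-- Evaluating extensions at `z` is a linear isomorphism from the tangent space at `y`, namely the
one matching the coordinate frames. -/
lemma ext_linearIndependent {y z : M} (hz : z ∈ dom n y) :
    LinearIndependent ℝ fun i => ext (tBasis (n := n) y i) z := by
  let E := (frBasis y (mem_dom y)).equiv (frBasis (n := n) y hz) (Equiv.refl _)
  have hE : ∀ v : T n y, ext v z = E v := by
    intro v
    rw [ext_eq_sum v hz]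
    conv_rhs => rw [← sum_co_fr y (mem_dom y) v]
    simp only [map_sum, map_smul]
    refine Finset.sum_congr rfl fun i _ => ?_
    rw [← frBasis_apply y (mem_dom y), ← frBasis_apply y hz]
    simp [E]
  simp only [hE]
  exact (tBasis (n := n) y).linearIndependent.map' (E : T n y →ₗ[ℝ] T n z) (by simp)

/-- The induced connection on densities in coordinates. -/
lemma covDerivDens_dcomp {D : ConnOp n M} {u : Set M} (hD : IsAffineConnectionOn D u)
    (hu : IsOpen u) (p : M) {y : M} (hyu : y ∈ u) (hy : y ∈ dom n p) {σ : (x : M) → Dens n r x}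
    (hσ : DiffFnAt n (dcomp p σ) y) (v : T n y) :
    (covDerivDens D σ y v).1 (fun i => fr p i y) =
      dAt (dcomp p σ) y v - r * (∑ i, co p i y (D (fr p i) y v)) * dcomp p σ y := by
  let b := tBasis (n := n) y
  -- `A` is the transition matrix between the coordinate frame at `p` and the frame of extensions
  -- used in the definition, and `Θ` below satisfies dA = A Θ. Changing frames adds tr Θ to the
  -- trace of the connection form, while differentiating |det A|^r produces r tr Θ; the two
  -- contributions cancel.
  let A : M → Matrix (Fin (n + 1)) (Fin (n + 1)) ℝ := fun z =>
    Matrix.of fun i j => co p i z (ext (b j) z)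
  have hb : (fun i => ext (b i) y) = ⇑b := funext fun i => ext_apply_self _
  have hA : ∀ i j, DiffFnAt n (fun z => A z i j) y := fun i j =>
    (diffVFAt_iff p hy).1 (ext_diff (b j)) i
  let W : Fin (n + 1) → T n y := fun j => ∑ i, dAt (fun z => A z i j) y v • fr p i y
  let Θ : Matrix (Fin (n + 1)) (Fin (n + 1)) ℝ := Matrix.of fun k j => b.repr (W j) k
  have hcoW : ∀ i j, co p i y (W j) = dAt (fun z => A z i j) y v := by
    intro i j
    simp [W, co_fr p hy]
  have hΘ : ∀ i j, dAt (fun z => A z i j) y v = ∑ k, A y i k * Θ k j := by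
    intro i j
    have h := congrArg (co p i y) (b.sum_repr (W j))
    rw [map_sum] at h
    rw [← hcoW, ← h]
    refine Finset.sum_congr rfl fun k _ => ?_
    rw [map_smul, smul_eq_mul, mul_comm]
    simp only [A, Θ, Matrix.of_apply, ext_apply_self, b]
  have hdet : (A y).det ≠ 0 := frame_det_ne_zero p hy (ext_linearIndependent (mem_dom y))
  have htr : ∑ i, b.repr (D (ext (b i)) y v) i =
      ∑ i, co p i y (D (fr p i) y v) + Θ.trace := by
    let L : T n y →ₗ[ℝ] T n y := ∑ j, (co p j y).smulRight (D (fr p j) y v)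
    have hL : ∀ a, L a = ∑ j, co p j y a • D (fr p j) y v := fun a => by simp [L]
    have h1 : ∀ i, D (ext (b i)) y v = L (b i) + W i := by
      intro i
      rw [← sum_co_fr p hy (D (ext (b i)) y v), ← sum_co_fr p hy (L (b i) + W i)]
      refine Finset.sum_congr rfl fun k _ => ?_
      rw [hD.co_apply hu p hyu hy (ext_diff (b i)) k v, map_add, hcoW, hL, ext_apply_self]
      simp only [map_sum, map_smul, smul_eq_mul]
      exact congrArg (· • fr p k y) (add_comm (G := ℝ) _ _)
    simp only [h1, map_add, Finsupp.add_apply, Finset.sum_add_distrib]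
    congr 1
    rw [sum_tBasis_repr_eq p hy L]
    refine Finset.sum_congr rfl fun i _ => ?_
    rw [hL]
    simp [co_fr p hy]
  have hval := density_apply_frame p hy (covDerivDens D σ y v)
    (ext_linearIndependent (n := n) (mem_dom y))
  rw [show (Matrix.of fun i j => co p i y (ext (tBasis (n := n) y j) y)) = A y from rfl] at hval
  have hpos : |(A y).det| ^ r ≠ 0 := (Real.rpow_pos_of_pos (abs_pos.2 hdet) r).ne'
  apply mul_left_cancel₀ hpos
  rw [← hval, hb, covDerivDens, densityOfBasis_apply_self]
  have hnear : (fun z => (σ z).1 (fun i => ext (b i) z)) =ᶠ[𝓝 y]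
      fun z => |(A z).det| ^ r * dcomp p σ z := by
    filter_upwards [(isOpen_dom (n := n) p).mem_nhds hy, (isOpen_dom (n := n) y).mem_nhds (mem_dom y)] with z hz hz'
    exact density_apply_frame p hz (σ z) (ext_linearIndependent hz')
  have hy0 : (σ y).1 b = |(A y).det| ^ r * dcomp p σ y := by
    rw [← hb]; exact hnear.eq_of_nhds
  have hdA := DiffFnAt.det hA
  rw [dAt_congr hnear, dAt_mul (DiffFnAt.comp (F := fun t => |t| ^ r) hdA
    (hasDerivAt_abs_rpow r hdet).differentiableAt) hσ,
    dAt_comp (F := fun t => |t| ^ r) hdA (hasDerivAt_abs_rpow r hdet), dAt_det hA v Θ hΘ, htr, hy0]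
  field_simp
  ring

end

section

variable {n : ℕ} {M : Type*} [TopologicalSpace M] [ChartedSpace (EuclideanHalfSpace (n + 1)) M]
  [IsManifold (𝓡∂ (n + 1)) ∞ M] {r : ℝ}

/-! ### Covariant derivatives of forms in coordinates -/

lemma co_ext_diff (p : M) {y : M} (hy : y ∈ dom n p) (v : T n y) (c : Fin (n + 1)) :
    DiffFnAt n (fun z => co p c z (ext v z)) y :=
  (diffVFAt_iff p hy).1 (ext_diff v) c

lemma diffFnAt_form (p : M) {y : M} (hy : y ∈ dom n p) {β : (x : M) → T n x → ℝ}
    {b : Fin (n + 1) → M → ℝ} (hb : ∀ c, DiffFnAt n (b c) y)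
    (hβ : ∀ᶠ z in 𝓝 y, ∀ v, β z v = ∑ c, co p c z v * b c z) (v : T n y) :
    DiffFnAt n (fun z => β z (ext v z)) y := by
  refine DiffFnAt.congr (DiffFnAt.sum Finset.univ fun c _ => (co_ext_diff p hy v c).mul (hb c)) ?_
  filter_upwards [hβ] with z hz
  exact hz _

lemma deriv_form {D : ConnOp n M} {u : Set M} (hD : IsAffineConnectionOn D u)
    (hu : IsOpen u) (p : M) {y : M} (hyu : y ∈ u) (hy : y ∈ dom n p) {β : (x : M) → T n x → ℝ}
    {b : Fin (n + 1) → M → ℝ} (hb : ∀ c, DiffFnAt n (b c) y)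
    (hβ : ∀ᶠ z in 𝓝 y, ∀ v, β z v = ∑ c, co p c z v * b c z) (a v : T n y) :
    dAt (fun z => β z (ext v z)) y a - β y (D (ext v) y a) =
      ∑ c, co p c y v * (dAt (b c) y a - ∑ e, co p e y (D (fr p c) y a) * b e y) := by
  have h1 : (fun z => β z (ext v z)) =ᶠ[𝓝 y] fun z => ∑ c, co p c z (ext v z) * b c z := by
    filter_upwards [hβ] with z hz
    exact hz _
  have h2 := hβ.self_of_nhds
  rw [dAt_congr h1, dAt_sum _ fun c _ => (co_ext_diff p hy v c).mul (hb c), h2]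
  simp only [dAt_mul (co_ext_diff p hy v _) (hb _), hD.co_apply hu p hyu hy (ext_diff v),
    ext_apply_self, add_mul, mul_sub, Finset.sum_add_distrib, Finset.sum_sub_distrib,
    Finset.mul_sum, Finset.sum_mul]
  rw [Finset.sum_comm (f := fun c j => co p j y v * co p c y (D (fr p j) y a) * b c y)]
  simp only [mul_comm (dAt _ y a), mul_assoc]
  ring

lemma diffFnAt_bilin (p : M) {y : M} (hy : y ∈ dom n p) {β : (x : M) → T n x → T n x → ℝ}
    {b : Fin (n + 1) → Fin (n + 1) → M → ℝ} (hb : ∀ c d, DiffFnAt n (b c d) y)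
    (hβ : ∀ᶠ z in 𝓝 y, ∀ v w, β z v w = ∑ c, ∑ d, co p c z v * co p d z w * b c d z)
    (v w : T n y) : DiffFnAt n (fun z => β z (ext v z) (ext w z)) y := by
  refine DiffFnAt.congr (DiffFnAt.sum Finset.univ fun c _ => DiffFnAt.sum Finset.univ fun d _ =>
    ((co_ext_diff p hy v c).mul (co_ext_diff p hy w d)).mul (hb c d)) ?_
  filter_upwards [hβ] with z hz
  exact hz _ _

/-- The derivatives of the coefficients of `ext v` and `ext w` cancel against the same derivatives
inside `D (ext v)` and `D (ext w)`, leaving a formula in the values `v` and `w` alone. -/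
lemma covDerivBilin_eq {D : ConnOp n M} {u : Set M} (hD : IsAffineConnectionOn D u)
    (hu : IsOpen u) (p : M) {y : M} (hyu : y ∈ u) (hy : y ∈ dom n p)
    {β : (x : M) → T n x → T n x → ℝ}
    {b : Fin (n + 1) → Fin (n + 1) → M → ℝ} (hb : ∀ c d, DiffFnAt n (b c d) y)
    (hβ : ∀ᶠ z in 𝓝 y, ∀ v w, β z v w = ∑ c, ∑ d, co p c z v * co p d z w * b c d z)
    (a v w : T n y) : covDerivBilin D β y a v w =
      ∑ c, ∑ d, co p c y v * co p d y w * (dAt (b c d) y a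
        - ∑ e, co p e y (D (fr p c) y a) * b e d y
        - ∑ e, co p e y (D (fr p d) y a) * b c e y) := by
  have h1 : (fun z => β z (ext v z) (ext w z)) =ᶠ[𝓝 y]
      fun z => ∑ c, co p c z (ext v z) * ∑ d, co p d z (ext w z) * b c d z := by
    filter_upwards [hβ] with z hz
    simp only [hz, Finset.mul_sum, mul_assoc]
  have h2 := hβ.self_of_nhds
  have hd : ∀ c, DiffFnAt n (fun z => ∑ d, co p d z (ext w z) * b c d z) y := fun c =>
    DiffFnAt.sum _ fun d _ => (co_ext_diff p hy w d).mul (hb c d)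
  rw [covDerivBilin, dAt_congr h1, dAt_sum _ fun c _ => (co_ext_diff p hy v c).mul (hd c), h2, h2]
  have h3 : ∀ c, dAt (fun z => ∑ d, co p d z (ext w z) * b c d z) y a =
      ∑ d, (co p d y w * dAt (b c d) y a + b c d y * dAt (fun z => co p d z (ext w z)) y a) := by
    intro c
    rw [dAt_sum _ fun d _ => (co_ext_diff p hy w d).mul (hb c d)]
    simp only [dAt_mul (co_ext_diff p hy w _) (hb _ _), ext_apply_self]
  simp only [dAt_mul (co_ext_diff p hy v _) (hd _), h3]
  simp only [hD.co_apply hu p hyu hy (ext_diff _), ext_apply_self, add_mul, mul_add, mul_sub, Finset.sum_add_distrib, Finset.sum_sub_distrib,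
    Finset.mul_sum, Finset.sum_mul]
  have e1 : ∑ c, ∑ d, ∑ j, co p j y v * co p c y (D (fr p j) y a) * co p d y w * b c d y =
      ∑ c, ∑ d, ∑ j, co p c y v * co p d y w * (co p j y (D (fr p c) y a) * b j d y) := by
    rw [Finset.sum_comm]
    conv_rhs => rw [Finset.sum_comm]
    refine Finset.sum_congr rfl fun d _ => ?_
    rw [Finset.sum_comm]
    exact Finset.sum_congr rfl fun c _ => Finset.sum_congr rfl fun j _ => by ring
  have e2 : ∑ c, ∑ d, ∑ j, co p c y v * (co p j y w * co p d y (D (fr p j) y a)) * b c d y =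
      ∑ c, ∑ d, ∑ j, co p c y v * co p d y w * (co p j y (D (fr p d) y a) * b c j y) := by
    refine Finset.sum_congr rfl fun d _ => ?_
    rw [Finset.sum_comm]
    exact Finset.sum_congr rfl fun c _ => Finset.sum_congr rfl fun j _ => by ring
  rw [e1, e2]
  have e3 : ∑ c, ∑ d, co p c y v * (b c d y * dAt (fun z => co p d z (ext w z)) y a) =
      ∑ c, ∑ d, co p c y v * dAt (fun z => co p d z (ext w z)) y a * b c d y :=
    Finset.sum_congr rfl fun c _ => Finset.sum_congr rfl fun d _ => by ring
  have e4 : ∑ c, ∑ d, co p d y w * b c d y * dAt (fun z => co p c z (ext v z)) y a =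
      ∑ c, ∑ d, dAt (fun z => co p c z (ext v z)) y a * co p d y w * b c d y :=
    Finset.sum_congr rfl fun c _ => Finset.sum_congr rfl fun d _ => by ring
  rw [e3, e4]
  simp only [mul_assoc]
  ring

/-! ### Density-valued forms -/

/-- The components of the covariant derivative of a density of order `r`. -/
def cdS (r : ℝ) (D : ConnOp n M) (p : M) (a : Fin (n + 1)) (f : M → ℝ) (y : M) : ℝ :=
  pd p a f y - r * gam D p a y * f y

/-- The components of the covariant derivative of a one-form with values in densities of
order `r`. -/
def cdF (r : ℝ) (D : ConnOp n M) (p : M) (a c : Fin (n + 1)) (b : Fin (n + 1) → M → ℝ) (y : M) : ℝ :=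
  pd p a (b c) y - ∑ e, Gam D p e a c y * b e y - r * gam D p a y * b c y

/-- The components of the covariant derivative of a bilinear form with values in densities of
order `r`. -/
def cdB (r : ℝ) (D : ConnOp n M) (p : M) (a c d : Fin (n + 1))
    (b : Fin (n + 1) → Fin (n + 1) → M → ℝ) (y : M) : ℝ :=
  pd p a (b c d) y - ∑ e, Gam D p e a c y * b e d y - ∑ e, Gam D p e a d y * b c e y
    - r * gam D p a y * b c d y

lemma sum_co_gam {D : ConnOp n M} (p : M) {y : M} (hy : y ∈ dom n p) (v : T n y) :
    ∑ i, co p i y (D (fr p i) y v) = ∑ a, co p a y v * gam D p a y := by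
  simp only [IsAffineConnectionOn.co_fr_apply (D := D) p hy, gam, Finset.mul_sum]
  exact Finset.sum_comm

lemma sum_co_Gam {D : ConnOp n M} (p : M) {y : M} (hy : y ∈ dom n p) (c : Fin (n + 1))
    (b : Fin (n + 1) → ℝ) (v : T n y) :
    ∑ e, co p e y (D (fr p c) y v) * b e = ∑ a, co p a y v * ∑ e, Gam D p e a c y * b e := by
  simp only [IsAffineConnectionOn.co_fr_apply (D := D) p hy, Finset.mul_sum, Finset.sum_mul]
  rw [Finset.sum_comm]
  exact Finset.sum_congr rfl fun e _ => Finset.sum_congr rfl fun c _ => by ring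

lemma covDerivDens_eq {D : ConnOp n M} {u : Set M} (hD : IsAffineConnectionOn D u)
    (hu : IsOpen u) (p : M) {y : M} (hyu : y ∈ u) (hy : y ∈ dom n p) {σ : (x : M) → Dens n r x}
    (hσ : DiffFnAt n (dcomp p σ) y) (v : T n y) :
    (covDerivDens D σ y v).1 (fun i => fr p i y) =
      ∑ a, co p a y v * cdS r D p a (dcomp p σ) y := by
  rw [covDerivDens_dcomp hD hu p hyu hy hσ, dAt_eq_sum p hy, sum_co_gam p hy]
  simp only [cdS, mul_sub, Finset.sum_sub_distrib, Finset.mul_sum, Finset.sum_mul]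
  congr 1
  exact Finset.sum_congr rfl fun a _ => by ring

lemma covDerivDensForm_eq {D : ConnOp n M} {u : Set M} (hD : IsAffineConnectionOn D u)
    (hu : IsOpen u) (p : M) {y : M} (hyu : y ∈ u) (hy : y ∈ dom n p)
    {ν : (x : M) → T n x → Dens n r x}
    {b : Fin (n + 1) → M → ℝ} (hb : ∀ c, DiffFnAt n (b c) y)
    (hν : ∀ᶠ z in 𝓝 y, ∀ v, (ν z v).1 (fun i => fr p i z) = ∑ c, co p c z v * b c z)
    (a v : T n y) : (covDerivDensForm D ν y a v).1 (fun i => fr p i y) =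
      ∑ c, co p c y v * ∑ e, co p e y a * cdF r D p e c b y := by
  have h1 := deriv_form hD hu p hyu hy (β := fun z v => (ν z v).1 (fun i => fr p i z)) hb hν a v
  have h2 := diffFnAt_form p hy (β := fun z v => (ν z v).1 (fun i => fr p i z)) hb hν v
  have h3 : (covDerivDensForm D ν y a v).1 (fun i => fr p i y) =
      (covDerivDens D (fun z => ν z (ext v z)) y a).1 (fun i => fr p i y)
        - (ν y (D (ext v) y a)).1 (fun i => fr p i y) := rfl
  have h4 := hν.self_of_nhds v
  have h5 : dcomp p (fun z => ν z (ext v z)) = fun z => (ν z (ext v z)).1 (fun i => fr p i z) := rfl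
  rw [h3, covDerivDens_dcomp hD hu p hyu hy h2, h5]
  simp only [ext_apply_self]
  rw [sub_right_comm, h1, h4, Finset.mul_sum, ← Finset.sum_sub_distrib]
  refine Finset.sum_congr rfl fun c _ => ?_
  rw [dAt_eq_sum p hy, sum_co_Gam p hy, sum_co_gam p hy]
  simp only [cdF, mul_sub, Finset.sum_sub_distrib, Finset.mul_sum, Finset.sum_mul]
  congr 1
  exact Finset.sum_congr rfl fun a _ => by ring

lemma covDerivBilin_eq_sum {D : ConnOp n M} {u : Set M} (hD : IsAffineConnectionOn D u)
    (hu : IsOpen u) (p : M) {y : M} (hyu : y ∈ u) (hy : y ∈ dom n p)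
    {β : (x : M) → T n x → T n x → ℝ}
    {b : Fin (n + 1) → Fin (n + 1) → M → ℝ} (hb : ∀ c d, DiffFnAt n (b c d) y)
    (hβ : ∀ᶠ z in 𝓝 y, ∀ v w, β z v w = ∑ c, ∑ d, co p c z v * co p d z w * b c d z)
    (a v w : T n y) : covDerivBilin D β y a v w =
      ∑ c, ∑ d, co p c y v * co p d y w * ∑ e, co p e y a * cdB 0 D p e c d b y := by
  rw [covDerivBilin_eq hD hu p hyu hy hb hβ]
  refine Finset.sum_congr rfl fun c _ => Finset.sum_congr rfl fun d _ => ?_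
  rw [dAt_eq_sum p hy, sum_co_Gam p hy, sum_co_Gam p hy]
  simp only [cdB, mul_sub, Finset.sum_sub_distrib, Finset.mul_sum, zero_mul, sub_zero]

lemma covDerivDensBilin_eq {D : ConnOp n M} {u : Set M} (hD : IsAffineConnectionOn D u)
    (hu : IsOpen u) (p : M) {y : M} (hyu : y ∈ u) (hy : y ∈ dom n p)
    {ν : (x : M) → T n x → T n x → Dens n r x}
    {b : Fin (n + 1) → Fin (n + 1) → M → ℝ} (hb : ∀ c d, DiffFnAt n (b c d) y)
    (hν : ∀ᶠ z in 𝓝 y, ∀ v w, (ν z v w).1 (fun i => fr p i z) =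
      ∑ c, ∑ d, co p c z v * co p d z w * b c d z)
    (a v w : T n y) : (covDerivDensBilin D ν y a v w).1 (fun i => fr p i y) =
      ∑ c, ∑ d, co p c y v * co p d y w * ∑ e, co p e y a * cdB r D p e c d b y := by
  let β : (x : M) → T n x → T n x → ℝ := fun z v w => (ν z v w).1 (fun i => fr p i z)
  have h1 := covDerivBilin_eq_sum hD hu p hyu hy (β := β) hb hν a v w
  have h2 := diffFnAt_bilin p hy (β := β) hb hν v w
  have h3 : (covDerivDensBilin D ν y a v w).1 (fun i => fr p i y) =
      (covDerivDens D (fun z => ν z (ext v z) (ext w z)) y a).1 (fun i => fr p i y)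
        - β y (D (ext v) y a) w - β y v (D (ext w) y a) := rfl
  have h4 := hν.self_of_nhds v w
  have h5 : dcomp p (fun z => ν z (ext v z) (ext w z)) = fun z => β z (ext v z) (ext w z) := rfl
  -- The density weight only adds a trace term to the formula for scalar-valued bilinear forms.
  have h6 : ∀ c d e, cdB r D p e c d b y = cdB 0 D p e c d b y - r * gam D p e y * b c d y :=
    fun c d e => by simp [cdB]
  rw [h3, covDerivDens_dcomp hD hu p hyu hy h2, h5]
  rw [covDerivBilin] at h1
  have h7 : ∀ s t, dAt (fun z => β z (ext v z) (ext w z)) y a - s - β y (D (ext v) y a) w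
      - β y v (D (ext w) y a) + t = (∑ c, ∑ d, co p c y v * co p d y w *
        ∑ e, co p e y a * cdB 0 D p e c d b y) - s + t := fun s t => by rw [← h1]; ring
  have h8 := h7 (r * (∑ i, co p i y (D (fr p i) y a)) * β y v w) 0
  simp only [add_zero] at h8
  simp only [ext_apply_self]
  refine h8.trans ?_
  rw [show β y v w = _ from h4, sum_co_gam p hy]
  simp only [h6, mul_sub, Finset.sum_sub_distrib, Finset.mul_sum, Finset.sum_mul]
  congr 1
  exact Finset.sum_congr rfl fun c _ => Finset.sum_congr rfl fun d _ =>
    Finset.sum_congr rfl fun e _ => by ring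

end

section

variable {n : ℕ} {M : Type*} [TopologicalSpace M] [ChartedSpace (EuclideanHalfSpace (n + 1)) M]
  [IsManifold (𝓡∂ (n + 1)) ∞ M] {r : ℝ}

/-! ### Smoothness of the coordinate expressions -/

section Smooth

variable [T2Space M] {D : ConnOp n M} {u : Set M} {p : M} {w : Set M}

lemma gam_smooth (hD : IsAffineConnectionOn D u) (hu : IsOpen u) (hw : IsOpen w) (hwu : w ⊆ u)
    (hwp : w ⊆ dom n p) (i : Fin (n + 1)) : SmoothFn n (gam D p i) w :=
  SmoothFn.sum _ fun k _ => Gam_smooth hD hu hw hwu hwp k i k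

lemma Ric_smooth (hD : IsAffineConnectionOn D u) (hu : IsOpen u) (hw : IsOpen w) (hwu : w ⊆ u)
    (hwp : w ⊆ dom n p) (j m : Fin (n + 1)) : SmoothFn n (Ric D p j m) w := by
  have h := Gam_smooth hD hu hw hwu hwp
  exact SmoothFn.sum _ fun i _ => ((pd_smooth p i hw hwp (h i j m)).sub
    (pd_smooth p j hw hwp (h i i m))).add (SmoothFn.sum _ fun k _ =>
      ((h i i k).mul (h k j m)).sub ((h i j k).mul (h k i m)))

/-- The components of the projective Schouten tensor. -/
def Sch (D : ConnOp n M) (p : M) (j m : Fin (n + 1)) (y : M) : ℝ :=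
  (((n : ℝ) + 1) * Ric D p j m y + Ric D p m j y) / (((n : ℝ) + 1) ^ 2 - 1)

lemma Sch_smooth (hD : IsAffineConnectionOn D u) (hu : IsOpen u) (hw : IsOpen w) (hwu : w ⊆ u)
    (hwp : w ⊆ dom n p) (j m : Fin (n + 1)) : SmoothFn n (Sch D p j m) w := by
  have h := Ric_smooth hD hu hw hwu hwp
  have h2 := (((h j m).const_mul ((n : ℝ) + 1)).add (h m j)).const_mul ((((n : ℝ) + 1) ^ 2 - 1)⁻¹)
  exact h2.congr fun y _ => by rw [Sch, div_eq_inv_mul]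

lemma schouten_eq (hD : IsAffineConnectionOn D u) (hu : IsOpen u) {y : M} (hy : y ∈ u)
    (hyp : y ∈ dom n p) (v w : T n y) :
    schouten D y v w = ∑ j, ∑ m, co p j y v * co p m y w * Sch D p j m y := by
  have h : ricci D y w v = ∑ j, ∑ m, co p j y v * co p m y w * Ric D p m j y := by
    rw [ricci_eq hD hu hy hyp, Finset.sum_comm]
    exact Finset.sum_congr rfl fun j _ => Finset.sum_congr rfl fun m _ => by ring
  rw [schouten, h, ricci_eq hD hu hy hyp, Finset.mul_sum, ← Finset.sum_add_distrib,
    Finset.sum_div]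
  refine Finset.sum_congr rfl fun j _ => ?_
  rw [Finset.mul_sum, ← Finset.sum_add_distrib, Finset.sum_div]
  refine Finset.sum_congr rfl fun m _ => ?_
  rw [Sch]; ring

lemma cdS_smooth (hD : IsAffineConnectionOn D u) (hu : IsOpen u) (hw : IsOpen w) (hwu : w ⊆ u)
    (hwp : w ⊆ dom n p) (a : Fin (n + 1)) {f : M → ℝ} (hf : SmoothFn n f w) :
    SmoothFn n (cdS r D p a f) w :=
  (pd_smooth p a hw hwp hf).sub (((gam_smooth hD hu hw hwu hwp a).const_mul r).mul hf)

lemma cdF_smooth (hD : IsAffineConnectionOn D u) (hu : IsOpen u) (hw : IsOpen w) (hwu : w ⊆ u)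
    (hwp : w ⊆ dom n p) (a c : Fin (n + 1)) {b : Fin (n + 1) → M → ℝ}
    (hb : ∀ c, SmoothFn n (b c) w) : SmoothFn n (cdF r D p a c b) w :=
  ((pd_smooth p a hw hwp (hb c)).sub (SmoothFn.sum _ fun e _ =>
    (Gam_smooth hD hu hw hwu hwp e a c).mul (hb e))).sub
    (((gam_smooth hD hu hw hwu hwp a).const_mul r).mul (hb c))

lemma cdB_smooth (hD : IsAffineConnectionOn D u) (hu : IsOpen u) (hw : IsOpen w) (hwu : w ⊆ u)
    (hwp : w ⊆ dom n p) (a c d : Fin (n + 1)) {b : Fin (n + 1) → Fin (n + 1) → M → ℝ}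
    (hb : ∀ c d, SmoothFn n (b c d) w) : SmoothFn n (cdB r D p a c d b) w :=
  (((pd_smooth p a hw hwp (hb c d)).sub (SmoothFn.sum _ fun e _ =>
    (Gam_smooth hD hu hw hwu hwp e a c).mul (hb e d))).sub (SmoothFn.sum _ fun e _ =>
    (Gam_smooth hD hu hw hwu hwp e a d).mul (hb c e))).sub
    (((gam_smooth hD hu hw hwu hwp a).const_mul r).mul (hb c d))

end Smooth

/-! ### The splitting operator in coordinates -/

/-- The order of the densities of projective weight two. -/
abbrev wt (n : ℕ) : ℝ := -2 / ((n : ℝ) + 2)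

/-- The middle component of the splitting operator in coordinates. -/
def nuC (D : ConnOp n M) (p : M) (s : M → ℝ) (a : Fin (n + 1)) (y : M) : ℝ :=
  1 / 2 * cdS (wt n) D p a s y

/-- The bottom component of the splitting operator in coordinates. -/
def rhoC (D : ConnOp n M) (p : M) (s : M → ℝ) (b c : Fin (n + 1)) (y : M) : ℝ :=
  1 / 2 * (cdF (wt n) D p b c (nuC D p s) y + cdF (wt n) D p c b (nuC D p s) y)
    + 1 / 2 * (Sch D p b c y + Sch D p c b y) * s y

section Splitting

variable [T2Space M] {D : ConnOp n M} {u : Set M} {p : M} {w : Set M}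

lemma nuC_smooth (hD : IsAffineConnectionOn D u) (hu : IsOpen u) (hw : IsOpen w) (hwu : w ⊆ u)
    (hwp : w ⊆ dom n p) {s : M → ℝ} (hs : SmoothFn n s w) (a : Fin (n + 1)) :
    SmoothFn n (nuC D p s a) w :=
  (cdS_smooth hD hu hw hwu hwp a hs).const_mul _

lemma rhoC_smooth (hD : IsAffineConnectionOn D u) (hu : IsOpen u) (hw : IsOpen w) (hwu : w ⊆ u)
    (hwp : w ⊆ dom n p) {s : M → ℝ} (hs : SmoothFn n s w) (b c : Fin (n + 1)) :
    SmoothFn n (rhoC D p s b c) w := by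
  have hF := fun b c => cdF_smooth (r := wt n) hD hu hw hwu hwp b c
    (nuC_smooth hD hu hw hwu hwp hs)
  have hS := Sch_smooth hD hu hw hwu hwp
  exact (((hF b c).add (hF c b)).const_mul _).add ((((hS b c).add (hS c b)).const_mul _).mul hs)

variable {τ : (x : M) → ProjDens n 2 x}

lemma splitting_mid_eq (hD : IsAffineConnectionOn D u) (hu : IsOpen u) (hw : IsOpen w)
    (hwu : w ⊆ u) (hwp : w ⊆ dom n p) (hs : SmoothFn n (dcomp p τ) w) {y : M} (hy : y ∈ w)
    (v : T n y) : ((splitting D τ).mid y v).1 (fun i => fr p i y) =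
      ∑ a, co p a y v * nuC D p (dcomp p τ) a y := by
  have h : ((splitting D τ).mid y v).1 (fun i => fr p i y) =
    1 / 2 * (covDerivDens D τ y v).1 (fun i => fr p i y) := rfl
  rw [h, covDerivDens_eq hD hu p (hwu hy) (hwp hy) (hs.diffFnAt hw hy), Finset.mul_sum]
  exact Finset.sum_congr rfl fun a _ => by rw [nuC]; ring

lemma splitting_covDerivDensForm_mid (hD : IsAffineConnectionOn D u) (hu : IsOpen u)
    (hw : IsOpen w) (hwu : w ⊆ u) (hwp : w ⊆ dom n p) (hs : SmoothFn n (dcomp p τ) w) {y : M}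
    (hy : y ∈ w) (a v : T n y) :
    (covDerivDensForm D (splitting D τ).mid y a v).1 (fun i => fr p i y) =
      ∑ c, ∑ e, co p e y a * co p c y v * cdF (wt n) D p e c (nuC D p (dcomp p τ)) y := by
  rw [covDerivDensForm_eq hD hu p (hwu hy) (hwp hy) (b := nuC D p (dcomp p τ))
    (fun c => (nuC_smooth hD hu hw hwu hwp hs c).diffFnAt hw hy)]
  · simp only [Finset.mul_sum]
    exact Finset.sum_congr rfl fun c _ => Finset.sum_congr rfl fun e _ => by ring
  · filter_upwards [hw.mem_nhds hy] with z hz v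
    exact splitting_mid_eq hD hu hw hwu hwp hs hz v

lemma splitting_bot_eq (hD : IsAffineConnectionOn D u) (hu : IsOpen u) (hw : IsOpen w)
    (hwu : w ⊆ u) (hwp : w ⊆ dom n p) (hs : SmoothFn n (dcomp p τ) w) {y : M} (hy : y ∈ w)
    (v v' : T n y) : ((splitting D τ).bot y v v').1 (fun i => fr p i y) =
      ∑ b, ∑ c, co p b y v * co p c y v' * rhoC D p (dcomp p τ) b c y := by
  have h : ((splitting D τ).bot y v v').1 (fun i => fr p i y) =
    1 / 2 * ((covDerivDensForm D (splitting D τ).mid y v v').1 (fun i => fr p i y)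
      + (covDerivDensForm D (splitting D τ).mid y v' v).1 (fun i => fr p i y))
      + (1 / 2 * (schouten D y v v' + schouten D y v' v)) * dcomp p τ y := rfl
  rw [h]
  have hm := splitting_covDerivDensForm_mid hD hu hw hwu hwp hs hy
  rw [hm v v', hm v' v, Finset.sum_comm, schouten_eq hD hu (hwu hy) (hwp hy) v v',
    schouten_eq hD hu (hwu hy) (hwp hy) v' v,
    Finset.sum_comm (f := fun j m => co p j y v' * co p m y v * Sch D p j m y),
    ← Finset.sum_add_distrib, ← Finset.sum_add_distrib, Finset.mul_sum, Finset.mul_sum,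
    Finset.sum_mul, ← Finset.sum_add_distrib]
  refine Finset.sum_congr rfl fun b _ => ?_
  rw [← Finset.sum_add_distrib, ← Finset.sum_add_distrib, Finset.mul_sum, Finset.mul_sum,
    Finset.sum_mul, ← Finset.sum_add_distrib]
  refine Finset.sum_congr rfl fun c _ => ?_
  rw [rhoC]; ring

/-- Parallelism of the splitting operator at a point, in coordinates. -/
lemma splitting_isParallel_at (hD : IsAffineConnectionOn D u) (hu : IsOpen u) (hw : IsOpen w)
    (hwu : w ⊆ u) (hwp : w ⊆ dom n p) (hs : SmoothFn n (dcomp p τ) w) {y : M} (hy : y ∈ w)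
    (h1 : ∀ a b, cdF (wt n) D p a b (nuC D p (dcomp p τ)) y + Sch D p a b y * dcomp p τ y
      - rhoC D p (dcomp p τ) a b y = 0)
    (h2 : ∀ a b c, cdB (wt n) D p a b c (rhoC D p (dcomp p τ)) y
      + Sch D p a b y * nuC D p (dcomp p τ) c y
      + Sch D p a c y * nuC D p (dcomp p τ) b y = 0) (a v v' : T n y) :
    covDerivDens D (splitting D τ).top y a - (2 : ℝ) • (splitting D τ).mid y a = 0 ∧
    covDerivDensForm D (splitting D τ).mid y a v + schouten D y a v • (splitting D τ).top y
      - (splitting D τ).bot y a v = 0 ∧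
    covDerivDensBilin D (splitting D τ).bot y a v v' + schouten D y a v • (splitting D τ).mid y v'
      + schouten D y a v' • (splitting D τ).mid y v = 0 := by
  refine ⟨?_, eq_of_dcomp_eq p (hwp hy) _ _ ?_, eq_of_dcomp_eq p (hwp hy) _ _ ?_⟩
  -- The first tractor equation holds by construction, the middle slot being half the derivative of
  -- the top one.
  · simp [splitting, smul_smul]
  · have e : (covDerivDensForm D (splitting D τ).mid y a v + schouten D y a v •
        (splitting D τ).top y - (splitting D τ).bot y a v).1 (fun i => fr p i y) =
      (covDerivDensForm D (splitting D τ).mid y a v).1 (fun i => fr p i y)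
        + schouten D y a v * dcomp p τ y
        - ((splitting D τ).bot y a v).1 (fun i => fr p i y) := rfl
    rw [e, splitting_covDerivDensForm_mid hD hu hw hwu hwp hs hy,
      splitting_bot_eq hD hu hw hwu hwp hs hy, schouten_eq hD hu (hwu hy) (hwp hy),
      Finset.sum_comm, Finset.sum_mul, ← Finset.sum_add_distrib, ← Finset.sum_sub_distrib]
    refine Finset.sum_eq_zero fun b _ => ?_
    rw [Finset.sum_mul, ← Finset.sum_add_distrib, ← Finset.sum_sub_distrib]
    refine Finset.sum_eq_zero fun c _ => ?_
    linear_combination (co p b y a * co p c y v) * h1 b c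
  · have e : (covDerivDensBilin D (splitting D τ).bot y a v v' + schouten D y a v •
        (splitting D τ).mid y v' + schouten D y a v' • (splitting D τ).mid y v).1
          (fun i => fr p i y) =
      (covDerivDensBilin D (splitting D τ).bot y a v v').1 (fun i => fr p i y)
        + schouten D y a v * ((splitting D τ).mid y v').1 (fun i => fr p i y)
        + schouten D y a v' * ((splitting D τ).mid y v).1 (fun i => fr p i y) := rfl
    have hB := covDerivDensBilin_eq hD hu p (hwu hy) (hwp hy) (ν := (splitting D τ).bot)
      (b := rhoC D p (dcomp p τ))
      (fun c d => (rhoC_smooth hD hu hw hwu hwp hs c d).diffFnAt hw hy)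
      (by filter_upwards [hw.mem_nhds hy] with z hz v v'
          exact splitting_bot_eq hD hu hw hwu hwp hs hz v v') a v v'
    rw [e, hB, splitting_mid_eq hD hu hw hwu hwp hs hy, splitting_mid_eq hD hu hw hwu hwp hs hy,
      schouten_eq hD hu (hwu hy) (hwp hy), schouten_eq hD hu (hwu hy) (hwp hy)]
    have e1 : (∑ j, ∑ m, co p j y a * co p m y v * Sch D p j m y) *
        ∑ c, co p c y v' * nuC D p (dcomp p τ) c y = ∑ b, ∑ c, ∑ j, co p b y v * co p c y v' *
          (co p j y a * (Sch D p j b y * nuC D p (dcomp p τ) c y)) := by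
      rw [Finset.sum_comm, Finset.sum_mul]
      refine Finset.sum_congr rfl fun b _ => ?_
      rw [Finset.sum_mul_sum, Finset.sum_comm]
      exact Finset.sum_congr rfl fun c _ => Finset.sum_congr rfl fun j _ => by ring
    have e2 : (∑ j, ∑ m, co p j y a * co p m y v' * Sch D p j m y) *
        ∑ b, co p b y v * nuC D p (dcomp p τ) b y = ∑ b, ∑ c, ∑ j, co p b y v * co p c y v' *
          (co p j y a * (Sch D p j c y * nuC D p (dcomp p τ) b y)) := by
      rw [Finset.sum_comm, Finset.sum_mul, Finset.sum_comm]
      refine Finset.sum_congr rfl fun c _ => ?_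
      rw [Finset.sum_mul_sum, Finset.sum_comm]
      exact Finset.sum_congr rfl fun b _ => Finset.sum_congr rfl fun j _ => by ring
    rw [e1, e2, ← Finset.sum_add_distrib, ← Finset.sum_add_distrib]
    refine Finset.sum_eq_zero fun b _ => ?_
    rw [← Finset.sum_add_distrib, ← Finset.sum_add_distrib]
    refine Finset.sum_eq_zero fun c _ => ?_
    rw [Finset.mul_sum, ← Finset.sum_add_distrib, ← Finset.sum_add_distrib]
    refine Finset.sum_eq_zero fun j _ => ?_
    linear_combination (co p b y v * co p c y v' * co p j y a) * h2 j b c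

/-- Non-degeneracy of the splitting operator at a point, in coordinates. -/
lemma splitting_isNondegenerate_at (hD : IsAffineConnectionOn D u) (hu : IsOpen u) (hw : IsOpen w)
    (hwu : w ⊆ u) (hwp : w ⊆ dom n p) (hs : SmoothFn n (dcomp p τ) w) {y : M} (hy : y ∈ w)
    (h : ∀ (a : ℝ) (v : Fin (n + 1) → ℝ), a * dcomp p τ y + ∑ b, v b * nuC D p (dcomp p τ) b y = 0 →
      (∀ c, a * nuC D p (dcomp p τ) c y + ∑ b, v b * rhoC D p (dcomp p τ) b c y = 0) →
      a = 0 ∧ v = 0) (a : ℝ) (v : T n y)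
    (hav : ∀ (b : ℝ) (v' : T n y), (a * b) • (splitting D τ).top y + a • (splitting D τ).mid y v'
      + b • (splitting D τ).mid y v + (splitting D τ).bot y v v' = 0) : a = 0 ∧ v = 0 := by
  have key : ∀ (b : ℝ) (v' : T n y), a * b * dcomp p τ y
      + a * ∑ c, co p c y v' * nuC D p (dcomp p τ) c y
      + b * ∑ c, co p c y v * nuC D p (dcomp p τ) c y
      + ∑ c, ∑ d, co p c y v * co p d y v' * rhoC D p (dcomp p τ) c d y = 0 := by
    intro b v'
    have e := congrArg (fun φ : ProjDens n 2 y => φ.1 (fun i => fr p i y)) (hav b v')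
    rw [← splitting_mid_eq hD hu hw hwu hwp hs hy, ← splitting_mid_eq hD hu hw hwu hwp hs hy,
      ← splitting_bot_eq hD hu hw hwu hwp hs hy]
    exact e
  -- Testing against (1, 0) and against (0, coordinate vector) gives the rows of the kernel
  -- equation.
  obtain ⟨h1, h2⟩ := h a (fun c => co p c y v) (by simpa using key 1 0) fun c => by
    simpa [co_fr p (hwp hy)] using key 0 (fr p c y)
  refine ⟨h1, ?_⟩
  rw [← sum_co_fr p (hwp hy) v]
  exact Finset.sum_eq_zero fun i _ => by rw [congrFun h2 i]; simp

end Splitting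

end

section

/-! ### Boundary regularity for closed linear systems -/

section LinearSystem

variable {E : Type*} [NormedAddCommGroup E] [NormedSpace ℝ E] {κ : Type*} [Fintype κ]

/-- Solutions of a closed linear system with bounded coefficients are bounded. -/
lemma bounded_of_linear_system {V : Type*} [NormedAddCommGroup V] [NormedSpace ℝ V] {Ω : Set E}
    (hconv : Convex ℝ Ω) {R : ℝ} (hR : ∀ x ∈ Ω, ∀ y ∈ Ω, ‖y - x‖ ≤ R) {L : E → V →L[ℝ] E →L[ℝ] V}
    {C : ℝ} (hC : ∀ x ∈ Ω, ‖L x‖ ≤ C) {f : E → V} (hf : ∀ x ∈ Ω, HasFDerivAt f (L x (f x)) x) :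
    ∃ B, ∀ x ∈ Ω, ‖f x‖ ≤ B := by
  rcases Ω.eq_empty_or_nonempty with rfl | ⟨x₀, hx₀⟩
  · exact ⟨0, by simp⟩
  have hR0 : 0 ≤ R := (norm_nonneg _).trans (hR x₀ hx₀ x₀ hx₀)
  -- Along the unit-time segment from `x₀` to `x` the derivative of `f` is at most C R times its
  -- norm, because the segment has length at most `R`.
  refine ⟨gronwallBound ‖f x₀‖ (C * R) 0 1, fun x hx => ?_⟩
  have hmem : ∀ t ∈ Set.Icc (0 : ℝ) 1, x₀ + t • (x - x₀) ∈ Ω := fun t ht =>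
    hconv.add_smul_sub_mem hx₀ hx ht
  have hder : ∀ t ∈ Set.Icc (0 : ℝ) 1, HasDerivAt (fun t : ℝ => f (x₀ + t • (x - x₀)))
      (L (x₀ + t • (x - x₀)) (f (x₀ + t • (x - x₀))) (x - x₀)) t := by
    intro t ht
    have h1 : HasDerivAt (fun t : ℝ => x₀ + t • (x - x₀)) (x - x₀) t := by
      simpa using ((hasDerivAt_id t).smul_const (x - x₀)).const_add x₀
    exact (hf _ (hmem t ht)).comp_hasDerivAt t h1
  have := norm_le_gronwallBound_of_norm_deriv_right_le (f := fun t : ℝ => f (x₀ + t • (x - x₀)))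
    (δ := ‖f x₀‖) (K := C * R) (ε := 0) (a := 0) (b := 1)
    (fun t ht => (hder t ht).continuousAt.continuousWithinAt)
    (fun t ht => (hder t ⟨ht.1, ht.2.le⟩).hasDerivWithinAt) (by simp) (fun t ht => by
      have hm := hmem t ⟨ht.1, ht.2.le⟩
      calc _ ≤ ‖L (x₀ + t • (x - x₀))‖ * ‖f (x₀ + t • (x - x₀))‖ * ‖x - x₀‖ :=
            ContinuousLinearMap.le_opNorm₂ _ _ _
        _ ≤ C * ‖f (x₀ + t • (x - x₀))‖ * R := by
            have h1 := hC _ hm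
            have h2 := hR x₀ hx₀ x hx
            have h3 := le_trans (norm_nonneg (L (x₀ + t • (x - x₀)))) h1
            gcongr
        _ = _ := by ring) 1 ⟨zero_le_one, le_rfl⟩
  simpa using this

/-- Solutions of a closed linear system extend smoothly to those boundary points to which the
coefficients extend smoothly. -/
lemma exists_contDiffOn_extension {Ω S : Set E} (hΩ : IsOpen Ω) (hconv : Convex ℝ Ω)
    {R : ℝ} (hR : ∀ x ∈ Ω, ∀ y ∈ Ω, ‖y - x‖ ≤ R) (hΩS : Ω ⊆ S) (hSΩ : S ⊆ closure Ω)
    {L : E → (κ → ℝ) →L[ℝ] E →L[ℝ] (κ → ℝ)} (hL : ContDiffOn ℝ ∞ L S)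
    {C : ℝ} (hC : ∀ x ∈ Ω, ‖L x‖ ≤ C) {f : E → κ → ℝ}
    (hf : ∀ x ∈ Ω, HasFDerivAt f (L x (f x)) x) :
    ∃ F : E → κ → ℝ, ContDiffOn ℝ ∞ F S ∧ Set.EqOn F f Ω := by
  obtain ⟨B, hB⟩ := bounded_of_linear_system hconv hR hC hf
  rcases Ω.eq_empty_or_nonempty with rfl | ⟨x₀, hx₀⟩
  · have hS : S = ∅ := by simpa using hSΩ
    exact ⟨f, hS ▸ contDiffOn_empty, by simp⟩
  have hC0 : 0 ≤ C := le_trans (norm_nonneg (L x₀)) (hC x₀ hx₀)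
  have hB0 : 0 ≤ B := (norm_nonneg _).trans (hB x₀ hx₀)
  -- Once `f` is bounded by `B`, the system bounds its derivative by C B; convexity makes `f`
  -- Lipschitz, hence extendable to a continuous map on the whole space.
  have hlip : LipschitzOnWith (Real.toNNReal (C * B)) f Ω := by
    refine hconv.lipschitzOnWith_of_nnnorm_hasFDerivWithin_le
      (fun x hx => (hf x hx).hasFDerivWithinAt) fun x hx => ?_
    rw [← NNReal.coe_le_coe, coe_nnnorm, Real.coe_toNNReal _ (by positivity)]
    calc _ ≤ ‖L x‖ * ‖f x‖ := ContinuousLinearMap.le_opNorm _ _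
      _ ≤ C * B := by gcongr; exacts [hC x hx, hB x hx]
  obtain ⟨F, hF, hFf⟩ := hlip.extend_pi
  have hFd : ∀ x ∈ Ω, HasFDerivAt F (L x (F x)) x := fun x hx => by
    rw [← hFf hx]
    exact (hf x hx).congr_of_eventuallyEq (by
      filter_upwards [hΩ.mem_nhds hx] with z hz using (hFf hz).symm)
  -- The derivative on `Ω` is L F, which is continuous up to `S`; its limits are therefore the
  -- derivatives at the added points.
  have hFS : ∀ x ∈ S, HasFDerivWithinAt F (L x (F x)) S x := by
    intro x hx
    refine (hasFDerivWithinAt_closure_of_tendsto_fderiv (s := Ω)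
      (fun y hy => (hFd y hy).differentiableAt.differentiableWithinAt) hconv hΩ
      (fun y _ => hF.continuous.continuousWithinAt) ?_).mono hSΩ
    have h1 : ContinuousWithinAt (fun y => L y (F y)) Ω x :=
      (((hL.continuousOn x hx).mono hΩS).clm_apply hF.continuous.continuousWithinAt)
    refine Filter.Tendsto.congr' ?_ h1
    filter_upwards [self_mem_nhdsWithin] with y hy using (hFd y hy).fderiv.symm
  refine ⟨F, ?_, fun x hx => (hFf hx).symm⟩
  rw [contDiffOn_infty]
  intro N
  -- Bootstrap: if F is C^N on `S`, then its derivative L F is C^N, so F is C^(N+1).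
  induction N with
  | zero => exact contDiffOn_zero.2 hF.continuous.continuousOn
  | succ N ih =>
    rw [Nat.cast_add, Nat.cast_one]
    refine (contDiffOn_succ_iff_hasFDerivWithinAt (by simp)).2 fun x hx => ?_
    refine ⟨S, by rw [Set.insert_eq_of_mem hx]; exact self_mem_nhdsWithin, by simp,
      fun y => L y (F y), hFS, ?_⟩
    exact (hL.of_le (by exact_mod_cast le_top)).clm_apply ih

end LinearSystem

end

section

variable {n : ℕ} {M : Type*} [TopologicalSpace M] [ChartedSpace (EuclideanHalfSpace (n + 1)) M]
  [IsManifold (𝓡∂ (n + 1)) ∞ M]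

/-! ### Interior and boundary -/

/-- The interior of `M`. -/
abbrev int (n : ℕ) (M : Type*) [TopologicalSpace M]
    [ChartedSpace (EuclideanHalfSpace (n + 1)) M] : Set M := (𝓡∂ (n + 1)).interior M

lemma isOpen_int : IsOpen (int n M) :=
  (𝓡∂ (n + 1)).isOpen_interior (n := ∞) (by simp)

lemma mem_int_iff (p : M) {y : M} (hy : y ∈ dom n p) :
    y ∈ int n M ↔ extChartAt (𝓡∂ (n + 1)) p y ∈ interior (Set.range (𝓡∂ (n + 1))) := by
  refine ((𝓡∂ (n + 1)).isInteriorPoint_iff_of_mem_atlas (n := ∞) (by simp)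
    (chart_mem_atlas _ p) hy).trans ⟨fun h => ?_, fun h => ?_⟩
  · exact interior_mono (OpenPartialHomeomorph.extend_target_subset_range _) h
  · exact OpenPartialHomeomorph.mem_interior_extend_target _
      (OpenPartialHomeomorph.map_source _ hy) h

/-- The interior is dense, because the half-space lies in the closure of its interior. -/
lemma exists_mem_int {U : Set M} (hU : IsOpen U) {y : M} (hy : y ∈ U) : ∃ z ∈ U, z ∈ int n M := by
  have hz : extChartAt (𝓡∂ (n + 1)) y y ∈ chartSet (n := n) y (U ∩ dom n y) :=
    extChartAt_mem_chartSet Set.inter_subset_right ⟨hy, mem_dom y⟩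
  have h1 := chartSet_mem_nhdsWithin y (hU.inter (isOpen_dom y)) hz
  obtain ⟨V, hV, hzV, hVs⟩ := mem_nhdsWithin.1 h1
  have h2 := (𝓡∂ (n + 1)).range_subset_closure_interior (chartSet_subset_range y _ hz)
  obtain ⟨z, hzV, hzi⟩ := mem_closure_iff.1 h2 V hV hzV
  have h3 := hVs ⟨hzV, interior_subset hzi⟩
  refine ⟨_, h3.2.1, (mem_int_iff y h3.2.2).2 ?_⟩
  rwa [(extChartAt (𝓡∂ (n + 1)) y).right_inv h3.1]

/-- This carries the tractor equations and the invertibility of H from the interior to the boundary: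
the set where `f` is non-zero is open, so if non-empty it would meet the interior. -/
lemma eq_zero_of_int {f : M → ℝ} {U : Set M} (hU : IsOpen U) (hf : ContinuousOn f U)
    (h : ∀ y ∈ U, y ∈ int n M → f y = 0) {y : M} (hy : y ∈ U) : f y = 0 := by
  by_contra hne
  obtain ⟨z, hz, hzi⟩ := exists_mem_int (n := n)
    (hf.isOpen_inter_preimage hU (isOpen_compl_singleton (x := (0 : ℝ)))) ⟨hy, hne⟩
  exact hz.2 (h z hz.1 hzi)

lemma not_mem_int_iff {y : M} : y ∉ int n M ↔ y ∈ (𝓡∂ (n + 1)).boundary M := by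
  rw [← (𝓡∂ (n + 1)).compl_interior, Set.mem_compl_iff]

/-! ### Boundary regularity on manifolds -/

/-- Solutions of a closed linear system on the interior extend smoothly to the boundary. -/
lemma exists_smooth_extension {κ : Type*} [Fintype κ] {x : M} {w : Set M} (hw : IsOpen w)
    (hxw : x ∈ w) (hwx : w ⊆ dom n x) {c : Fin (n + 1) → κ → κ → M → ℝ}
    (hc : ∀ a k l, SmoothFn n (c a k l) w) {f : κ → M → ℝ}
    (hf : ∀ k, SmoothFn n (f k) (w ∩ int n M))
    (hsys : ∀ y ∈ w, y ∈ int n M → ∀ a k, pd x a (f k) y = ∑ l, c a k l y * f l y) :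
    ∃ (w' : Set M) (F : κ → M → ℝ), IsOpen w' ∧ x ∈ w' ∧ w' ⊆ w ∧ (∀ k, SmoothFn n (F k) w') ∧
      ∀ y ∈ w', y ∈ int n M → ∀ k, F k y = f k y := by
  classical
  let φ := extChartAt (𝓡∂ (n + 1)) x
  have hz0 : φ x ∈ chartSet (n := n) x w := extChartAt_mem_chartSet hwx hxw
  -- A closed ball is chosen so that compactness of its part in the half-space bounds the
  -- coefficients; the system itself is used on the open half-ball, which is convex.
  obtain ⟨ε, hε, hball⟩ := (nhdsWithin_hasBasis Metric.nhds_basis_closedBall _).mem_iff.1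
    (chartSet_mem_nhdsWithin x hw hz0)
  have hwi : IsOpen (w ∩ int n M) := hw.inter isOpen_int
  have hwix : w ∩ int n M ⊆ dom n x := Set.inter_subset_left.trans hwx
  let Ω : Set (EuclideanSpace ℝ (Fin (n + 1))) :=
    Metric.ball (φ x) ε ∩ interior (Set.range (𝓡∂ (n + 1)))
  let S : Set (EuclideanSpace ℝ (Fin (n + 1))) := Metric.ball (φ x) ε ∩ Set.range (𝓡∂ (n + 1))
  have hrange : Convex ℝ (Set.range (𝓡∂ (n + 1))) := by
    rw [range_modelWithCornersEuclideanHalfSpace]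
    exact convex_halfSpace_ge (f := fun y : EuclideanSpace ℝ (Fin (n + 1)) => y 0)
      ⟨fun _ _ => rfl, fun _ _ => rfl⟩ 0
  have hΩ : IsOpen Ω := Metric.isOpen_ball.inter isOpen_interior
  have hΩc : Convex ℝ Ω := (convex_ball _ _).inter hrange.interior
  have hΩS : Ω ⊆ S := Set.inter_subset_inter_right _ interior_subset
  have hSΩ : S ⊆ closure Ω :=
    (Set.inter_subset_inter_right _ (𝓡∂ (n + 1)).range_subset_closure_interior).trans
      (Metric.isOpen_ball.inter_closure)
  have hSw : Metric.closedBall (φ x) ε ∩ Set.range (𝓡∂ (n + 1)) ⊆ chartSet (n := n) x w := hball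
  have hSw' : S ⊆ chartSet (n := n) x w :=
    (Set.inter_subset_inter_left _ Metric.ball_subset_closedBall).trans hSw
  have hΩw : Ω ⊆ chartSet (n := n) x (w ∩ int n M) := by
    intro z hz
    have h := hSw' (hΩS hz)
    refine ⟨h.1, h.2, (mem_int_iff x (hwx h.2)).2 ?_⟩
    rw [(extChartAt (𝓡∂ (n + 1)) x).right_inv h.1]
    exact hz.2
  let L : EuclideanSpace ℝ (Fin (n + 1)) → (κ → ℝ) →L[ℝ] EuclideanSpace ℝ (Fin (n + 1)) →L[ℝ]
      (κ → ℝ) := fun z => ∑ a, ∑ k, ∑ l, (c a k l ∘ φ.symm) z •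
    (ContinuousLinearMap.proj (R := ℝ) (φ := fun _ : κ => ℝ) l).smulRight
      ((EuclideanSpace.proj a : EuclideanSpace ℝ (Fin (n + 1)) →L[ℝ] ℝ).smulRight
        (Pi.single k (1 : ℝ) : κ → ℝ))
  have hLs : ContDiffOn ℝ ∞ L (chartSet x w) :=
    ContDiffOn.sum fun a _ => ContDiffOn.sum fun k _ => ContDiffOn.sum fun l _ =>
      (ContinuousLinearMap.toSpanSingleton ℝ _).contDiff.comp_contDiffOn
        ((hc a k l).contDiffOn_chartSet x)
  have hLv : ∀ z v ξ k, L z v ξ k = ∑ a, ξ a * ∑ l, c a k l (φ.symm z) * v l := by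
    intro z v ξ k
    simp only [L, sum_apply, smul_apply,
      ContinuousLinearMap.smulRight_apply, Finset.sum_apply, Pi.smul_apply, smul_eq_mul,
      Function.comp_apply, ContinuousLinearMap.proj_apply, Pi.single_apply, Finset.mul_sum]
    refine Finset.sum_congr rfl fun a _ => ?_
    rw [Finset.sum_comm]
    refine Finset.sum_congr rfl fun l _ => ?_
    simp
    ring
  have hLb : ∃ C, ∀ z ∈ Metric.closedBall (φ x) ε ∩ Set.range (𝓡∂ (n + 1)), ‖L z‖ ≤ C := ((isCompact_closedBall (φ x) ε).inter_right
    (𝓡∂ (n + 1)).isClosed_range).exists_bound_of_continuousOn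
    (E := (κ → ℝ) →L[ℝ] EuclideanSpace ℝ (Fin (n + 1)) →L[ℝ] (κ → ℝ))
    (hLs.continuousOn.mono hSw)
  obtain ⟨C, hC⟩ := hLb
  let g : EuclideanSpace ℝ (Fin (n + 1)) → κ → ℝ := fun z k => f k (φ.symm z)
  have hg : ∀ z ∈ Ω, HasFDerivAt g (L z (g z)) z := by
    intro z hz
    rw [hasFDerivAt_pi']
    intro k
    have hzc := hΩw hz
    have hnhds : chartSet (n := n) x (w ∩ int n M) ∈ 𝓝 z :=
      Filter.mem_of_superset (hΩ.mem_nhds hz) hΩw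
    have hd : DifferentiableAt ℝ (f k ∘ φ.symm) z :=
      (((hf k).contDiffOn_chartSet x).contDiffAt hnhds).differentiableAt (by simp)
    have hzi : φ (φ.symm z) = z := (extChartAt (𝓡∂ (n + 1)) x).right_inv hzc.1
    refine hd.hasFDerivAt.congr_fderiv (ContinuousLinearMap.ext fun v => ?_)
    have hv : v = ∑ a, v a • EuclideanSpace.basisFun (Fin (n + 1)) ℝ a := by
      conv_lhs => rw [← (EuclideanSpace.basisFun (Fin (n + 1)) ℝ).sum_repr v]
      simp
    have hL : (ContinuousLinearMap.proj (R := ℝ) (φ := fun _ : κ => ℝ) k ∘L L z (g z)) v =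
        ∑ a, v a * ∑ l, c a k l (φ.symm z) * g z l := hLv z (g z) v k
    rw [hL]
    conv_lhs => rw [hv]
    simp only [map_sum, map_smul, smul_eq_mul]
    refine Finset.sum_congr rfl fun a _ => ?_
    congr 1
    have h1 := hsys (φ.symm z) hzc.2.1 hzc.2.2 a k
    rw [pd_eq_fderivWithin_chartSet x a hwi hwix (hf k) hzc.2, fderivWithin_of_mem_nhds (by
      rwa [show (extChartAt (𝓡∂ (n + 1)) x) _ = z from hzi])] at h1
    rw [show (extChartAt (𝓡∂ (n + 1)) x) _ = z from hzi] at h1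
    exact h1
  obtain ⟨F, hFs, hFg⟩ := exists_contDiffOn_extension (R := ε + ε) hΩ hΩc (fun a ha b hb => by
      rw [← dist_eq_norm]
      exact (dist_triangle_right b a (φ x)).trans (add_le_add hb.1.le ha.1.le)) hΩS hSΩ
    (hLs.mono hSw') (fun z hz => hC z ⟨Metric.ball_subset_closedBall hz.1, interior_subset hz.2⟩) hg
  -- Points whose coordinates lie in the ball: their images fall in `S`, where the extension is
  -- known to be smooth.
  let w' : Set M := w ∩ (φ.source ∩ φ ⁻¹' Metric.ball (φ x) ε)
  have hw' : IsOpen w' := hw.inter ((continuousOn_extChartAt x).isOpen_inter_preimage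
    (isOpen_extChartAt_source x) Metric.isOpen_ball)
  have hw'x : w' ⊆ dom n x := Set.inter_subset_left.trans hwx
  refine ⟨w', fun k => (fun z => F z k) ∘ φ, hw', ⟨hxw, mem_extChartAt_source x,
    Metric.mem_ball_self hε⟩, Set.inter_subset_left, fun k => ?_, fun y hy hyi k => ?_⟩
  · refine ContDiffOn.smoothFn_of_chartSet (n := n) x hw'x ?_
    refine ((contDiffOn_pi.1 hFs) k).mono fun z hz => ⟨?_, extChartAt_target_subset_range x hz.1⟩
    have h := hz.2.2.2
    rwa [Set.mem_preimage, show φ _ = z from (extChartAt (𝓡∂ (n + 1)) x).right_inv hz.1] at h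
  · have h := hFg ⟨hy.2.2, (mem_int_iff x (hw'x hy)).1 hyi⟩
    have h2 : φ.symm (φ y) = y := extChartAt_symm_extChartAt (hw'x hy)
    simp only [Function.comp_apply, h, g, h2]

end

section

/-! ### Projective changes in coordinates -/

/-- The algebra behind the change of the Ricci curvature under a projective change. -/
lemma ricci_change_algebra {n : ℕ} (G : Fin (n + 1) → Fin (n + 1) → Fin (n + 1) → ℝ)
    (dG : Fin (n + 1) → Fin (n + 1) → Fin (n + 1) → Fin (n + 1) → ℝ)
    (U : Fin (n + 1) → ℝ) (dU : Fin (n + 1) → Fin (n + 1) → ℝ)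
    (hG : ∀ k i j, G k i j = G k j i) (j m : Fin (n + 1)) :
    ∑ i, ((dG i i j m + ((if i = m then dU i j else 0) + if i = j then dU i m else 0))
        - (dG j i i m + ((if i = m then dU j i else 0) + dU j m))
        + ∑ k, ((G i i k + ((if i = k then U i else 0) + U k))
            * (G k j m + ((if k = m then U j else 0) + if k = j then U m else 0))
          - (G i j k + ((if i = k then U j else 0) + if i = j then U k else 0))
            * (G k i m + ((if k = m then U i else 0) + if k = i then U m else 0)))) =
      ∑ i, (dG i i j m - dG j i i m + ∑ k, (G i i k * G k j m - G i j k * G k i m))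
        + (dU m j - ∑ d, G d m j * U d) - (n + 1) * (dU j m - ∑ d, G d j m * U d)
        + n * (U j * U m) := by
  simp only [add_mul, mul_add, sub_eq_add_neg, neg_add, Finset.sum_add_distrib, ite_mul, mul_ite,
    mul_zero, zero_mul, Finset.sum_ite_eq, Finset.sum_ite_eq', Finset.mem_univ, if_true,
    Finset.sum_neg_distrib, Finset.sum_const, Finset.card_univ, Fintype.card_fin, nsmul_eq_mul,
    hG _ m j]
  -- After contracting the Kronecker deltas, a few sums differ only by order of factors or by the
  -- symmetry of the lower indices; aligning them lets the rest cancel.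
  have e1 : (∑ x, ∑ x_1, if x = j then U x_1 * G x_1 x m else 0) = ∑ x, G x j m * U x := by
    rw [Finset.sum_comm]
    simp [mul_comm]
  have e2 : ∑ x, U x * G x j m = ∑ x, G x j m * U x := by simp only [mul_comm]
  have e3 : ∑ x, U j * G x x m = ∑ x, G x x m * U j := by simp only [mul_comm]
  have e4 : ∑ x, G x j x * U m = ∑ x, G x x j * U m :=
    Finset.sum_congr rfl fun x _ => by rw [hG x j x]
  rw [e1, e2, e3, e4]
  push_cast
  ring

variable {n : ℕ} {M : Type*} [TopologicalSpace M] [ChartedSpace (EuclideanHalfSpace (n + 1)) M]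
  [IsManifold (𝓡∂ (n + 1)) ∞ M]

/-- The components of a one-form. -/
def Up (Υ : (x : M) → T n x →L[ℝ] ℝ) (p : M) (a : Fin (n + 1)) (y : M) : ℝ := Υ y (fr p a y)

section Change

variable [T2Space M] {D N : ConnOp n M} {Υ : (x : M) → T n x →L[ℝ] ℝ} {u : Set M} {p : M}
  {w : Set M}

lemma SmoothOneFormOn.apply (hΥ : SmoothOneFormOn Υ u) (hw : IsOpen w) (hwu : w ⊆ u)
    {X : (x : M) → T n x} (hX : SmoothVF X w) : SmoothFn n (fun y => Υ y (X y)) w := by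
  intro y hy
  obtain ⟨X', hX', h⟩ := hX.exists_global hw hy
  have h1 := (hΥ X' (hX'.mono (Set.subset_univ u))).mono hwu
  refine ((h1.contMDiffAt (hw.mem_nhds hy)).congr_of_eventuallyEq ?_).contMDiffWithinAt
  filter_upwards [h] with z hz
  rw [hz]

lemma Up_smooth (hΥ : SmoothOneFormOn Υ u) (hw : IsOpen w) (hwu : w ⊆ u) (hwp : w ⊆ dom n p)
    (a : Fin (n + 1)) : SmoothFn n (Up Υ p a) w :=
  hΥ.apply hw hwu ((fr_smooth p a).mono hwp)

lemma Gam_change (hDN : IsProjectiveChangeOn D N Υ u) {y : M} (hy : y ∈ u) (hyp : y ∈ dom n p)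
    (k i j : Fin (n + 1)) : Gam N p k i j y = Gam D p k i j y
      + ((if k = j then Up Υ p i y else 0) + if k = i then Up Υ p j y else 0) := by
  rw [Gam, hDN (fr p j) y hy (fr_diff p j hyp)]
  simp [co_fr p hyp, Gam, Up, add_assoc]

lemma gam_change (hDN : IsProjectiveChangeOn D N Υ u) {y : M} (hy : y ∈ u) (hyp : y ∈ dom n p)
    (i : Fin (n + 1)) : gam N p i y = gam D p i y + ((n : ℝ) + 2) * Up Υ p i y := by
  simp only [gam, Gam_change hDN hy hyp, if_true, Finset.sum_add_distrib, Finset.sum_const,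
    Finset.card_univ, Fintype.card_fin, Finset.sum_ite_eq', Finset.mem_univ]
  simp
  ring

/-- The components of the covariant derivative of a one-form. -/
def dUp (D : ConnOp n M) (Υ : (x : M) → T n x →L[ℝ] ℝ) (p : M) (a b : Fin (n + 1)) (y : M) : ℝ :=
  pd p a (Up Υ p b) y - ∑ d, Gam D p d a b y * Up Υ p d y

lemma Ric_change (hD : IsAffineConnectionOn D Set.univ)
    (hΥ : SmoothOneFormOn Υ u) (hDN : IsProjectiveChangeOn D N Υ u) (hw : IsOpen w) (hwu : w ⊆ u)
    (hwp : w ⊆ dom n p) {y : M} (hy : y ∈ w) (j m : Fin (n + 1)) :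
    Ric N p j m y = Ric D p j m y + dUp D Υ p m j y - ((n : ℝ) + 1) * dUp D Υ p j m y
      + n * (Up Υ p j y * Up Υ p m y) := by
  have hU := Up_smooth hΥ hw hwu hwp
  have hd : ∀ a k i j : Fin (n + 1), pd p a (Gam N p k i j) y = pd p a (Gam D p k i j) y
      + ((if k = j then pd p a (Up Υ p i) y else 0) + if k = i then pd p a (Up Υ p j) y else 0) := by
    intro a k i j
    have hG := (Gam_smooth hD isOpen_univ hw (Set.subset_univ w) hwp k i j).diffFnAt hw hy
    have h0 : ∀ (c : Prop) [Decidable c] i, DiffFnAt n (fun z => if c then Up Υ p i z else 0) y := by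
      intro c _ i
      by_cases h : c
      · simpa [h] using (hU i).diffFnAt hw hy
      · simpa [h] using DiffFnAt.const 0 y
    have h1 : ∀ (c : Prop) [Decidable c] i, dAt (n := n) (fun z => if c then Up Υ p i z else 0) y (fr p a y) =
        if c then pd p a (Up Υ p i) y else 0 := by
      intro c _ i
      by_cases h : c
      · simp [h, pd]
      · simpa [h] using dAt_const 0 (fr p a y)
    rw [pd_congr_of_eqOn p a hw (fun z hz => Gam_change hDN (hwu hz) (hwp hz) k i j) hy, pd,
      dAt_add hG ((h0 _ _).add (h0 _ _)), dAt_add (h0 _ _) (h0 _ _), h1, h1]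
    rfl
  have key := ricci_change_algebra (fun k i j => Gam D p k i j y)
    (fun a k i j => pd p a (Gam D p k i j) y) (fun i => Up Υ p i y)
    (fun a i => pd p a (Up Υ p i) y) (fun k i j => Gam_symm hD (Set.mem_univ y) (hwp hy) k i j) j m
  rw [Ric, Ric, dUp, dUp]
  refine Eq.trans ?_ key
  simp only [Rm, hd, Gam_change hDN (hwu hy) (hwp hy), if_true]

/-- The Schouten tensor is the combination of Ric and its transpose for which the change of Ricci
becomes -∇Υ + Υ⊗Υ, skew part included. Its denominator is n (n + 2), whence `n ≠ 0`. -/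
lemma Sch_change (hn : n ≠ 0) (hD : IsAffineConnectionOn D Set.univ)
    (hΥ : SmoothOneFormOn Υ u) (hDN : IsProjectiveChangeOn D N Υ u) (hw : IsOpen w) (hwu : w ⊆ u)
    (hwp : w ⊆ dom n p) {y : M} (hy : y ∈ w) (j m : Fin (n + 1)) :
    Sch N p j m y = Sch D p j m y - dUp D Υ p j m y + Up Υ p j y * Up Υ p m y := by
  have hn' : (n : ℝ) ≠ 0 := Nat.cast_ne_zero.2 hn
  have hn2 : ((n : ℝ) + 1) ^ 2 - 1 ≠ 0 := by
    have h : ((n : ℝ) + 1) ^ 2 - 1 = n * (n + 2) := by ring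
    rw [h]
    positivity
  rw [Sch, Sch, Ric_change hD hΥ hDN hw hwu hwp hy, Ric_change hD hΥ hDN hw hwu hwp hy]
  field_simp
  ring

end Change

end

section

variable {n : ℕ} {M : Type*} [TopologicalSpace M] [ChartedSpace (EuclideanHalfSpace (n + 1)) M]
  [IsManifold (𝓡∂ (n + 1)) ∞ M] [T2Space M] {D N : ConnOp n M} {Υ : (x : M) → T n x →L[ℝ] ℝ}
  {u : Set M} {p : M} {w : Set M}

lemma pd_add {f g : M → ℝ} {y : M} (a : Fin (n + 1)) (hf : DiffFnAt n f y) (hg : DiffFnAt n g y) :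
    pd p a (fun z => f z + g z) y = pd p a f y + pd p a g y := dAt_add hf hg _

lemma pd_mul {f g : M → ℝ} {y : M} (a : Fin (n + 1)) (hf : DiffFnAt n f y) (hg : DiffFnAt n g y) :
    pd p a (fun z => f z * g z) y = f y * pd p a g y + g y * pd p a f y := dAt_mul hf hg _

lemma pd_const_mul {f : M → ℝ} {y : M} (a : Fin (n + 1)) (c : ℝ) (hf : DiffFnAt n f y) :
    pd p a (fun z => c * f z) y = c * pd p a f y := by
  rw [pd_mul a (DiffFnAt.const c y) hf, pd, pd, dAt_const, mul_zero, add_zero]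

lemma pd_sum {ι : Type*} (s : Finset ι) {f : ι → M → ℝ} {y : M} (a : Fin (n + 1))
    (hf : ∀ i ∈ s, DiffFnAt n (f i) y) :
    pd p a (fun z => ∑ i ∈ s, f i z) y = ∑ i ∈ s, pd p a (f i) y := dAt_sum s hf _

lemma sum_co_fr_mul (p : M) {y : M} (hy : y ∈ dom n p) (a : Fin (n + 1))
    (X : Fin (n + 1) → ℝ) : ∑ i, co p i y (fr p a y) * X i = X a := by
  simp [co_fr p hy]

lemma sum_sum_co_fr_mul (p : M) {y : M} (hy : y ∈ dom n p) (a b : Fin (n + 1))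
    (X : Fin (n + 1) → Fin (n + 1) → ℝ) :
    ∑ i, ∑ j, co p i y (fr p a y) * co p j y (fr p b y) * X i j = X a b := by
  simp only [mul_assoc, ← Finset.mul_sum, sum_co_fr_mul p hy]

/-! ### Special connections -/

/-- The skew part of Ricci measures the curvature induced on volume densities, that is, the failure
of the trace of the connection form to be closed. -/
lemma Ric_antisymm (hD : IsAffineConnectionOn D u) (hu : IsOpen u) (hw : IsOpen w) (hwu : w ⊆ u)
    (hwp : w ⊆ dom n p) {y : M} (hy : y ∈ w) (j m : Fin (n + 1)) :
    Ric D p j m y - Ric D p m j y = pd p m (gam D p j) y - pd p j (gam D p m) y := by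
  have hs : ∀ z ∈ w, ∀ k i j : Fin (n + 1), Gam D p k i j z = Gam D p k j i z := fun z hz k i j =>
    Gam_symm hD (hwu hz) (hwp hz) k i j
  have hG := fun k i j => (Gam_smooth hD hu hw hwu hwp k i j).diffFnAt hw hy
  have hg : ∀ j m : Fin (n + 1), pd p j (gam D p m) y = ∑ i, pd p j (Gam D p i i m) y := by
    intro j m
    refine (pd_sum _ j fun i _ => hG i m i).trans (Finset.sum_congr rfl fun i _ => ?_)
    exact pd_congr_of_eqOn p j hw (fun z hz => hs z hz i m i) hy
  have h1 : ∀ i, pd p i (Gam D p i j m) y = pd p i (Gam D p i m j) y := fun i =>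
    pd_congr_of_eqOn p i hw (fun z hz => hs z hz i j m) hy
  have h2 : ∑ i, ∑ k, Gam D p i j k y * Gam D p k i m y =
      ∑ i, ∑ k, Gam D p i m k y * Gam D p k i j y := by
    rw [Finset.sum_comm]
    refine Finset.sum_congr rfl fun i _ => Finset.sum_congr rfl fun k _ => ?_
    rw [hs y hy k j i, hs y hy i k m]
    ring
  simp only [Ric, Rm, Finset.sum_add_distrib, Finset.sum_sub_distrib, hg, h1, h2, hs y hy _ j m]
  ring

/-! ### Parallel volume densities. -/

section Volume

variable {κ : (x : M) → Dens n 1 x}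

lemma IsParallelVolume.pd_dcomp (hN : IsAffineConnectionOn N (int n M)) (hκ : IsParallelVolume N κ)
    (hw : IsOpen w) (hwi : w ⊆ int n M) (hwp : w ⊆ dom n p) {y : M} (hy : y ∈ w)
    (a : Fin (n + 1)) : pd p a (dcomp p κ) y = gam N p a y * dcomp p κ y := by
  have h := covDerivDens_eq hN isOpen_int p (hwi hy) (hwp hy)
    ((hκ.smooth.dcomp p hw hwi hwp).diffFnAt hw hy) (fr p a y)
  rw [hκ.parallel y (hwi hy)] at h
  simp only [sum_co_fr_mul p (hwp hy), cdS] at h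
  have h0 : ((0 : Dens n 1 y).1 fun i => fr p i y) = 0 := rfl
  rw [h0] at h
  linarith

lemma IsParallelVolume.dcomp_ne_zero (hκ : IsParallelVolume N κ) {y : M} (hy : y ∈ int n M)
    (hyp : y ∈ dom n p) : dcomp p κ y ≠ 0 := by
  intro h
  apply hκ.ne_zero y hy
  rw [density_eq_zero_iff _ (frBasis p hyp), frBasis_coe]
  exact h

/-- A parallel volume makes the trace of the connection form logarithmically exact. Commuting second
derivatives of its component show closedness, and `Ric_antisymm` concludes. -/
lemma IsParallelVolume.Ric_symm (hN : IsAffineConnectionOn N (int n M))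
    (hκ : IsParallelVolume N κ) (hw : IsOpen w) (hwi : w ⊆ int n M) (hwp : w ⊆ dom n p) {y : M}
    (hy : y ∈ w) (j m : Fin (n + 1)) : Ric N p j m y = Ric N p m j y := by
  have hk := hκ.smooth.dcomp p hw hwi hwp
  have hg := gam_smooth hN isOpen_int hw hwi hwp
  have h1 : ∀ a b, pd p a (pd p b (dcomp p κ)) y =
      gam N p b y * (gam N p a y * dcomp p κ y) + dcomp p κ y * pd p a (gam N p b) y := by
    intro a b
    rw [pd_congr_of_eqOn p a hw (fun z hz => hκ.pd_dcomp hN hw hwi hwp hz b) hy,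
      pd_mul a ((hg b).diffFnAt hw hy) (hk.diffFnAt hw hy), hκ.pd_dcomp hN hw hwi hwp hy a]
  have h2 := pd_comm p j m hw hwp hk hy
  rw [h1, h1] at h2
  have h3 : dcomp p κ y * (pd p m (gam N p j) y - pd p j (gam N p m) y) = 0 := by
    linear_combination -h2
  have h4 := (mul_eq_zero.1 h3).resolve_left (hκ.dcomp_ne_zero (hwi hy) (hwp hy))
  rw [← Ric_antisymm hN isOpen_int hw hwi hwp hy] at h4
  linarith

lemma abs_dcomp_rpow_smooth (hκ : IsParallelVolume N κ) (r : ℝ) (hw : IsOpen w) (hwi : w ⊆ int n M)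
    (hwp : w ⊆ dom n p) : SmoothFn n (fun y => |dcomp p κ y| ^ r) w :=
  (hκ.smooth.dcomp p hw hwi hwp).comp (F := fun t => |t| ^ r) fun _ hy =>
    contDiffAt_abs_rpow r (hκ.dcomp_ne_zero (hwi hy) (hwp hy))

lemma pd_abs_dcomp_rpow (hN : IsAffineConnectionOn N (int n M)) (hκ : IsParallelVolume N κ) (r : ℝ)
    (hw : IsOpen w) (hwi : w ⊆ int n M) (hwp : w ⊆ dom n p) {y : M} (hy : y ∈ w)
    (a : Fin (n + 1)) : pd p a (fun z => |dcomp p κ z| ^ r) y =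
      r * gam N p a y * |dcomp p κ y| ^ r := by
  have h0 := hκ.dcomp_ne_zero (hwi hy) (hwp hy)
  rw [pd, dAt_comp (F := fun t => |t| ^ r) ((hκ.smooth.dcomp p hw hwi hwp).diffFnAt hw hy)
    (hasDerivAt_abs_rpow r h0), ← pd, hκ.pd_dcomp hN hw hwi hwp hy]
  field_simp

end Volume

/-- The components of `∇ Ric = 0`. -/
lemma RicciParallel.pd_Ric (hN : IsAffineConnectionOn N (int n M)) (hR : RicciParallel N)
    (hw : IsOpen w) (hwi : w ⊆ int n M) (hwp : w ⊆ dom n p) {y : M} (hy : y ∈ w)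
    (a b c : Fin (n + 1)) : pd p a (Ric N p b c) y =
      ∑ e, Gam N p e a b y * Ric N p e c y + ∑ e, Gam N p e a c y * Ric N p b e y := by
  have h := covDerivBilin_eq_sum hN isOpen_int p (hwi hy) (hwp hy) (β := ricci N) (b := Ric N p)
    (fun c d => (Ric_smooth hN isOpen_int hw hwi hwp c d).diffFnAt hw hy)
    (by filter_upwards [hw.mem_nhds hy] with z hz v v'
        exact ricci_eq hN isOpen_int (hwi hz) (hwp hz) v v') (fr p a y) (fr p b y) (fr p c y)
  simp only [hR y (hwi hy), sum_co_fr_mul p (hwp hy), sum_sum_co_fr_mul p (hwp hy), cdB] at h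
  linarith

lemma RicciParallel.pd_Sch (hN : IsAffineConnectionOn N (int n M)) (hR : RicciParallel N)
    (hw : IsOpen w) (hwi : w ⊆ int n M) (hwp : w ⊆ dom n p) {y : M} (hy : y ∈ w)
    (a b c : Fin (n + 1)) : pd p a (Sch N p b c) y =
      ∑ e, Gam N p e a b y * Sch N p e c y + ∑ e, Gam N p e a c y * Sch N p b e y := by
  have hs := fun c d => (Ric_smooth hN isOpen_int hw hwi hwp c d).diffFnAt hw hy
  have h1 : Sch N p b c = fun z => (((n : ℝ) + 1) ^ 2 - 1)⁻¹ *
      (((n : ℝ) + 1) * Ric N p b c z + Ric N p c b z) := by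
    funext z; rw [Sch, div_eq_inv_mul]
  rw [h1, pd_const_mul a _ (((hs b c).const_mul _).add (hs c b)),
    pd_add a ((hs b c).const_mul _) (hs c b), pd_const_mul a _ (hs b c),
    hR.pd_Ric hN hw hwi hwp hy, hR.pd_Ric hN hw hwi hwp hy, ← Finset.sum_add_distrib,
    ← Finset.sum_add_distrib, ← Finset.sum_add_distrib, Finset.mul_sum, ← Finset.sum_add_distrib,
    Finset.mul_sum]
  refine Finset.sum_congr rfl fun e _ => ?_
  simp only [Sch, div_eq_inv_mul]
  ring

/-! ### The splitting operator on the interior -/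

section Interior

variable {s : M → ℝ}

/-- The hypothesis `hds` says that `s` is parallel for `N`. Passing to `D` changes the trace by (n +
2) Υ, and wt · (n + 2) = -2, so half the derivative is -Υ s. -/
lemma nuC_int (hDN : IsProjectiveChangeOn D N Υ (int n M)) (hwi : w ⊆ int n M) (hwp : w ⊆ dom n p)
    (hds : ∀ y ∈ w, ∀ a, pd p a s y = wt n * gam N p a y * s y) {y : M} (hy : y ∈ w)
    (a : Fin (n + 1)) : nuC D p s a y = -(Up Υ p a y * s y) := by
  rw [nuC, cdS, hds y hy, gam_change hDN (hwi hy) (hwp hy), wt]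
  have : (n : ℝ) + 2 ≠ 0 := by positivity
  field_simp
  ring

lemma cdF_int (hΥ : SmoothOneFormOn Υ (int n M)) (hDN : IsProjectiveChangeOn D N Υ (int n M))
    (hw : IsOpen w) (hwi : w ⊆ int n M) (hwp : w ⊆ dom n p) (hs : SmoothFn n s w)
    (hds : ∀ y ∈ w, ∀ a, pd p a s y = wt n * gam N p a y * s y) {y : M} (hy : y ∈ w)
    (b c : Fin (n + 1)) : cdF (wt n) D p b c (nuC D p s) y =
      -(dUp D Υ p b c y * s y) + 2 * (Up Υ p b y * Up Υ p c y) * s y := by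
  have hU := fun c => (Up_smooth hΥ hw hwi hwp c).diffFnAt hw hy
  have hν := fun {z} (hz : z ∈ w) a => nuC_int (D := D) hDN hwi hwp hds hz a
  have hneg : ∀ z ∈ w, nuC D p s c z = -1 * (Up Υ p c z * s z) := fun z hz => by
    rw [hν hz]; ring
  rw [cdF, pd_congr_of_eqOn p b hw hneg hy,
    pd_const_mul b _ ((hU c).mul (hs.diffFnAt hw hy)), pd_mul b (hU c) (hs.diffFnAt hw hy),
    hds y hy, gam_change hDN (hwi hy) (hwp hy)]
  simp only [hν hy, dUp, mul_neg, Finset.sum_neg_distrib, sub_mul, Finset.sum_mul, wt, mul_assoc]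
  have : (n : ℝ) + 2 ≠ 0 := by positivity
  field_simp
  ring

/-- In the splitting of `N` the bottom slot is the Schouten tensor of `N` times `s`; changing the
splitting adds Υ⊗Υ s. -/
lemma rhoC_int (hn : n ≠ 0) (hD : IsAffineConnectionOn D Set.univ)
    (hΥ : SmoothOneFormOn Υ (int n M)) (hDN : IsProjectiveChangeOn D N Υ (int n M))
    (hw : IsOpen w) (hwi : w ⊆ int n M) (hwp : w ⊆ dom n p) (hs : SmoothFn n s w)
    (hds : ∀ y ∈ w, ∀ a, pd p a s y = wt n * gam N p a y * s y)
    (hsymm : ∀ y ∈ w, ∀ b c, Sch N p b c y = Sch N p c b y) {y : M} (hy : y ∈ w) (b c : Fin (n + 1)) : rhoC D p s b c y =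
    (Sch N p b c y + Up Υ p b y * Up Υ p c y) * s y := by
  have hS := Sch_change hn hD hΥ hDN hw hwi hwp hy
  rw [rhoC, cdF_int hΥ hDN hw hwi hwp hs hds hy, cdF_int hΥ hDN hw hwi hwp hs hds hy]
  have h1 := hS b c
  have h2 := hS c b
  have h3 := hsymm y hy b c
  linear_combination (-(1 / 2 : ℝ) * h1 - 1 / 2 * h2 - 1 / 2 * h3) * s y

/-- The symmetrization in the bottom slot loses nothing: the unsymmetrized expression already equals
(P + Υ⊗Υ) s, with P the symmetric Schouten tensor of `N`. -/
lemma cdF_add_Sch_int (hn : n ≠ 0) (hD : IsAffineConnectionOn D Set.univ)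
    (hΥ : SmoothOneFormOn Υ (int n M)) (hDN : IsProjectiveChangeOn D N Υ (int n M))
    (hw : IsOpen w) (hwi : w ⊆ int n M) (hwp : w ⊆ dom n p) (hs : SmoothFn n s w)
    (hds : ∀ y ∈ w, ∀ a, pd p a s y = wt n * gam N p a y * s y)
    (hsymm : ∀ y ∈ w, ∀ b c, Sch N p b c y = Sch N p c b y) {y : M} (hy : y ∈ w)
    (b c : Fin (n + 1)) :
    cdF (wt n) D p b c (nuC D p s) y + Sch D p b c y * s y - rhoC D p s b c y = 0 := by
  rw [rhoC_int hn hD hΥ hDN hw hwi hwp hs hds hsymm hy,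
    cdF_int hΥ hDN hw hwi hwp hs hds hy, Sch_change hn hD hΥ hDN hw hwi hwp hy]
  ring

lemma cdB_add_Sch_int (hn : n ≠ 0) (hD : IsAffineConnectionOn D Set.univ)
    (hN : IsAffineConnectionOn N (int n M)) (hR : RicciParallel N)
    (hΥ : SmoothOneFormOn Υ (int n M)) (hDN : IsProjectiveChangeOn D N Υ (int n M))
    (hw : IsOpen w) (hwi : w ⊆ int n M) (hwp : w ⊆ dom n p) (hs : SmoothFn n s w)
    (hds : ∀ y ∈ w, ∀ a, pd p a s y = wt n * gam N p a y * s y)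
    (hsymm : ∀ y ∈ w, ∀ b c, Sch N p b c y = Sch N p c b y) {y : M} (hy : y ∈ w)
    (a b c : Fin (n + 1)) :
    cdB (wt n) D p a b c (rhoC D p s) y + Sch D p a b y * nuC D p s c y
      + Sch D p a c y * nuC D p s b y = 0 := by
  have hU := fun c => (Up_smooth hΥ hw hwi hwp c).diffFnAt hw hy
  have hSd := fun b c => (Sch_smooth hN isOpen_int hw hwi hwp b c).diffFnAt hw hy
  have hsd := hs.diffFnAt hw hy
  have hρ : ∀ z ∈ w, ∀ b c, rhoC D p s b c z = (Sch N p b c z + Up Υ p b z * Up Υ p c z) * s z :=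
    fun z hz b c => rhoC_int hn hD hΥ hDN hw hwi hwp hs hds hsymm hz b c
  -- The Schouten change is solved for the derivative of Υ; the next identities rewrite the
  -- parallelism of the Schouten tensor of `N` and of `s` through `D`. With every derivative
  -- eliminated, the claim is polynomial.
  have hdU : ∀ c, pd p a (Up Υ p c) y = Sch D p a c y - Sch N p a c y + Up Υ p a y * Up Υ p c y
      + ∑ d, Gam D p d a c y * Up Υ p d y := by
    intro c
    have h := Sch_change hn hD hΥ hDN hw hwi hwp hy a c
    rw [dUp] at h
    linarith
  have hdS : pd p a (Sch N p b c) y = ∑ e, Gam D p e a b y * Sch N p e c y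
      + ∑ e, Gam D p e a c y * Sch N p b e y + 2 * Up Υ p a y * Sch N p b c y
      + Up Υ p b y * Sch N p a c y + Up Υ p c y * Sch N p b a y := by
    rw [hR.pd_Sch hN hw hwi hwp hy]
    simp only [Gam_change hDN (hwi hy) (hwp hy), add_mul, ite_mul, zero_mul, Finset.sum_add_distrib,
      Finset.sum_ite_eq', Finset.mem_univ, if_true]
    ring
  have hds' : pd p a s y = -2 * Up Υ p a y * s y + wt n * gam D p a y * s y := by
    rw [hds y hy, gam_change hDN (hwi hy) (hwp hy), wt]
    have : (n : ℝ) + 2 ≠ 0 := by positivity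
    field_simp
    ring
  have e1 : ∑ e, Gam D p e a b y * rhoC D p s e c y = (∑ e, Gam D p e a b y * Sch N p e c y
      + (∑ e, Gam D p e a b y * Up Υ p e y) * Up Υ p c y) * s y := by
    rw [Finset.sum_mul, ← Finset.sum_add_distrib, Finset.sum_mul]
    exact Finset.sum_congr rfl fun e _ => by rw [hρ y hy]; ring
  have e2 : ∑ e, Gam D p e a c y * rhoC D p s b e y = (∑ e, Gam D p e a c y * Sch N p b e y
      + (∑ e, Gam D p e a c y * Up Υ p e y) * Up Υ p b y) * s y := by
    rw [Finset.sum_mul, ← Finset.sum_add_distrib, Finset.sum_mul]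
    exact Finset.sum_congr rfl fun e _ => by rw [hρ y hy]; ring
  rw [cdB, pd_congr_of_eqOn p a hw (fun z hz => hρ z hz b c) hy,
    pd_mul a ((hSd b c).add ((hU b).mul (hU c))) hsd, pd_add a (hSd b c) ((hU b).mul (hU c)),
    pd_mul a (hU b) (hU c), e1, e2, hρ y hy, hdU, hdU, hdS, hds',
    nuC_int (D := D) hDN hwi hwp hds hy, nuC_int (D := D) hDN hwi hwp hds hy, hsymm y hy b a]
  ring

end Interior

end

section

variable {n : ℕ} {M : Type*} [TopologicalSpace M] [ChartedSpace (EuclideanHalfSpace (n + 1)) M]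
  [IsManifold (𝓡∂ (n + 1)) ∞ M]

/-! ### Inverses of matrix-valued functions -/

section Inverse

variable {κ : Type*} [Fintype κ] [DecidableEq κ] {H : M → Matrix κ κ ℝ} {w : Set M}

/-- By Cramer's rule the entries are quotients of determinants. -/
lemma SmoothFn.matrix_inv (hH : ∀ A B, SmoothFn n (fun y => H y A B) w)
    (hdet : ∀ y ∈ w, (H y).det ≠ 0) (A B : κ) : SmoothFn n (fun y => (H y)⁻¹ A B) w := by
  have h1 : SmoothFn n (fun y => ((H y).updateRow B (Pi.single A 1)).det) w := by
    refine SmoothFn.det fun i j => ?_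
    simp only [Matrix.updateRow_apply]
    split_ifs
    · exact SmoothFn.const _ _
    · exact hH i j
  refine (h1.div (SmoothFn.det hH) hdet).congr fun y _ => ?_
  rw [Matrix.inv_def, Matrix.smul_apply, Matrix.adjugate_apply, Ring.inverse_eq_inv', smul_eq_mul,
    div_eq_inv_mul]

/-- Differentiating H⁻¹ H = 1 gives the dual system, linear in H⁻¹ with coefficients from the same
`W`. Linearity is what prevents the inverse from blowing up at the boundary. -/
lemma pd_matrix_inv [T2Space M] (hw : IsOpen w) (hH : ∀ A B, SmoothFn n (fun y => H y A B) w)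
    (hdet : ∀ y ∈ w, (H y).det ≠ 0) {p y : M} (hy : y ∈ w) (a : Fin (n + 1)) (W : Matrix κ κ ℝ)
    (hW : ∀ A B, pd p a (fun z => H z A B) y = ∑ C, W A C * H y C B + ∑ C, W B C * H y A C)
    (A B : κ) : pd p a (fun z => (H z)⁻¹ A B) y =
      -∑ C, W C A * (H y)⁻¹ C B - ∑ C, W C B * (H y)⁻¹ A C := by
  have hG := SmoothFn.matrix_inv hH hdet
  have hu : ∀ z ∈ w, IsUnit (H z).det := fun z hz => isUnit_iff_ne_zero.2 (hdet z hz)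
  let dH : Matrix κ κ ℝ := Matrix.of fun A B => pd p a (fun z => H z A B) y
  let dG : Matrix κ κ ℝ := Matrix.of fun A B => pd p a (fun z => (H z)⁻¹ A B) y
  have hdH : dH = W * H y + H y * Wᵀ := by
    ext A B
    simp only [dH, Matrix.of_apply, hW, Matrix.add_apply, Matrix.mul_apply, Matrix.transpose_apply,
      mul_comm (H y A _)]
  have h0 : dG * H y + (H y)⁻¹ * dH = 0 := by
    ext A B
    have h1 : pd p a (fun z => ∑ C, (H z)⁻¹ A C * H z C B) y =
        ∑ C, ((H y)⁻¹ A C * pd p a (fun z => H z C B) y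
          + H y C B * pd p a (fun z => (H z)⁻¹ A C) y) := by
      rw [pd_sum _ a fun C _ => ((hG A C).diffFnAt hw hy).mul ((hH C B).diffFnAt hw hy)]
      exact Finset.sum_congr rfl fun C _ =>
        pd_mul a ((hG A C).diffFnAt hw hy) ((hH C B).diffFnAt hw hy)
    have h2 : pd p a (fun z => ∑ C, (H z)⁻¹ A C * H z C B) y = 0 := by
      rw [pd_congr_of_eqOn p a (g := fun _ => (1 : Matrix κ κ ℝ) A B) hw (fun z hz => by
        rw [← Matrix.mul_apply, Matrix.nonsing_inv_mul _ (hu z hz)]) hy]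
      exact dAt_const _ _
    rw [h2] at h1
    simp only [Matrix.add_apply, Matrix.mul_apply, dG, dH, Matrix.of_apply, Matrix.zero_apply,
      ← Finset.sum_add_distrib]
    rw [h1]
    exact Finset.sum_congr rfl fun C _ => by ring
  have h1 : dG = -((H y)⁻¹ * W) - Wᵀ * (H y)⁻¹ := by
    have e1 : H y * (H y)⁻¹ = 1 := Matrix.mul_nonsing_inv _ (hu y hy)
    have e2 : (H y)⁻¹ * H y = 1 := Matrix.nonsing_inv_mul _ (hu y hy)
    have e3 : dG * H y = -((H y)⁻¹ * dH) := eq_neg_of_add_eq_zero_left h0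
    calc dG = dG * H y * (H y)⁻¹ := by rw [mul_assoc, e1, mul_one]
      _ = -((H y)⁻¹ * W * (H y * (H y)⁻¹)) - ((H y)⁻¹ * H y) * Wᵀ * (H y)⁻¹ := by
          rw [e3, hdH]; noncomm_ring
      _ = _ := by rw [e1, e2, mul_one, one_mul]
  have h2 := congrFun (congrFun h1 A) B
  simp only [dG, Matrix.of_apply, Matrix.sub_apply, Matrix.neg_apply, Matrix.mul_apply,
    Matrix.transpose_apply] at h2
  rw [h2]
  simp only [mul_comm ((H y)⁻¹ A _)]
  ring

end Inverse

/-! ### The splitting operator as a solution of a closed linear system -/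

/-- The components of the splitting operator as a symmetric matrix. -/
def Hm (D : ConnOp n M) (p : M) (s : M → ℝ) (y : M) :
    Matrix (Option (Fin (n + 1))) (Option (Fin (n + 1))) ℝ
  | none, none => s y
  | none, some b => nuC D p s b y
  | some b, none => nuC D p s b y
  | some b, some c => rhoC D p s b c y

/-- The connection form of the standard cotractor connection, twisted by densities. -/
def Wm (D : ConnOp n M) (p : M) (a : Fin (n + 1)) (y : M) :
    Matrix (Option (Fin (n + 1))) (Option (Fin (n + 1))) ℝ
  | none, none => wt n / 2 * gam D p a y
  | none, some c => if a = c then 1 else 0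
  | some b, none => -Sch D p a b y
  | some b, some e => Gam D p e a b y + if b = e then wt n / 2 * gam D p a y else 0

lemma rhoC_symm (D : ConnOp n M) (p : M) (s : M → ℝ) (b c : Fin (n + 1)) (y : M) :
    rhoC D p s b c y = rhoC D p s c b y := by
  rw [rhoC, rhoC]; ring

section System

variable [T2Space M] {D : ConnOp n M} {p : M} {w : Set M}

lemma Hm_smooth (hD : IsAffineConnectionOn D Set.univ) (hw : IsOpen w) (hwp : w ⊆ dom n p)
    {s : M → ℝ} (hs : SmoothFn n s w) (A B : Option (Fin (n + 1))) :
    SmoothFn n (fun y => Hm D p s y A B) w := by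
  have hν := nuC_smooth hD isOpen_univ hw (Set.subset_univ w) hwp hs
  rcases A with _ | b <;> rcases B with _ | c
  · exact hs
  · exact hν c
  · exact hν b
  · exact rhoC_smooth hD isOpen_univ hw (Set.subset_univ w) hwp hs b c

lemma Wm_smooth (hD : IsAffineConnectionOn D Set.univ) (hw : IsOpen w) (hwp : w ⊆ dom n p)
    (a : Fin (n + 1)) (A B : Option (Fin (n + 1))) :
    SmoothFn n (fun y => Wm D p a y A B) w := by
  have hg := (gam_smooth hD isOpen_univ hw (Set.subset_univ w) hwp a).const_mul (wt n / 2)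
  rcases A with _ | b <;> rcases B with _ | c
  · exact hg
  · exact SmoothFn.const _ _
  · exact (Sch_smooth hD isOpen_univ hw (Set.subset_univ w) hwp a b).neg
  · refine (Gam_smooth hD isOpen_univ hw (Set.subset_univ w) hwp c a b).add ?_
    by_cases h : b = c
    · simpa [h] using hg
    · simpa [h] using SmoothFn.const 0 w

/-- The tractor equations solved for the first derivatives. The system is closed: no derivative of
`s` beyond those recorded in `Hm` is left on the right. -/
lemma pd_Hm {s : M → ℝ} {y : M}
    (h1 : ∀ a b, cdF (wt n) D p a b (nuC D p s) y + Sch D p a b y * s y - rhoC D p s a b y = 0)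
    (h2 : ∀ a b c, cdB (wt n) D p a b c (rhoC D p s) y + Sch D p a b y * nuC D p s c y
      + Sch D p a c y * nuC D p s b y = 0) (a : Fin (n + 1)) (A B : Option (Fin (n + 1))) :
    pd p a (fun z => Hm D p s z A B) y =
      ∑ C, Wm D p a y A C * Hm D p s y C B + ∑ C, Wm D p a y B C * Hm D p s y A C := by
  have hmix : ∀ b, pd p a (nuC D p s b) y = wt n * gam D p a y * nuC D p s b y
      + rhoC D p s a b y - Sch D p a b y * s y + ∑ e, Gam D p e a b y * nuC D p s e y := by
    intro b
    have h := h1 a b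
    rw [cdF] at h
    linarith
  rcases A with _ | b <;> rcases B with _ | c
  -- The corner entry is the definition of the middle slot, read as an equation for the derivative
  -- of `s`.
  · have h : nuC D p s a y = 1 / 2 * (pd p a s y - wt n * gam D p a y * s y) := rfl
    simp only [Hm, Wm, Fintype.sum_option, ite_mul, one_mul, zero_mul, Finset.sum_ite_eq,
      Finset.mem_univ, if_true]
    rw [h]; ring
  · simp only [Hm, Wm, Fintype.sum_option, ite_mul, one_mul, zero_mul, Finset.sum_ite_eq,
      Finset.mem_univ, if_true, add_mul, Finset.sum_add_distrib]
    refine (hmix c).trans ?_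
    ring
  · simp only [Hm, Wm, Fintype.sum_option, ite_mul, one_mul, zero_mul, Finset.sum_ite_eq,
      Finset.mem_univ, if_true, add_mul, Finset.sum_add_distrib]
    refine (hmix b).trans ?_
    rw [rhoC_symm D p s a b]
    ring
  · have h := h2 a b c
    rw [cdB] at h
    simp only [Hm, Wm, Fintype.sum_option, ite_mul, zero_mul, Finset.sum_ite_eq,
      Finset.mem_univ, if_true, add_mul, Finset.sum_add_distrib]
    change pd p a (rhoC D p s b c) y = _
    linarith

end System

end

/-! ### Extension of the density and its tractor to the boundary. -/

section

variable {n : ℕ} {M : Type*} [TopologicalSpace M] [ChartedSpace (EuclideanHalfSpace (n + 1)) M]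
  [IsManifold (𝓡∂ (n + 1)) ∞ M] [T2Space M] {D N : ConnOp n M} {Υ : (x : M) → T n x →L[ℝ] ℝ}
  {p : M} {w : Set M}

lemma RicciNondegenerate.components (hN : IsAffineConnectionOn N (int n M))
    (hR : RicciNondegenerate N) {y : M} (hy : y ∈ int n M) (hyp : y ∈ dom n p)
    {v : Fin (n + 1) → ℝ} (hv : ∀ c, ∑ b, v b * Ric N p b c y = 0) : v = 0 := by
  have h := hR y hy (∑ b, v b • fr p b y) fun w' => by
    rw [ricci_eq hN isOpen_int hy hyp, Finset.sum_comm]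
    refine Finset.sum_eq_zero fun c _ => ?_
    have h1 : ∀ b, co p b y (∑ b, v b • fr p b y) = v b := fun b => by simp [co_fr p hyp]
    simp only [h1]
    rw [← mul_zero (co p c y w'), ← hv c, Finset.mul_sum]
    exact Finset.sum_congr rfl fun b _ => by ring
  funext b
  have h2 := congrArg (co p b y) h
  simpa [co_fr p hyp] using h2

/-- A projective class with a non-degenerate Ricci tensor lives in dimension at least two. -/
lemma RicciNondegenerate.ne_zero (hN : IsAffineConnectionOn N (int n M))
    (hR : RicciNondegenerate N) {y : M} (hy : y ∈ int n M) : n ≠ 0 := by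
  rintro rfl
  have h := hR.components hN hy (mem_dom y) (v := fun _ => 1) fun c => by
    have hc : c = 0 := Fin.eq_zero c
    simp [Ric, Rm, hc]
  simpa using congrFun h 0

lemma Sch_of_symm (hn : n ≠ 0) {y : M} (h : ∀ b c, Ric N p b c y = Ric N p c b y)
    (b c : Fin (n + 1)) : Sch N p b c y = Ric N p b c y / n := by
  have hn' : (n : ℝ) ≠ 0 := Nat.cast_ne_zero.2 hn
  have hn2 : ((n : ℝ) + 1) ^ 2 - 1 ≠ 0 := by
    have h : ((n : ℝ) + 1) ^ 2 - 1 = n * (n + 2) := by ring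
    rw [h]
    positivity
  rw [Sch, h c b]
  field_simp
  ring

/-- Up to the unipotent change of splitting by Υ, the matrix is block diagonal with blocks s and
(s/n) Ric. For a kernel vector (a, v), the first equation gives a = Υ(v); substituting it leaves
Ric(v, ·) = 0. -/
lemma Hm_det_ne_zero (hn : n ≠ 0) (hD : IsAffineConnectionOn D Set.univ)
    (hN : IsAffineConnectionOn N (int n M)) (hR : RicciNondegenerate N)
    (hΥ : SmoothOneFormOn Υ (int n M)) (hDN : IsProjectiveChangeOn D N Υ (int n M))
    (hw : IsOpen w) (hwi : w ⊆ int n M) (hwp : w ⊆ dom n p) {s : M → ℝ} (hs : SmoothFn n s w)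
    (hds : ∀ y ∈ w, ∀ a, pd p a s y = wt n * gam N p a y * s y)
    (hsymm : ∀ y ∈ w, ∀ b c, Ric N p b c y = Ric N p c b y) {y : M} (hy : y ∈ w)
    (hs0 : s y ≠ 0) : (Hm D p s y).det ≠ 0 := by
  have hn' : (n : ℝ) ≠ 0 := Nat.cast_ne_zero.2 hn
  have hS : ∀ z ∈ w, ∀ b c, Sch N p b c z = Sch N p c b z := fun z hz b c => by
    rw [Sch_of_symm hn (hsymm z hz), Sch_of_symm hn (hsymm z hz), hsymm z hz]
  have hν := nuC_int (D := D) hDN hwi hwp hds hy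
  have hρ := rhoC_int hn hD hΥ hDN hw hwi hwp hs hds hS hy
  intro h0
  obtain ⟨v, hv0, hv⟩ := Matrix.exists_vecMul_eq_zero_iff.2 h0
  apply hv0
  have hB : ∀ B, ∑ A, v A * Hm D p s y A B = 0 := fun B => congrFun hv B
  have h1 : v none = ∑ b, v (some b) * Up Υ p b y := by
    have h := hB none
    simp only [Fintype.sum_option, Hm, hν] at h
    have h' : (v none - ∑ b, v (some b) * Up Υ p b y) * s y = 0 := by
      rw [← h, sub_mul, Finset.sum_mul, sub_eq_add_neg, ← Finset.sum_neg_distrib]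
      congr 1
      exact Finset.sum_congr rfl fun b _ => by ring
    linarith [(mul_eq_zero.1 h').resolve_right hs0]
  have h2 : (fun b => v (some b)) = 0 := by
    refine hR.components hN (hwi hy) (hwp hy) fun c => ?_
    have h := hB (some c)
    simp only [Fintype.sum_option, Hm, hν, hρ, Sch_of_symm hn (hsymm y hy)] at h
    rw [h1, Finset.sum_mul, ← Finset.sum_add_distrib] at h
    have h' : (∑ b, v (some b) * Ric N p b c y) * (s y / n) = 0 := by
      rw [← h, Finset.sum_mul]
      exact Finset.sum_congr rfl fun b _ => by ring
    exact (mul_eq_zero.1 h').resolve_right (div_ne_zero hs0 hn')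
  funext A
  rcases A with _ | b
  · rw [h1]
    exact Finset.sum_eq_zero fun b _ => by rw [congrFun h2 b]; simp
  · exact congrFun h2 b

/-- This rewrites a matrix equation of the form dX = V X + X Wᵀ as a linear system whose unknowns
are indexed by pairs. -/
lemma sum_prod_ite {κ : Type*} [Fintype κ] [DecidableEq κ] (A B : κ) (V W : κ → ℝ)
    (X : κ → κ → ℝ) :
    ∑ C : κ × κ, ((if B = C.2 then V C.1 else 0) + if A = C.1 then W C.2 else 0) * X C.1 C.2 =
      ∑ C, V C * X C B + ∑ C, W C * X A C := by
  simp only [add_mul, ite_mul, zero_mul, Finset.sum_add_distrib, Fintype.sum_prod_type,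
    Finset.sum_ite_eq, Finset.mem_univ, if_true]
  congr 1
  rw [Finset.sum_comm]
  simp

/-- The density defined by a parallel volume density extends smoothly to the boundary, where it
satisfies the closed system with a non-degenerate matrix of components. -/
lemma exists_density_extension (hD : IsAffineConnectionOn D Set.univ)
    (hN : IsAffineConnectionOn N (int n M)) (hRp : RicciParallel N) (hR : RicciNondegenerate N)
    {κ : (x : M) → Dens n 1 x} (hκ : IsParallelVolume N κ)
    (hΥ : SmoothOneFormOn Υ (int n M)) (hDN : IsProjectiveChangeOn D N Υ (int n M)) (x : M) :
    ∃ (w : Set M) (t : M → ℝ), IsOpen w ∧ x ∈ w ∧ w ⊆ dom n x ∧ SmoothFn n t w ∧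
      (∀ y ∈ w, y ∈ int n M → t y = |dcomp x κ y| ^ wt n) ∧
      (∀ y ∈ w, y ∈ int n M → ∀ a, nuC D x t a y = -(Up Υ x a y * t y)) ∧
      ∀ y ∈ w,
        (∀ a b, cdF (wt n) D x a b (nuC D x t) y + Sch D x a b y * t y - rhoC D x t a b y = 0) ∧
        (∀ a b c, cdB (wt n) D x a b c (rhoC D x t) y + Sch D x a b y * nuC D x t c y
          + Sch D x a c y * nuC D x t b y = 0) ∧
        ∃ G : Matrix (Option (Fin (n + 1))) (Option (Fin (n + 1))) ℝ, Hm D x t y * G = 1 := by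
  obtain ⟨z, -, hz⟩ := exists_mem_int (n := n) isOpen_univ (Set.mem_univ x)
  have hn := hR.ne_zero hN hz
  -- The interior facts are stated for any function agreeing with |κ|^wt, as they are needed twice:
  -- for this function itself and for its extension `t` restricted to the interior.
  have main : ∀ {w : Set M} {s : M → ℝ}, IsOpen w → w ⊆ int n M → w ⊆ dom n x → SmoothFn n s w →
      (∀ y ∈ w, s y = |dcomp x κ y| ^ wt n) →
      (∀ y ∈ w, ∀ a, nuC D x s a y = -(Up Υ x a y * s y)) ∧
      (∀ y ∈ w, ∀ a b, cdF (wt n) D x a b (nuC D x s) y + Sch D x a b y * s y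
        - rhoC D x s a b y = 0) ∧
      (∀ y ∈ w, ∀ a b c, cdB (wt n) D x a b c (rhoC D x s) y + Sch D x a b y * nuC D x s c y
          + Sch D x a c y * nuC D x s b y = 0) ∧ ∀ y ∈ w, (Hm D x s y).det ≠ 0 := by
    intro w s hw hwi hwp hs hsk
    have hds : ∀ y ∈ w, ∀ a, pd x a s y = wt n * gam N x a y * s y := fun y hy a => by
      rw [pd_congr_of_eqOn x a hw hsk hy, pd_abs_dcomp_rpow hN hκ _ hw hwi hwp hy, hsk y hy]
    have hsymm : ∀ y ∈ w, ∀ b c, Ric N x b c y = Ric N x c b y := fun y hy b c =>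
      hκ.Ric_symm hN hw hwi hwp hy b c
    have hS : ∀ z ∈ w, ∀ b c, Sch N x b c z = Sch N x c b z := fun z hz b c => by
      rw [Sch_of_symm hn (hsymm z hz), Sch_of_symm hn (hsymm z hz), hsymm z hz]
    refine ⟨fun y hy a => nuC_int hDN hwi hwp hds hy a,
      fun y hy a b => cdF_add_Sch_int hn hD hΥ hDN hw hwi hwp hs hds hS hy a b,
      fun y hy a b c => cdB_add_Sch_int hn hD hN hRp hΥ hDN hw hwi hwp hs hds hS hy a b c,
      fun y hy => Hm_det_ne_zero hn hD hN hR hΥ hDN hw hwi hwp hs hds hsymm hy ?_⟩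
    rw [hsk y hy]
    exact (Real.rpow_pos_of_pos (abs_pos.2 (hκ.dcomp_ne_zero (hwi hy) (hwp hy))) _).ne'
  have hW := fun {w : Set M} (hw : IsOpen w) (hwp : w ⊆ dom n x) => Wm_smooth hD hw hwp
  have hite : ∀ {w : Set M} (c : Prop) [Decidable c] {f : M → ℝ}, SmoothFn n f w →
      SmoothFn n (fun y => if c then f y else 0) w := by
    intro w c _ f hf
    by_cases h : c
    · simpa [h] using hf
    · simpa [h] using SmoothFn.const 0 w
  have hw0 : IsOpen (dom n x ∩ int n M) := (isOpen_dom x).inter isOpen_int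
  have hs0 := abs_dcomp_rpow_smooth hκ (wt n) hw0 Set.inter_subset_right Set.inter_subset_left
  obtain ⟨-, hF0, hB0, -⟩ := main hw0 Set.inter_subset_right Set.inter_subset_left hs0
    fun y _ => rfl
  obtain ⟨w₁, F, hw₁, hxw₁, hw₁x, hFs, hFeq⟩ := exists_smooth_extension (κ := Option (Fin (n + 1)) × Option (Fin (n + 1)))
    (isOpen_dom x) (mem_dom x) le_rfl
    (c := fun a A B z => (if A.2 = B.2 then Wm D x a z A.1 B.1 else 0)
      + if A.1 = B.1 then Wm D x a z A.2 B.2 else 0)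
    (fun a A B => (hite _ (hW (isOpen_dom x) le_rfl a _ _)).add
      (hite _ (hW (isOpen_dom x) le_rfl a _ _)))
    (f := fun A z => Hm D x (fun y => |dcomp x κ y| ^ wt n) z A.1 A.2)
    (fun A => Hm_smooth hD hw0 Set.inter_subset_left hs0 A.1 A.2)
    (fun y hy hyi a A => by
      rw [pd_Hm (hF0 y ⟨hy, hyi⟩) (hB0 y ⟨hy, hyi⟩) a A.1 A.2]
      exact (sum_prod_ite A.1 A.2 _ _ _).symm)
  -- Only the corner entry of the extended matrix is kept; the remaining entries are recomputed from
  -- `t` by the splitting operator.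
  let t := F (none, none)
  have ht : SmoothFn n t w₁ := hFs _
  have htk : ∀ y ∈ w₁, y ∈ int n M → t y = |dcomp x κ y| ^ wt n := fun y hy hyi =>
    hFeq y hy hyi (none, none)
  have hwi₁ : IsOpen (w₁ ∩ int n M) := hw₁.inter isOpen_int
  obtain ⟨hν1, hF1, hB1, hdet⟩ := main hwi₁ Set.inter_subset_right
    (Set.inter_subset_left.trans hw₁x) (ht.mono Set.inter_subset_left) fun y hy => htk y hy.1 hy.2
  have hH := Hm_smooth hD hw₁ hw₁x ht
  have hHi := fun A B => (hH A B).mono (Set.inter_subset_left (t := int n M))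
  -- The inverse matrix is extended by its own dual system, on a possibly smaller neighbourhood;
  -- this avoids any control of the determinant at the boundary.
  obtain ⟨w₂, G, hw₂, hxw₂, hw₂₁, hGs, hGeq⟩ := exists_smooth_extension (κ := Option (Fin (n + 1)) × Option (Fin (n + 1)))
    hw₁ hxw₁ hw₁x
    (c := fun a A B z => -((if A.2 = B.2 then Wm D x a z B.1 A.1 else 0)
      + if A.1 = B.1 then Wm D x a z B.2 A.2 else 0))
    (fun a A B => ((hite _ (hW hw₁ hw₁x a _ _)).add (hite _ (hW hw₁ hw₁x a _ _))).neg)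
    (f := fun A z => (Hm D x t z)⁻¹ A.1 A.2)
    (fun A => SmoothFn.matrix_inv hHi hdet A.1 A.2)
    (fun y hy hyi a A => by
      rw [pd_matrix_inv hwi₁ hHi hdet (p := x) ⟨hy, hyi⟩ a (Wm D x a y)
        (fun A B => pd_Hm (hF1 y ⟨hy, hyi⟩) (hB1 y ⟨hy, hyi⟩) a A B) A.1 A.2]
      have h := sum_prod_ite A.1 A.2 (fun C => Wm D x a y C A.1) (fun C => Wm D x a y C A.2)
        fun B C => (Hm D x t y)⁻¹ B C
      simp only [neg_mul, Finset.sum_neg_distrib]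
      linarith)
  have hw₂x := hw₂₁.trans hw₁x
  have ht2 := ht.mono hw₂₁
  have hu := Set.subset_univ w₂
  have hν2 := nuC_smooth hD isOpen_univ hw₂ hu hw₂x ht2
  have hρ2 := rhoC_smooth hD isOpen_univ hw₂ hu hw₂x ht2
  have hS2 := Sch_smooth hD isOpen_univ hw₂ hu hw₂x
  refine ⟨w₂, t, hw₂, hxw₂, hw₂x, ht2, fun y hy hyi => htk y (hw₂₁ hy) hyi,
    fun y hy hyi => hν1 y ⟨hw₂₁ hy, hyi⟩, fun y hy => ⟨fun a b => ?_, fun a b c => ?_, ?_⟩⟩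
  · exact eq_zero_of_int hw₂ (((cdF_smooth hD isOpen_univ hw₂ hu hw₂x a b hν2).add
      ((hS2 a b).mul ht2)).sub (hρ2 a b)).continuousOn
      (fun z hz hzi => hF1 z ⟨hw₂₁ hz, hzi⟩ a b) hy
  · exact eq_zero_of_int hw₂ (((cdB_smooth hD isOpen_univ hw₂ hu hw₂x a b c hρ2).add
      ((hS2 a b).mul (hν2 c))).add ((hS2 a c).mul (hν2 b))).continuousOn
      (fun z hz hzi => hB1 z ⟨hw₂₁ hz, hzi⟩ a b c) hy
  · refine ⟨Matrix.of fun A B => G (A, B) y, ?_⟩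
    ext A B
    rw [Matrix.mul_apply, ← sub_eq_zero]
    refine eq_zero_of_int (n := n) (f := fun z => ∑ C, Hm D x t z A C * G (C, B) z
      - (1 : Matrix (Option (Fin (n + 1))) (Option (Fin (n + 1))) ℝ) A B) hw₂
      (((SmoothFn.sum _ fun C _ => ((hH A C).mono hw₂₁).mul (hGs (C, B))).sub
        (SmoothFn.const _ _)).continuousOn) (fun z hz hzi => ?_) hy
    have h := Matrix.mul_nonsing_inv (Hm D x t z)
      (isUnit_iff_ne_zero.2 (hdet z ⟨hw₂₁ hz, hzi⟩))
    rw [← h, Matrix.mul_apply, sub_eq_zero]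
    exact Finset.sum_congr rfl fun C _ => by rw [hGeq z hz hzi]

end

section

variable {n : ℕ} {M : Type*} [TopologicalSpace M] [ChartedSpace (EuclideanHalfSpace (n + 1)) M]
  [IsManifold (𝓡∂ (n + 1)) ∞ M]

/-! ### Projective changes of affine connections -/

lemma contMDiffAt_hom_of_co {L : (x : M) → T n x →L[ℝ] T n x} {w : Set M} (hw : IsOpen w) {y : M}
    (hy : y ∈ w) (h : ∀ i k, SmoothFn n (fun z => co y k z (L z (fr y i z))) w)
    (hwy : w ⊆ dom n y) :
    ContMDiffAt (𝓡∂ (n + 1)) ((𝓡∂ (n + 1)).prod 𝓘(ℝ, EuclideanSpace ℝ (Fin (n + 1)) →L[ℝ]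
      EuclideanSpace ℝ (Fin (n + 1)))) ∞
      (fun z => (⟨z, L z⟩ : Bundle.TotalSpace (EuclideanSpace ℝ (Fin (n + 1)) →L[ℝ]
        EuclideanSpace ℝ (Fin (n + 1))) fun z => T n z →L[ℝ] T n z)) y := by
  refine (contMDiffAt_hom_bundle _).2 ⟨contMDiffAt_id, ?_⟩
  let e := EuclideanSpace.basisFun (Fin (n + 1)) ℝ
  let C : Fin (n + 1) → Fin (n + 1) → EuclideanSpace ℝ (Fin (n + 1)) →L[ℝ]
      EuclideanSpace ℝ (Fin (n + 1)) := fun i k =>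
    (EuclideanSpace.proj i : EuclideanSpace ℝ (Fin (n + 1)) →L[ℝ] ℝ).smulRight (e k)
  have hs : ContMDiffAt (𝓡∂ (n + 1)) 𝓘(ℝ, EuclideanSpace ℝ (Fin (n + 1)) →L[ℝ]
      EuclideanSpace ℝ (Fin (n + 1))) ∞
      (fun z => ∑ i, ∑ k, co y k z (L z (fr y i z)) • C i k) y := by
    refine ContMDiffAt.sum fun i _ => ContMDiffAt.sum fun k _ => ?_
    exact (ContinuousLinearMap.toSpanSingleton ℝ (C i k)).contMDiff.contMDiffAt.comp y
      ((h i k).contMDiffAt (hw.mem_nhds hy))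
  refine hs.congr_of_eventuallyEq ?_
  filter_upwards [hw.mem_nhds hy] with z hz
  have hzy := hwy hz
  have key : ∀ i, ContinuousLinearMap.inCoordinates (EuclideanSpace ℝ (Fin (n + 1)))
      (TangentSpace (𝓡∂ (n + 1))) (EuclideanSpace ℝ (Fin (n + 1))) (TangentSpace (𝓡∂ (n + 1)))
      y z y z (L z) (e i) = ∑ k, co y k z (L z (fr y i z)) • e k := by
    intro i
    have h1 : (trivializationAt (EuclideanSpace ℝ (Fin (n + 1))) (TangentSpace (𝓡∂ (n + 1)))
        y).symmL ℝ z (e i) = fr y i z := (fr_eq_symmL hzy i).symm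
    simp only [ContinuousLinearMap.inCoordinates, ContinuousLinearMap.comp_apply, h1]
    conv_lhs => rw [← sum_co_fr y hzy (L z (fr y i z))]
    rw [map_sum]
    refine Finset.sum_congr rfl fun k _ => ?_
    rw [map_smul, fr_eq_symmL hzy k, Bundle.Trivialization.continuousLinearMapAt_symmL _
      (mem_baseSet hzy)]
    rfl
  ext1 v
  have hv : v = ∑ a, v a • e a := by
    conv_lhs => rw [← e.sum_repr v]
    simp [e]
  have h2 : (∑ i, ∑ k, co y k z (L z (fr y i z)) • C i k) v =
      ∑ i, v i • ∑ k, co y k z (L z (fr y i z)) • e k := by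
    simp only [sum_apply, smul_apply, C, ContinuousLinearMap.smulRight_apply, Finset.smul_sum]
    refine Finset.sum_congr rfl fun i _ => Finset.sum_congr rfl fun k _ => ?_
    rw [smul_comm]
    rfl
  refine Eq.trans ?_ h2.symm
  conv_lhs => rw [hv]
  rw [map_sum]
  exact Finset.sum_congr rfl fun i _ => by rw [map_smul, key i]

/-- The connection `D + Υ`. -/
def projChange (D : ConnOp n M) (Υ : (x : M) → T n x →L[ℝ] ℝ) : ConnOp n M := fun η y =>
  D η y + (Υ y).smulRight (η y) + Υ y (η y) • ContinuousLinearMap.id ℝ (T n y)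

lemma projChange_apply (D : ConnOp n M) (Υ : (x : M) → T n x →L[ℝ] ℝ) (η : (x : M) → T n x) (y : M)
    (ξ : T n y) : projChange D Υ η y ξ = D η y ξ + Υ y ξ • η y + Υ y (η y) • ξ := rfl

/-- The added terms are tensorial in the field and symmetric in the two arguments, so the Leibniz
rule and the torsion are unaffected. -/
lemma IsAffineConnectionOn.projChange [T2Space M] {D : ConnOp n M}
    (hD : IsAffineConnectionOn D Set.univ) {Υ : (x : M) → T n x →L[ℝ] ℝ} {u : Set M} (hu : IsOpen u)
    (hΥ : SmoothOneFormOn Υ u) : IsAffineConnectionOn (projChange D Υ) u where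
  isCovariantDerivativeOn :=
    { add := fun {σ σ' x} hσ hσ' hx => by
        ext1 ξ
        have h := hD.isCovariantDerivativeOn.add hσ hσ' (Set.mem_univ x)
        simp only [projChange_apply, h, add_apply, Pi.add_apply, map_add, smul_add, add_smul]
        abel
      leibniz := fun {σ g x} hσ hg hx => by
        ext1 ξ
        have h := hD.isCovariantDerivativeOn.leibniz hσ hg (Set.mem_univ x)
        simp only [projChange_apply, h, add_apply, smul_apply, Pi.smul_apply', map_smul,
          smul_add, smul_smul, smul_eq_mul, mul_comm (g x)]
        abel }
  smooth :=
    { contMDiff := fun {σ} hσ => by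
        have hσ' : SmoothVF σ u := by simpa using! hσ
        intro y hy
        have hw : IsOpen (u ∩ dom n y) := hu.inter (isOpen_dom y)
        have hwu : u ∩ dom n y ⊆ u := Set.inter_subset_left
        have hwy : u ∩ dom n y ⊆ dom n y := Set.inter_subset_right
        refine (contMDiffAt_hom_of_co hw ⟨hy, mem_dom y⟩ (fun i k => ?_) hwy).contMDiffWithinAt
        have hσw := hσ'.mono hwu
        have hf := (fr_smooth (n := n) y i).mono hwy
        have h1 := (smoothVF_iff y hw hwy).1
          (hD.smoothVF isOpen_univ hw (Set.subset_univ _) hσw hf) k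
        have h2 := (smoothVF_iff y hw hwy).1 hσw k
        have h3 := (smoothVF_iff y hw hwy).1 hf k
        refine ((h1.add ((hΥ.apply hw hwu hf).mul h2)).add ((hΥ.apply hw hwu hσw).mul h3)).congr
          fun z _ => ?_
        simp only [projChange_apply, map_add, map_smul, smul_eq_mul] }
  torsionFree := fun X Y x hx hX hY => by
    rw [← hD.torsionFree X Y x (Set.mem_univ x) hX hY]
    simp only [projChange_apply]
    abel

end

section

variable {n : ℕ} {M : Type*} [TopologicalSpace M] [ChartedSpace (EuclideanHalfSpace (n + 1)) M]
  [IsManifold (𝓡∂ (n + 1)) ∞ M] {N : ConnOp n M} {p : M} {w : Set M}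

/-! ### Einstein metrics -/

section Metric

variable {g : (x : M) → T n x →ₗ[ℝ] T n x →ₗ[ℝ] ℝ}

/-- The components of a bilinear form. -/
def gC (g : (x : M) → T n x →ₗ[ℝ] T n x →ₗ[ℝ] ℝ) (p : M) (c d : Fin (n + 1)) (y : M) : ℝ :=
  g y (fr p c y) (fr p d y)

lemma eq_sum_gC {y : M} (hyp : y ∈ dom n p) (v v' : T n y) :
    g y v v' = ∑ c, ∑ d, co p c y v * co p d y v' * gC g p c d y := by
  conv_lhs => rw [← sum_co_fr p hyp v, ← sum_co_fr p hyp v']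
  simp only [map_sum, map_smul, LinearMap.sum_apply, LinearMap.smul_apply, smul_eq_mul,
    Finset.mul_sum, gC]
  rw [Finset.sum_comm]
  exact Finset.sum_congr rfl fun c _ => Finset.sum_congr rfl fun d _ => by ring

lemma gC_smooth [T2Space M] (hg : IsPseudoRiemannianMetricOn g (int n M)) (hw : IsOpen w)
    (hwi : w ⊆ int n M) (hwp : w ⊆ dom n p) (c d : Fin (n + 1)) : SmoothFn n (gC g p c d) w := by
  intro y hy
  have hXs : SmoothVF (fr p c) w := (fr_smooth (n := n) p c).mono hwp
  obtain ⟨X, hX, hXe⟩ := SmoothVF.exists_global hXs hw hy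
  have hYs : SmoothVF (fr p d) w := (fr_smooth (n := n) p d).mono hwp
  obtain ⟨Y, hY, hYe⟩ := SmoothVF.exists_global hYs hw hy
  have h1 := (hg.smooth X Y (hX.mono (Set.subset_univ _)) (hY.mono (Set.subset_univ _))).mono hwi
  refine ((h1.contMDiffAt (hw.mem_nhds hy)).congr_of_eventuallyEq ?_).contMDiffWithinAt
  filter_upwards [hXe, hYe] with z hz hz'
  rw [hz, hz', gC]

/-- The Gram matrix of the coordinate frame. -/
def gram (g : (x : M) → T n x →ₗ[ℝ] T n x →ₗ[ℝ] ℝ) (p y : M) :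
    Matrix (Fin (n + 1)) (Fin (n + 1)) ℝ := Matrix.of fun c d => gC g p c d y

lemma gram_det_ne_zero (hg : IsPseudoRiemannianMetricOn g (int n M)) {y : M} (hy : y ∈ int n M)
    (hyp : y ∈ dom n p) : (gram g p y).det ≠ 0 := by
  intro h0
  obtain ⟨v, hv0, hv⟩ := Matrix.exists_vecMul_eq_zero_iff.2 h0
  apply hv0
  have hB : ∀ d, ∑ c, v c * gC g p c d y = 0 := fun d => congrFun hv d
  have h := hg.nondegenerate y hy (∑ c, v c • fr p c y) fun v' => by
    rw [eq_sum_gC hyp, Finset.sum_comm]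
    refine Finset.sum_eq_zero fun d _ => ?_
    have h1 : ∀ b, co p b y (∑ b, v b • fr p b y) = v b := fun b => by simp [co_fr p hyp]
    simp only [h1]
    rw [← mul_zero (co p d y v'), ← hB d, Finset.mul_sum]
    exact Finset.sum_congr rfl fun b _ => by ring
  funext b
  have h2 := congrArg (co p b y) h
  simpa [co_fr p hyp] using h2

lemma pd_gC [T2Space M] (hg : IsPseudoRiemannianMetricOn g (int n M))
    (hN : IsLeviCivitaOn N g (int n M)) (hw : IsOpen w) (hwi : w ⊆ int n M) (hwp : w ⊆ dom n p)
    {y : M} (hy : y ∈ w) (a c d : Fin (n + 1)) : pd p a (gC g p c d) y =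
      ∑ e, Gam N p e a c y * gC g p e d y + ∑ e, Gam N p e a d y * gC g p c e y := by
  have h := covDerivBilin_eq_sum hN.1 isOpen_int p (hwi hy) (hwp hy)
    (β := fun y v w => g y v w) (b := gC g p)
    (fun c d => (gC_smooth hg hw hwi hwp c d).diffFnAt hw hy)
    (by filter_upwards [hw.mem_nhds hy] with z hz v v'
        exact eq_sum_gC (hwp hz) v v') (fr p a y) (fr p c y) (fr p d y)
  simp only [hN.2 y (hwi hy), sum_co_fr_mul p (hwp hy), sum_sum_co_fr_mul p (hwp hy), cdB] at h
  linarith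

/-- Metricity reads dG = θᵀ G + G θ = G (G⁻¹ θᵀ G + θ). Jacobi's formula applies, and the conjugated
summand has the same trace as θ. -/
lemma pd_gram_det [T2Space M] (hg : IsPseudoRiemannianMetricOn g (int n M))
    (hN : IsLeviCivitaOn N g (int n M)) (hw : IsOpen w) (hwi : w ⊆ int n M) (hwp : w ⊆ dom n p)
    {y : M} (hy : y ∈ w) (a : Fin (n + 1)) :
    pd p a (fun z => (gram g p z).det) y = 2 * gam N p a y * (gram g p y).det := by
  let θ : Matrix (Fin (n + 1)) (Fin (n + 1)) ℝ := Matrix.of fun e c => Gam N p e a c y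
  let G := gram g p y
  have hu : IsUnit G.det := isUnit_iff_ne_zero.2 (gram_det_ne_zero hg (hwi hy) (hwp hy))
  have h1 : G * (G⁻¹ * θᵀ * G + θ) = θᵀ * G + G * θ := by
    rw [mul_add, ← mul_assoc, ← mul_assoc, Matrix.mul_nonsing_inv _ hu, one_mul]
  have h2 := dAt_det (A := gram g p) (y := y)
    (fun c d => (gC_smooth hg hw hwi hwp c d).diffFnAt hw hy) (fr p a y) (G⁻¹ * θᵀ * G + θ)
    fun c d => by
      have h3 := congrFun (congrFun h1 c) d
      rw [Matrix.mul_apply] at h3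
      refine Eq.trans ?_ h3.symm
      refine (pd_gC hg hN hw hwi hwp hy a c d).trans ?_
      simp only [Matrix.add_apply, Matrix.mul_apply, Matrix.transpose_apply, θ, Matrix.of_apply, G,
        gram]
      congr 1
      exact Finset.sum_congr rfl fun e _ => mul_comm _ _
  refine h2.trans ?_
  have h3 : (G⁻¹ * θᵀ * G).trace = θ.trace := by
    rw [Matrix.trace_mul_comm, ← mul_assoc, Matrix.mul_nonsing_inv _ hu, one_mul,
      Matrix.trace_transpose]
  have h4 : θ.trace = gam N p a y := rfl
  rw [Matrix.trace_add, h3, h4]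
  ring

/-- The volume density of a metric. -/
def metricVol (g : (x : M) → T n x →ₗ[ℝ] T n x →ₗ[ℝ] ℝ) (x : M) : Dens n 1 x :=
  densityOfBasis 1 (tBasis x)
    (|(Matrix.of fun i j => g x (tBasis x i) (tBasis x j)).det| ^ (1 / 2 : ℝ))

/-- A change of basis acts on Gram matrices by congruence, so the root of the absolute determinant
scales by the absolute determinant of the change, as a density of order one should. -/
lemma dcomp_metricVol {y : M} (hyp : y ∈ dom n p) :
    dcomp p (metricVol g) y = |(gram g p y).det| ^ (1 / 2 : ℝ) := by
  have h1 := density_apply_basis (metricVol g y) (tBasis y) (frBasis p hyp)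
  rw [metricVol, densityOfBasis_apply_self, frBasis_coe] at h1
  have h2 : gram g p y = ((tBasis y).toMatrix (frBasis p hyp))ᵀ *
      (Matrix.of fun i j => g y (tBasis y i) (tBasis y j)) * (tBasis y).toMatrix (frBasis p hyp) := by
    have h1 : LinearMap.BilinForm.toMatrix (tBasis y) (g y) =
        Matrix.of fun i j => g y (tBasis y i) (tBasis y j) :=
      Matrix.ext fun i j => LinearMap.BilinForm.toMatrix_apply _ _ _ _
    have h2 := LinearMap.BilinForm.toMatrix_mul_basis_toMatrix (tBasis (n := n) y) (frBasis p hyp)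
      (g y)
    rw [h1] at h2
    refine Eq.trans (Matrix.ext fun i j => ?_) h2.symm
    rw [LinearMap.BilinForm.toMatrix_apply, frBasis_coe]
    rfl
  refine h1.trans ?_
  rw [h2, Matrix.det_mul, Matrix.det_mul, Matrix.det_transpose, ← Module.Basis.det_apply,
    frBasis_coe, Real.rpow_one]
  have h3 : ∀ a b : ℝ, |a| * |b| ^ (1 / 2 : ℝ) = |a * b * a| ^ (1 / 2 : ℝ) := by
    intro a b
    rw [abs_mul, abs_mul, mul_comm |a| |b|, mul_assoc, Real.mul_rpow (abs_nonneg _) (by positivity),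
      ← Real.sqrt_eq_rpow, ← Real.sqrt_eq_rpow, Real.sqrt_mul_self (abs_nonneg _), mul_comm]
  exact h3 _ _

end Metric

lemma isParallelVolume_metricVol [T2Space M] {g : (x : M) → T n x →ₗ[ℝ] T n x →ₗ[ℝ] ℝ}
    (hg : IsPseudoRiemannianMetricOn g (int n M)) (hN : IsLeviCivitaOn N g (int n M)) :
    IsParallelVolume N (metricVol g) := by
  have hw : ∀ x : M, IsOpen (dom n x ∩ int n M) := fun x => (isOpen_dom x).inter isOpen_int
  have hwx : ∀ x : M, dom n x ∩ int n M ⊆ dom n x := fun x => Set.inter_subset_left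
  have hwi : ∀ x : M, dom n x ∩ int n M ⊆ int n M := fun x => Set.inter_subset_right
  have hdet : ∀ x : M, SmoothFn n (fun z => (gram g x z).det) (dom n x ∩ int n M) := fun x =>
    SmoothFn.det fun c d => gC_smooth hg (hw x) (hwi x) (hwx x) c d
  have hs : ∀ x : M, SmoothFn n (dcomp x (metricVol g)) (dom n x ∩ int n M) := fun x =>
    ((hdet x).comp (F := fun t => |t| ^ (1 / 2 : ℝ)) fun z hz => contDiffAt_abs_rpow _
      (gram_det_ne_zero hg hz.2 hz.1)).congr fun z hz => dcomp_metricVol hz.1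
  refine ⟨smoothDensOn_of_dcomp fun x hx => ⟨x, _, hw x, ⟨mem_dom x, hx⟩, hwx x, hs x⟩,
    fun x hx h0 => ?_, fun x hx v => ?_⟩
  · have h1 := dcomp_metricVol (g := g) (mem_dom (n := n) x)
    rw [dcomp, h0] at h1
    exact (Real.rpow_pos_of_pos (abs_pos.2 (gram_det_ne_zero hg hx (mem_dom x))) _).ne h1
  · have hx' : x ∈ dom n x ∩ int n M := ⟨mem_dom x, hx⟩
    refine eq_of_dcomp_eq x (mem_dom x) _ _ ?_
    rw [covDerivDens_eq hN.1 isOpen_int x hx (mem_dom x) ((hs x).diffFnAt (hw x) hx')]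
    refine Finset.sum_eq_zero fun a _ => ?_
    have h0 := gram_det_ne_zero hg hx (mem_dom x)
    have h1 : pd x a (dcomp x (metricVol g)) x = gam N x a x * dcomp x (metricVol g) x := by
      rw [pd_congr_of_eqOn x a (hw x) (fun z hz => dcomp_metricVol hz.1) hx', pd,
        dAt_comp (F := fun t => |t| ^ (1 / 2 : ℝ)) ((hdet x).diffFnAt (hw x) hx')
          (hasDerivAt_abs_rpow _ h0), ← pd, pd_gram_det hg hN (hw x) (hwi x) (hwx x) hx',
        dcomp_metricVol (mem_dom x)]
      field_simp
    rw [cdS, h1]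
    ring

/-- The Ricci curvature as a bilinear form. -/
def ricciForm (N : ConnOp n M) (x : M) : T n x →ₗ[ℝ] T n x →ₗ[ℝ] ℝ :=
  ∑ j, ∑ m, Ric N x j m x • (co x j x).smulRight (co x m x)

/-! ### Einstein metrics and parallel Ricci curvature. -/

section Ricci

variable [T2Space M]

lemma ricciForm_apply (hN : IsAffineConnectionOn N (int n M)) {x : M} (hx : x ∈ int n M)
    (v w : T n x) : ricciForm N x v w = ricci N x v w := by
  rw [ricci_eq hN isOpen_int hx (mem_dom x), ricciForm]
  simp only [LinearMap.sum_apply, LinearMap.smul_apply, LinearMap.smulRight_apply, smul_eq_mul]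
  exact Finset.sum_congr rfl fun c _ => Finset.sum_congr rfl fun d _ => by ring

/-- Forwards, Ric = c g inherits parallelism and non-degeneracy from g, and the metric volume is
parallel. Backwards, Ric is taken as the metric, with Einstein constant 1; its symmetry is the one
property that uses the parallel volume. -/
lemma isLeviCivita_iff (hN : IsAffineConnectionOn N (int n M)) :
    IsLeviCivitaOfNonRicciFlatEinstein N ↔
      IsSpecial N ∧ RicciParallel N ∧ RicciNondegenerate N := by
  constructor
  · rintro ⟨g, hg, hLC, c, hc, hRic⟩
    refine ⟨⟨_, isParallelVolume_metricVol hg hLC⟩, fun x hx a v v' => ?_, fun x hx v hv => ?_⟩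
    · have h1 : (fun y => ricci N y (ext v y) (ext v' y)) =ᶠ[𝓝 x]
          fun y => c * g y (ext v y) (ext v' y) := by
        filter_upwards [isOpen_int.mem_nhds hx] with z hz
        exact hRic z hz _ _
      have hd : DiffFnAt n (fun y => g y (ext v y) (ext v' y)) x :=
        diffFnAt_bilin x (mem_dom x) (β := fun y v w => g y v w) (b := gC g x)
          (fun c d => (gC_smooth hg ((isOpen_dom x).inter isOpen_int) Set.inter_subset_right
            Set.inter_subset_left c d).diffFnAt ((isOpen_dom x).inter isOpen_int) ⟨mem_dom x, hx⟩)
          (by filter_upwards [(isOpen_dom (n := n) x).mem_nhds (mem_dom x)] with z hz v v'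
              exact eq_sum_gC hz v v') v v'
      have h2 := hLC.2 x hx a v v'
      rw [covDerivBilin] at h2 ⊢
      rw [dAt_congr h1, dAt_mul (DiffFnAt.const c x) hd, dAt_const, hRic x hx, hRic x hx]
      linear_combination c * h2
    · refine hg.nondegenerate x hx v fun v' => ?_
      have h := hv v'
      rw [hRic x hx] at h
      exact (mul_eq_zero.1 h).resolve_left hc
  · rintro ⟨⟨κ, hκ⟩, hpar, hnd⟩
    have hw : ∀ x : M, IsOpen (dom n x ∩ int n M) := fun x => (isOpen_dom x).inter isOpen_int
    have happ : ∀ x ∈ int n M, ∀ v v' : T n x, ricciForm (n := n) N x v v' = ricci N x v v' := fun x hx =>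
      ricciForm_apply hN hx
    refine ⟨ricciForm N, ⟨fun x hx v v' => ?_, fun x hx v hv => ?_, fun X Y hX hY x hx => ?_⟩,
      ⟨hN, fun x hx a v v' => ?_⟩, 1, one_ne_zero, fun x hx v v' => ?_⟩
    · rw [happ x hx, happ x hx, ricci_eq hN isOpen_int hx (mem_dom x),
        ricci_eq hN isOpen_int hx (mem_dom x), Finset.sum_comm]
      refine Finset.sum_congr rfl fun c _ => Finset.sum_congr rfl fun d _ => ?_
      rw [hκ.Ric_symm hN (hw x) Set.inter_subset_right Set.inter_subset_left ⟨mem_dom x, hx⟩ c d]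
      ring
    · exact hnd x hx v fun v' => by rw [← happ x hx]; exact hv v'
    · have hX' := (smoothVF_iff x (hw x) Set.inter_subset_left).1 (hX.mono Set.inter_subset_right)
      have hY' := (smoothVF_iff x (hw x) Set.inter_subset_left).1 (hY.mono Set.inter_subset_right)
      have hR := Ric_smooth hN isOpen_int (hw x) Set.inter_subset_right Set.inter_subset_left
      have h1 : SmoothFn n (fun z => ricciForm N z (X z) (Y z)) (dom n x ∩ int n M) :=
        (SmoothFn.sum _ fun j _ => SmoothFn.sum _ fun m _ => ((hX' j).mul (hY' m)).mul
          (hR j m)).congr fun z hz => by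
            rw [happ z hz.2, ricci_eq hN isOpen_int hz.2 hz.1]
      exact (h1.contMDiffAt ((hw x).mem_nhds ⟨mem_dom x, hx⟩)).contMDiffWithinAt
    · have h := hpar x hx a v v'
      rw [covDerivBilin] at h ⊢
      rw [← h, happ x hx, happ x hx]
      congr 3
      refine dAt_congr ?_
      filter_upwards [isOpen_int.mem_nhds hx] with z hz
      exact happ z hz _ _
    · rw [happ x hx, one_mul]

end Ricci

end

section

variable {n : ℕ} {M : Type*} [TopologicalSpace M] [ChartedSpace (EuclideanHalfSpace (n + 1)) M]
  [IsManifold (𝓡∂ (n + 1)) ∞ M] {D N : ConnOp n M} {p : M} {w : Set M}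

/-! ### One-forms from components -/

lemma clm_ext_fr {y : M} (hyp : y ∈ dom n p) {L L' : T n y →L[ℝ] ℝ}
    (h : ∀ a, L (fr p a y) = L' (fr p a y)) : L = L' := by
  ext v
  rw [← sum_co_fr p hyp v]
  simp only [map_sum, map_smul, h]

/-- The one-form with given components. -/
def oneForm (p : M) (f : Fin (n + 1) → M → ℝ) (y : M) : T n y →L[ℝ] ℝ :=
  haveI : FiniteDimensional ℝ (T n y) :=
    inferInstanceAs (FiniteDimensional ℝ (EuclideanSpace ℝ (Fin (n + 1))))
  haveI : T2Space (T n y) := inferInstanceAs (T2Space (EuclideanSpace ℝ (Fin (n + 1))))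
  LinearMap.toContinuousLinearMap (∑ a, f a y • co p a y)

lemma oneForm_apply (f : Fin (n + 1) → M → ℝ) (y : M) (v : T n y) :
    oneForm p f y v = ∑ a, f a y * co p a y v := by
  simp [oneForm]

lemma oneForm_apply_fr (f : Fin (n + 1) → M → ℝ) {y : M} (hyp : y ∈ dom n p) (a : Fin (n + 1)) :
    oneForm p f y (fr p a y) = f a y := by
  simp [oneForm_apply, co_fr p hyp]

lemma smoothOneFormOn_oneForm {f : Fin (n + 1) → M → ℝ} (hw : IsOpen w) (hwp : w ⊆ dom n p)
    (hf : ∀ a, SmoothFn n (f a) w) : SmoothOneFormOn (oneForm p f) w := by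
  intro X hX
  exact (SmoothFn.sum _ fun a _ => (hf a).mul ((smoothVF_iff p hw hwp).1 hX a)).congr
    fun z _ => oneForm_apply f z _

/-! ### Composition of projective changes -/

lemma ProjectivelyEquivalentOn.trans [T2Space M] {D D' D'' : ConnOp n M} {u : Set M}
    (hu : IsOpen u) (h : ProjectivelyEquivalentOn D D' Set.univ)
    (h' : ProjectivelyEquivalentOn D' D'' u) : ProjectivelyEquivalentOn D D'' u := by
  obtain ⟨Υ, hΥ, hc⟩ := h
  obtain ⟨Υ', hΥ', hc'⟩ := h'
  refine ⟨fun x => Υ x + Υ' x, fun X hX => ?_, fun η x hx hη ξ => ?_⟩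
  · exact ((hΥ.apply hu (Set.subset_univ u) hX).add (hΥ' X hX)).congr fun z _ => rfl
  · rw [hc' η x hx hη, hc η x (Set.mem_univ x) hη]
    simp only [add_apply, add_smul]
    abel

/-- This permits any member of the class as background connection, so the tractor statements can be
proved separately in each splitting. -/
lemma ProjectiveStructure.HasOnInterior.projectivelyEquivalentOn [T2Space M]
    {P : ProjectiveStructure n M} (h : P.HasOnInterior N) (hD : D ∈ P.conns) :
    ProjectivelyEquivalentOn D N (int n M) := by
  obtain ⟨-, D', hD', hc⟩ := h
  exact ((P.mem_iff D hD D' (P.isAffineConnection D' hD')).1 hD').trans isOpen_int hc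

/-! ### Vanishing of the density on the boundary -/

/-- Where `t` is non-zero the form -ν/t is smooth and equals Υ on the interior; adding it to `D`
would extend `N` across the boundary point. -/
lemma DoesNotExtend.eq_zero [T2Space M] (hN : DoesNotExtend N)
    (hD : IsAffineConnectionOn D Set.univ) {Υ : (x : M) → T n x →L[ℝ] ℝ}
    (hDN : IsProjectiveChangeOn D N Υ (int n M)) (hw : IsOpen w) (hwp : w ⊆ dom n p) {t : M → ℝ}
    (ht : SmoothFn n t w)
    (hν : ∀ y ∈ w, y ∈ int n M → ∀ a, nuC D p t a y = -(Up Υ p a y * t y)) {y : M} (hy : y ∈ w)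
    (hyb : y ∈ (𝓡∂ (n + 1)).boundary M) : t y = 0 := by
  by_contra h0
  have hU : IsOpen (w ∩ t ⁻¹' {0}ᶜ) :=
    ht.continuousOn.isOpen_inter_preimage hw isOpen_compl_singleton
  have hUw : w ∩ t ⁻¹' {0}ᶜ ⊆ w := Set.inter_subset_left
  have hsm : SmoothOneFormOn (oneForm p fun a z => -(nuC D p t a z * (t z)⁻¹))
      (w ∩ t ⁻¹' {0}ᶜ) := by
    refine smoothOneFormOn_oneForm hU (hUw.trans hwp) fun a => ?_
    have h1 := (nuC_smooth hD isOpen_univ hw (Set.subset_univ w) hwp ht a).mono hUw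
    have h2 : SmoothFn n (fun z => (t z)⁻¹) (w ∩ t ⁻¹' {0}ᶜ) :=
      SmoothFn.comp (F := fun r => r⁻¹) (ht.mono hUw) fun z hz => contDiffAt_inv ℝ hz.2
    exact (h1.mul h2).neg
  refine hN y hyb ⟨_, projChange D _, hU, ⟨hy, h0⟩, hD.projChange hU hsm, fun η z hz hη => ?_⟩
  have hΥ : oneForm p (fun a z => -(nuC D p t a z * (t z)⁻¹)) z = Υ z := by
    refine clm_ext_fr (hwp hz.1.1) fun a => ?_
    have hz0 : t z ≠ 0 := hz.1.2
    rw [oneForm_apply_fr _ (hwp hz.1.1), hν z hz.1.1 hz.2, Up]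
    field_simp
  ext1 ξ
  rw [projChange_apply, hDN η z hz.2 hη, hΥ]

/-! ### Congruence of the splitting -/

section Congr

variable {s t : M → ℝ}

lemma nuC_congr (hw : IsOpen w) (h : ∀ y ∈ w, s y = t y) {y : M} (hy : y ∈ w) (a : Fin (n + 1)) :
    nuC D p s a y = nuC D p t a y := by
  rw [nuC, nuC, cdS, cdS, pd_congr_of_eqOn p a hw h hy, h y hy]

lemma cdF_congr {r : ℝ} {b c : Fin (n + 1) → M → ℝ} (hw : IsOpen w)
    (h : ∀ i, ∀ y ∈ w, b i y = c i y) {y : M} (hy : y ∈ w) (i j : Fin (n + 1)) :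
    cdF r D p i j b y = cdF r D p i j c y := by
  simp only [cdF, pd_congr_of_eqOn p i hw (h j) hy, fun e => h e y hy]

lemma cdB_congr {r : ℝ} {b c : Fin (n + 1) → Fin (n + 1) → M → ℝ} (hw : IsOpen w)
    (h : ∀ i j, ∀ y ∈ w, b i j y = c i j y) {y : M} (hy : y ∈ w) (i j k : Fin (n + 1)) :
    cdB r D p i j k b y = cdB r D p i j k c y := by
  simp only [cdB, pd_congr_of_eqOn p i hw (h j k) hy, fun e f => h e f y hy]

lemma rhoC_congr (hw : IsOpen w) (h : ∀ y ∈ w, s y = t y) {y : M} (hy : y ∈ w)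
    (a b : Fin (n + 1)) : rhoC D p s a b y = rhoC D p t a b y := by
  have h1 := fun i j => cdF_congr (D := D) (p := p) (r := wt n) hw
    (fun a y hy => nuC_congr (D := D) (p := p) hw h hy a) hy i j
  rw [rhoC, rhoC, h1, h1, h y hy]

lemma Hm_congr (hw : IsOpen w) (h : ∀ y ∈ w, s y = t y) {y : M} (hy : y ∈ w) :
    Hm D p s y = Hm D p t y := by
  ext A B
  cases A <;> cases B
  · exact h y hy
  · exact nuC_congr hw h hy _
  · exact nuC_congr hw h hy _
  · exact rhoC_congr hw h hy _ _

end Congr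

/-! ### The density determined by a parallel volume density -/

/-- The power `|κ| ^ (-2 / (n + 2))` of a volume density. -/
def powDens {x : M} (φ : Dens n 1 x) : Dens n (wt n) x :=
  densityOfBasis (wt n) (tBasis x) (|φ.1 (tBasis x)| ^ wt n)

lemma powDens_apply {x : M} (φ : Dens n 1 x) {e : Fin (n + 1) → T n x}
    (he : LinearIndependent ℝ e) : (powDens φ).1 e = |φ.1 e| ^ wt n := by
  have hfin : Module.finrank ℝ (T n x) = n + 1 := by
    rw [Module.finrank_eq_card_basis (tBasis x), Fintype.card_fin]
  obtain ⟨b, rfl⟩ : ∃ b : Module.Basis (Fin (n + 1)) ℝ (T n x), ⇑b = e :=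
    ⟨basisOfLinearIndependentOfCardEqFinrank he (by simp [hfin]),
      coe_basisOfLinearIndependentOfCardEqFinrank he _⟩
  rw [density_apply_basis (powDens φ) (tBasis x) b, density_apply_basis φ (tBasis x) b, powDens,
    densityOfBasis_apply_self, Real.rpow_one, abs_mul, abs_abs,
    Real.mul_rpow (abs_nonneg _) (abs_nonneg _)]

open Classical in
/-- The density `|κ| ^ (-2 / (n + 2))` on the interior, extended by zero. -/
def extDens (κ : (x : M) → Dens n 1 x) (x : M) : Dens n (wt n) x :=
  if x ∈ int n M then powDens (κ x) else 0

lemma fr_linearIndependent {y : M} (hyp : y ∈ dom n p) :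
    LinearIndependent ℝ fun i => fr (n := n) p i y := by
  rw [← frBasis_coe p hyp]
  exact (frBasis p hyp).linearIndependent

lemma dcomp_extDens_int (κ : (x : M) → Dens n 1 x) {y : M} (hyp : y ∈ dom n p)
    (hy : y ∈ int n M) : dcomp p (extDens κ) y = |dcomp p κ y| ^ wt n := by
  rw [dcomp, extDens, if_pos hy, powDens_apply _ (fr_linearIndependent hyp), dcomp]

lemma dcomp_extDens_boundary (κ : (x : M) → Dens n 1 x) {y : M} (hy : y ∉ int n M) :
    dcomp p (extDens κ) y = 0 := by
  rw [dcomp, extDens, if_neg hy]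
  rfl

end

section

variable {n : ℕ} {M : Type*} [TopologicalSpace M] [ChartedSpace (EuclideanHalfSpace (n + 1)) M]
  [IsManifold (𝓡∂ (n + 1)) ∞ M] {D N : ConnOp n M} {p : M} {w : Set M}

/-! ### Boundary behaviour of the extended density. -/

section Main

variable [T2Space M] {κ : (x : M) → Dens n 1 x} {Υ : (x : M) → T n x →L[ℝ] ℝ}

/-- Around every point, the extended density is smooth and its splitting is parallel and
non-degenerate. -/
lemma exists_nhds_extDens (hD : IsAffineConnectionOn D Set.univ)
    (hN : IsAffineConnectionOn N (int n M)) (hRp : RicciParallel N) (hR : RicciNondegenerate N)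
    (hκ : IsParallelVolume N κ) (hΥ : SmoothOneFormOn Υ (int n M))
    (hDN : IsProjectiveChangeOn D N Υ (int n M)) (hne : DoesNotExtend N) (x : M) :
    ∃ w : Set M, IsOpen w ∧ x ∈ w ∧ w ⊆ dom n x ∧ SmoothFn n (dcomp x (extDens κ)) w ∧
      (∀ y ∈ w, y ∈ int n M → ∀ a, nuC D x (dcomp x (extDens κ)) a y =
        -(Up Υ x a y * dcomp x (extDens κ) y)) ∧
      ∀ y ∈ w,
        (∀ a b, cdF (wt n) D x a b (nuC D x (dcomp x (extDens κ))) y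
          + Sch D x a b y * dcomp x (extDens κ) y - rhoC D x (dcomp x (extDens κ)) a b y = 0) ∧
        (∀ a b c, cdB (wt n) D x a b c (rhoC D x (dcomp x (extDens κ))) y
          + Sch D x a b y * nuC D x (dcomp x (extDens κ)) c y
          + Sch D x a c y * nuC D x (dcomp x (extDens κ)) b y = 0) ∧
        ∃ G : Matrix (Option (Fin (n + 1))) (Option (Fin (n + 1))) ℝ,
          Hm D x (dcomp x (extDens κ)) y * G = 1 := by
  obtain ⟨w, t, hw, hxw, hwp, ht, htκ, hν, hE⟩ :=
    exists_density_extension hD hN hRp hR hκ hΥ hDN x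
  have h : ∀ y ∈ w, dcomp x (extDens κ) y = t y := by
    intro y hy
    by_cases hyi : y ∈ int n M
    · rw [dcomp_extDens_int κ (hwp hy) hyi, htκ y hy hyi]
    · rw [dcomp_extDens_boundary κ hyi,
        hne.eq_zero hD hDN hw hwp ht hν hy (not_mem_int_iff.1 hyi)]
  refine ⟨w, hw, hxw, hwp, ht.congr h, fun y hy hyi a => ?_, fun y hy => ?_⟩
  · rw [nuC_congr hw h hy, hν y hy hyi, h y hy]
  · have h1 : ∀ a, ∀ y ∈ w, nuC D x (dcomp x (extDens κ)) a y = nuC D x t a y :=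
      fun a y hy => nuC_congr hw h hy a
    have h2 : ∀ a b, ∀ y ∈ w, rhoC D x (dcomp x (extDens κ)) a b y = rhoC D x t a b y :=
      fun a b y hy => rhoC_congr hw h hy a b
    have hy' := hE y hy
    simp only [cdF_congr hw h1 hy, cdB_congr hw h2 hy, h1 _ y hy, h2 _ _ y hy, h y hy,
      Hm_congr hw h hy]
    exact hy'

lemma eq_zero_of_Hm_mul_eq_one {s : M → ℝ} {y : M}
    {G : Matrix (Option (Fin (n + 1))) (Option (Fin (n + 1))) ℝ} (hG : Hm D p s y * G = 1) (a : ℝ)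
    (v : Fin (n + 1) → ℝ) (h1 : a * s y + ∑ b, v b * nuC D p s b y = 0)
    (h2 : ∀ c, a * nuC D p s c y + ∑ b, v b * rhoC D p s b c y = 0) : a = 0 ∧ v = 0 := by
  let V : Option (Fin (n + 1)) → ℝ := fun o => o.elim a v
  have h : Matrix.vecMul V (Hm D p s y) = 0 := by
    funext o
    rw [Matrix.vecMul, dotProduct, Fintype.sum_option]
    cases o
    · exact h1
    · exact h2 _
  have hV : V = 0 := by
    have h3 := congrArg (fun X => Matrix.vecMul X G) h
    simpa [Matrix.vecMul_vecMul, hG] using h3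
  exact ⟨congrFun hV none, funext fun b => congrFun hV (some b)⟩

/-- The local representative of the extended density is a defining function of the boundary. -/
lemma isDefiningFunctionOn_dcomp_extDens {x : M} (hκ : IsParallelVolume N κ)
    (hwp : w ⊆ dom n x) (hs : SmoothFn n (dcomp x (extDens κ)) w)
    (hG : ∀ y ∈ w, ∃ G : Matrix (Option (Fin (n + 1))) (Option (Fin (n + 1))) ℝ,
      Hm D x (dcomp x (extDens κ)) y * G = 1) :
    IsDefiningFunctionOn (n := n) (dcomp x (extDens κ)) w := by
  have hpos : ∀ y ∈ w, y ∈ int n M → 0 < dcomp x (extDens κ) y := fun y hy hyi => by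
    rw [dcomp_extDens_int κ (hwp hy) hyi]
    exact Real.rpow_pos_of_pos (abs_pos.2 (hκ.dcomp_ne_zero hyi (hwp hy))) _
  refine ⟨hs, fun y hy => ?_, fun y hy => ⟨fun h0 => ?_, fun hb => ?_⟩, fun y hy h0 hd => ?_⟩
  · by_cases hyi : y ∈ int n M
    · exact (hpos y hy hyi).le
    · exact (dcomp_extDens_boundary κ hyi).ge
  · exact not_mem_int_iff.1 fun hyi => (hpos y hy hyi).ne' h0
  · exact dcomp_extDens_boundary κ (not_mem_int_iff.2 hb)
  · obtain ⟨G, hG⟩ := hG y hy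
    -- If both the function and its differential vanish, the whole `none` row of the matrix is zero,
    -- so the vector (1, 0) contradicts invertibility.
    have hν : ∀ a, nuC D x (dcomp x (extDens κ)) a y = 0 := fun a => by
      rw [nuC, cdS, pd, hd, h0]
      simp
    have h := eq_zero_of_Hm_mul_eq_one hG 1 0 (by simp [h0]) (by simp [hν])
    exact one_ne_zero h.1

open Classical in
/-- The density which takes the value `1` on the coordinate frame. -/
def frameDens (r : ℝ) (p y : M) : Dens n r y :=
  if hy : y ∈ dom n p then densityOfBasis r (frBasis p hy) 1 else 0

lemma dcomp_frameDens (r : ℝ) {y : M} (hyp : y ∈ dom n p) :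
    dcomp (n := n) p (frameDens r p) y = 1 := by
  rw [dcomp, frameDens, dif_pos hyp]
  have h := densityOfBasis_apply_self r (frBasis p hyp) 1
  rwa [frBasis_coe] at h

lemma isDefiningDensity_extDens
    (h : ∀ x : M, ∃ w : Set M, IsOpen w ∧ x ∈ w ∧ w ⊆ dom n x ∧
      SmoothFn n (dcomp x (extDens κ)) w ∧
      IsDefiningFunctionOn (n := n) (dcomp x (extDens κ)) w) : IsDefiningDensity (extDens κ) := by
  refine ⟨smoothDensOn_of_dcomp fun x _ => ?_, fun x => ?_, fun x hx => ?_⟩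
  · obtain ⟨w, hw, hxw, hwp, hs, -⟩ := h x
    exact ⟨x, w, hw, hxw, hwp, hs⟩
  · obtain ⟨w, hw, hxw, hwp, -, hd⟩ := h x
    rw [← hd.zero_iff x hxw, density_eq_zero_iff _ (frBasis x (mem_dom x)), frBasis_coe]
    rfl
  · obtain ⟨w, hw, hxw, hwp, hs, hd⟩ := h x
    refine ⟨w, frameDens (wt n) x, _, hw, hxw, smoothDensOn_of_dcomp fun y hy =>
      ⟨x, w, hw, hy, hwp, ?_⟩, fun y hy h0 => ?_, hd, fun y hy => ?_⟩
    · exact ((contMDiff_const (c := (1 : ℝ))).contMDiffOn).congr fun z hz =>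
        dcomp_frameDens _ (hwp hz)
    · have h1 := dcomp_frameDens (n := n) (wt n) (hwp hy)
      rw [dcomp, h0] at h1
      exact zero_ne_one h1
    · refine eq_of_dcomp_eq x (hwp hy) _ _ ?_
      have h1 := dcomp_frameDens (n := n) (wt n) (hwp hy)
      rw [dcomp] at h1
      change _ = dcomp x (extDens κ) y * (frameDens (wt n) x y).1 fun i => fr x i y
      rw [h1, mul_one]
      rfl

/-- The relation ν = -Υ s says ds = wt γ s - 2 Υ s, where γ is the trace of the connection form of
`D`. Hence Υ + ds/(2s) = (wt/2) γ: the singularities cancel, and `N` + ds/(2s) is `D` changed by a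
form smooth up to the boundary. -/
lemma isProjectivelyCompact_two (hD : IsAffineConnectionOn D Set.univ)
    (hDN : IsProjectiveChangeOn D N Υ (int n M))
    (h : ∀ x : M, ∃ (w : Set M) (s : M → ℝ), IsOpen w ∧ x ∈ w ∧ w ⊆ dom n x ∧
      (∀ y ∈ w, y ∈ int n M → ∀ a, nuC D x s a y = -(Up Υ x a y * s y)) ∧
      IsDefiningFunctionOn (n := n) s w) : IsProjectivelyCompact 2 N := by
  intro x _
  obtain ⟨w, s, hw, hxw, hwp, hν, hs⟩ := h x
  have hsm : SmoothOneFormOn (oneForm x fun a z => wt n / 2 * gam D x a z) w :=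
    smoothOneFormOn_oneForm hw hwp fun a =>
      SmoothFn.const_mul _ (gam_smooth hD isOpen_univ hw (Set.subset_univ w) hwp a)
  refine ⟨w, s, projChange D _, hw, hxw, hs, hD.projChange hw hsm, fun η z hz hη ξ => ?_⟩
  have hz0 : s z ≠ 0 := fun h0 =>
    not_mem_int_iff.2 ((hs.zero_iff z hz.1).1 h0) hz.2
  have hΥ : oneForm x (fun a z => wt n / 2 * gam D x a z) z =
      Υ z + (2 * s z)⁻¹ • dAt (n := n) s z := by
    refine clm_ext_fr (hwp hz.1) fun a => ?_
    have h1 := hν z hz.1 hz.2 a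
    rw [nuC, cdS] at h1
    rw [oneForm_apply_fr _ (hwp hz.1), add_apply, smul_apply, ← pd, ← Up, smul_eq_mul]
    have h2 : pd x a s z = wt n * gam D x a z * s z - 2 * (Up Υ x a z * s z) := by
      linear_combination 2 * h1
    rw [h2]
    field_simp
    ring
  rw [projChange_apply, hΥ, hDN η z hz.2 hη]
  simp only [add_apply, add_smul]
  abel

end Main

end

end ProjCompact

end

theorem theorem3 (n : ℕ) (M : Type*) [TopologicalSpace M] [T2Space M]
    [ChartedSpace (EuclideanHalfSpace (n + 1)) M] [IsManifold (𝓡∂ (n + 1)) ∞ M]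
    (p : ProjCompact.ProjectiveStructure n M) (nabla : ProjCompact.ConnOp n M)
    (hnabla : p.HasOnInterior nabla) :
    (ProjCompact.IsLeviCivitaOfNonRicciFlatEinstein nabla ↔
      ProjCompact.IsSpecial nabla ∧ ProjCompact.RicciParallel nabla ∧
        ProjCompact.RicciNondegenerate nabla) ∧
    (ProjCompact.IsLeviCivitaOfNonRicciFlatEinstein nabla ∨
        (ProjCompact.IsSpecial nabla ∧ ProjCompact.RicciParallel nabla ∧
          ProjCompact.RicciNondegenerate nabla) →
      ProjCompact.DoesNotExtend nabla →
      ProjCompact.IsProjectivelyCompact 2 nabla ∧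
      ∀ κ : (x : M) → ProjCompact.Dens n 1 x, ProjCompact.IsParallelVolume nabla κ →
        ∃ τ : (x : M) → ProjCompact.ProjDens n 2 x,
          (∀ x ∈ (𝓡∂ (n + 1)).interior M, ∀ e : Fin (n + 1) → ProjCompact.T n x,
            LinearIndependent ℝ e → (τ x).1 e = |(κ x).1 e| ^ (-2 / ((n : ℝ) + 2))) ∧
          (∀ x ∈ (𝓡∂ (n + 1)).boundary M, τ x = 0) ∧
          ProjCompact.IsDefiningDensity τ ∧
          ProjCompact.IsNormalBGGSolution p τ ∧
          ∀ D ∈ p.conns, (ProjCompact.splitting D τ).IsNondegenerate) := by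
  have hN := hnabla.1
  have key := ProjCompact.isLeviCivita_iff hN
  refine ⟨key, fun hor hne => ?_⟩
  obtain ⟨⟨κ₀, hκ₀⟩, hRp, hR⟩ := hor.elim key.1 id
  obtain ⟨D₀, hD₀⟩ := p.nonempty
  refine ⟨?_, fun κ hκ => ⟨ProjCompact.extDens κ, fun x hx e he => ?_, fun x hx => ?_, ?_,
    fun D hD x a v v' => ?_, fun D hD x a v hav => ?_⟩⟩
  -- Any parallel volume density and any connection in the class serve to produce local defining
  -- functions; `κ₀` comes from specialness.
  · obtain ⟨Υ, hΥ, hDN⟩ := hnabla.projectivelyEquivalentOn hD₀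
    refine ProjCompact.isProjectivelyCompact_two (p.isAffineConnection D₀ hD₀) hDN fun x => ?_
    obtain ⟨w, hw, hxw, hwp, hs, hν, hE⟩ := ProjCompact.exists_nhds_extDens
      (p.isAffineConnection D₀ hD₀) hN hRp hR hκ₀ hΥ hDN hne x
    exact ⟨w, _, hw, hxw, hwp, hν,
      ProjCompact.isDefiningFunctionOn_dcomp_extDens hκ₀ hwp hs fun y hy => (hE y hy).2.2⟩
  · rw [ProjCompact.extDens, if_pos hx, ProjCompact.powDens_apply _ he]
  · rw [ProjCompact.extDens, if_neg (ProjCompact.not_mem_int_iff.2 hx)]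
  · obtain ⟨Υ, hΥ, hDN⟩ := hnabla.projectivelyEquivalentOn hD₀
    refine ProjCompact.isDefiningDensity_extDens fun x => ?_
    obtain ⟨w, hw, hxw, hwp, hs, hν, hE⟩ := ProjCompact.exists_nhds_extDens
      (p.isAffineConnection D₀ hD₀) hN hRp hR hκ hΥ hDN hne x
    exact ⟨w, hw, hxw, hwp, hs,
      ProjCompact.isDefiningFunctionOn_dcomp_extDens hκ hwp hs fun y hy => (hE y hy).2.2⟩
  -- The local extension is rebuilt with the given `D` as background, so no invariance of the
  -- tractor connection under change of splitting is needed.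
  · obtain ⟨Υ, hΥ, hDN⟩ := hnabla.projectivelyEquivalentOn hD
    obtain ⟨w, hw, hxw, hwp, hs, -, hE⟩ := ProjCompact.exists_nhds_extDens
      (p.isAffineConnection D hD) hN hRp hR hκ hΥ hDN hne x
    exact ProjCompact.splitting_isParallel_at (p.isAffineConnection D hD) isOpen_univ hw
      (Set.subset_univ w) hwp hs hxw (hE x hxw).1 (hE x hxw).2.1 a v v'
  · obtain ⟨Υ, hΥ, hDN⟩ := hnabla.projectivelyEquivalentOn hD
    obtain ⟨w, hw, hxw, hwp, hs, -, hE⟩ := ProjCompact.exists_nhds_extDens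
      (p.isAffineConnection D hD) hN hRp hR hκ hΥ hDN hne x
    obtain ⟨G, hG⟩ := (hE x hxw).2.2
    exact ProjCompact.splitting_isNondegenerate_at (p.isAffineConnection D hD) isOpen_univ hw
      (Set.subset_univ w) hwp hs hxw (fun a v h1 h2 =>
        ProjCompact.eq_zero_of_Hm_mul_eq_one hG a v h1 h2) a v hav
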